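/- Let $A,B$ be finite sequences of integers. A pair of positions $(x,y)$ is a $\sigma$-pair if $A[x]=B[y]=\sigma$, and a matching pair if it is a $\sigma$-pair for some $\sigma$. For matching pairs write $(x,y)\le(x',y')$ if $x\le x'$ and $y\le y'$, and $(x,y)\prec(x',y')$ if $x<x'$, $y<y'$ and $A[x]<A[x']$. A common increasing subsequence is a sequence of matching pairs $(x_1,y_1)\prec\cdots\prec(x_s,y_s)$; an LCIS is one of maximal length $s$. Let $\mathrm{lcis}^{\to}(x,y)$ be the maximal length of a common increasing subsequence ending with the matching pair $(x,y)$. A $\sigma$-pair $(x,y)$ is significant if $\mathrm{lcis}^{\to}(x',y')<\mathrm{lcis}^{\to}(x,y)$ for every $\sigma$-pair $(x',y')\le(x,y)$ with $(x',y')\ne(x,y)$. Theorem. Let $t=t(n)$ be a function, positive for all large $n$, with $\log t=\Theta(\log\log n)$. There is a deterministic algorithm which, given $A$ and $B$, finds an LCIS of $A$ and $B$, and whose running time is $O\!\left(\frac{n^2(\log\log n)^2}{\sqrt{t}}\right)$ on all inputs with $|A|,|B|\le n$ that have at most $O\!\left(\frac{n^2}{t}\right)$ significant pairs. Precisely: for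 every constant $C$ there are $K$ and $N$ such that for all $n\ge N$ and all $A,B$ with $|A|,|B|\le n$ and at most $C\,n^2/t(n)$ significant pairs, the algorithm stops after at most $K\,n^2(\log\log n)^2/\sqrt{t(n)}$ steps. The machine is a word RAM with unit-cost instructions (constants, addition, subtraction, multiplication, integer division, indirect load and store, jumps and comparison jumps), whose memory is not initialized apart from the input, and whose word length is any $w$ such that the entries of $A$ and $B$ fit into a word and $w\ge\kappa\log_2(|A|+|B|+2)$, with a constant $\kappa$ belonging to the algorithm. -/

import Mathlib

open Filter Asymptotics

/-! ## Common increasing subsequences and significant pairs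

The input sequences are lists of integers. Positions are counted from `0`. -/

namespace LCIS

/-- `(x, y)` is a `σ`-pair of `A` and `B`: `A[x] = B[y] = σ` (in particular both positions exist). -/
def IsSigmaPair (A B : List ℤ) (σ : ℤ) (p : ℕ × ℕ) : Prop :=
  A[p.1]? = some σ ∧ B[p.2]? = some σ

/-- `(x, y)` is a matching pair of `A` and `B`. -/
def IsMatching (A B : List ℤ) (p : ℕ × ℕ) : Prop :=
  ∃ σ, IsSigmaPair A B σ p

/-- The strict order `p ≺ q` on matching pairs: both coordinates and the symbol increase. -/
def Prec (A B : List ℤ) (p q : ℕ × ℕ) : Prop :=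
  p.1 < q.1 ∧ p.2 < q.2 ∧ ∃ σ τ, IsSigmaPair A B σ p ∧ IsSigmaPair A B τ q ∧ σ < τ

/-- A common increasing subsequence of `A` and `B`: matching pairs `p₁ ≺ p₂ ≺ ⋯ ≺ pₛ`. -/
def IsCIS (A B : List ℤ) (L : List (ℕ × ℕ)) : Prop :=
  (∀ p ∈ L, IsMatching A B p) ∧ L.IsChain (Prec A B)

/-- A longest common increasing subsequence. -/
def IsLongestCIS (A B : List ℤ) (L : List (ℕ × ℕ)) : Prop :=
  IsCIS A B L ∧ ∀ L', IsCIS A B L' → L'.length ≤ L.length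

/-- The maximal length of a common increasing subsequence that ends with the matching pair `p`.
(The set is bounded, the first coordinates being distinct positions of `A`, and it is non-empty
when `p` is a matching pair.) -/
noncomputable def lcisTo (A B : List ℤ) (p : ℕ × ℕ) : ℕ :=
  sSup {k | ∃ L, IsCIS A B L ∧ L.getLast? = some p ∧ L.length = k}

/-- `p` is a significant pair: it is a `σ`-pair for some `σ`, and every other `σ`-pair `q ≤ p`
(coordinatewise) has a strictly smaller value of `lcisTo`. -/
def IsSignificant (A B : List ℤ) (p : ℕ × ℕ) : Prop :=
  ∃ σ, IsSigmaPair A B σ p ∧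
    ∀ q, IsSigmaPair A B σ q → q ≤ p → q ≠ p → lcisTo A B q < lcisTo A B p

open scoped Classical in
/-- The number of significant pairs of `A` and `B`. -/
noncomputable def numSignificant (A B : List ℤ) : ℕ :=
  ((Finset.range A.length ×ˢ Finset.range B.length).filter (IsSignificant A B)).card

end LCIS

/-! ## The word RAM -/

namespace WordRAM

/-- Instructions. Natural-number arguments `d a b` are register names; `ℓ` is the index of an
instruction of the program. Every instruction costs one step. -/
inductive Instr where
  /-- `r[d] := c` -/
  | const (d : ℕ) (c : ℤ)
  /-- `r[d] := r[a] + r[b]` -/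
  | add (d a b : ℕ)
  /-- `r[d] := r[a] - r[b]` -/
  | sub (d a b : ℕ)
  /-- `r[d] := r[a] * r[b]` -/
  | mul (d a b : ℕ)
  /-- `r[d] := r[a] / r[b]`, integer division -/
  | div (d a b : ℕ)
  /-- `r[d] := mem[r[a]]` -/
  | load (d a : ℕ)
  /-- `mem[r[a]] := r[b]` -/
  | store (a b : ℕ)
  /-- continue with instruction `ℓ` -/
  | jump (ℓ : ℕ)
  /-- continue with instruction `ℓ` if `r[a] < r[b]`, with the next instruction otherwise -/
  | jumpLt (a b : ℕ) (ℓ : ℕ)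
  /-- stop -/
  | halt

/-- A program is a finite list of instructions (so it uses finitely many registers). -/
abbrev Program := List Instr

/-- A configuration: program counter, registers, memory. -/
structure State where
  pc : ℕ
  reg : ℕ → ℤ
  mem : ℕ → ℤ

/-- The integer `v` fits into a (signed) machine word of length `w`. -/
def Fits (w : ℕ) (v : ℤ) : Prop := |v| < 2 ^ w

instance (w : ℕ) (v : ℤ) : Decidable (Fits w v) := inferInstanceAs (Decidable (|v| < 2 ^ w))

/-- Write the result `v` into register `d` and go on; the machine crashes (`none`) on an overflow of
the word length `w`. -/
def State.setReg (w : ℕ) (s : State) (d : ℕ) (v : ℤ) : Option State :=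
  if Fits w v then some { s with pc := s.pc + 1, reg := Function.update s.reg d v } else none

/-- Execution of one instruction with word length `w`; `none` if the machine stops or crashes. -/
def exec (w : ℕ) (s : State) : Instr → Option State
  | .const d c => s.setReg w d c
  | .add d a b => s.setReg w d (s.reg a + s.reg b)
  | .sub d a b => s.setReg w d (s.reg a - s.reg b)
  | .mul d a b => s.setReg w d (s.reg a * s.reg b)
  | .div d a b => if s.reg b = 0 then none else s.setReg w d (s.reg a / s.reg b)
  | .load d a => if s.reg a < 0 then none else s.setReg w d (s.mem (s.reg a).toNat)
  | .store a b =>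
      if s.reg a < 0 then none
      else some { s with pc := s.pc + 1, mem := Function.update s.mem (s.reg a).toNat (s.reg b) }
  | .jump ℓ => some { s with pc := ℓ }
  | .jumpLt a b ℓ => some { s with pc := if s.reg a < s.reg b then ℓ else s.pc + 1 }
  | .halt => none

/-- One step of program `P`; leaving the program is a crash. -/
def step (w : ℕ) (P : Program) (s : State) : Option State :=
  (P[s.pc]?).bind (exec w s)

/-- The configuration after exactly `k` steps, if the machine has not stopped or crashed before. -/
def run (w : ℕ) (P : Program) : ℕ → State → Option State
  | 0, s => some s
  | k + 1, s => (step w P s).bind (run w P k)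

/-- From `s`, after exactly `k` steps, the program reaches a `halt` instruction in configuration
`s'`. -/
def HaltsIn (w : ℕ) (P : Program) (s : State) (k : ℕ) (s' : State) : Prop :=
  run w P k s = some s' ∧ P[s'.pc]? = some .halt

/-- `s` is an initial configuration for the input `A`, `B` and word length `w`: registers `0` and `1`
hold the two lengths, the first memory cells hold the entries of `A` followed by those of `B`, and
all the other registers and cells hold arbitrary words (so initialization has to be paid for). -/
def IsInput (w : ℕ) (A B : List ℤ) (s : State) : Prop :=
  s.pc = 0 ∧ s.reg 0 = A.length ∧ s.reg 1 = B.length ∧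
    (∀ i (h : i < (A ++ B).length), s.mem i = (A ++ B)[i]) ∧
    (∀ r, Fits w (s.reg r)) ∧ (∀ i, Fits w (s.mem i))

/-- `s` holds the list of pairs `L` as output: register `0` holds the length of `L`, register `1` an
address from which on the pairs are stored in consecutive cells. -/
def IsOutput (L : List (ℕ × ℕ)) (s : State) : Prop :=
  s.reg 0 = L.length ∧ ∃ a : ℕ, s.reg 1 = a ∧
    ∀ i (h : i < L.length), s.mem (a + 2 * i) = L[i].1 ∧ s.mem (a + 2 * i + 1) = L[i].2

end WordRAM

set_option linter.constructorNameAsVariable false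
set_option linter.unusedSimpArgs false

/-! ## A small imperative language and its compilation to the word RAM -/


namespace Imp

open WordRAM

/-! Only significant pairs matter. Below every matching pair lies a significant pair with the same
symbol and the same value (`exists_significant`), so a value is 1 or one more than the value of an
earlier significant pair (`val_eq`). Whether a pair is significant can be decided from the part of
its row to the left and from the significant pairs recorded in its column (`isSignificant_iff`). The
algorithm goes through the rows, that is the positions of `A`, and records exactly the significant
pairs of each row.

Let `N = |A| + |B| + 2` and `P = 2 ^ h`. The columns, that is the positions of `B`, are sorted by
symbol, and the symbol of every `(|B| / P + 1)`-th one becomes a pivot. A pivot is alone in its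
group; the symbols between pivots form groups with at most `|B| / P + 1` columns each
(`Par.good_of_sorted`). Every group has a tree of range maxima, `h` levels high, over the recorded
pairs of smaller groups. It is brought up to date only when a row of the group is processed
(`absorb_spec`, `query_spec`). In a row without a pivot symbol all columns of the group are scanned,
and a running maximum takes care of predecessors inside the group (`scanGroup_spec`). In a row with
a pivot symbol all predecessors lie in smaller groups, and a new significant pair must come from a
record absorbed since the previous row of that pivot, at the first column of the group after it
(`Recs.exists_new`, `scanRecords_spec`). A row thus costs `O((h + 1) (P + N / P))` plus `O(h + 1)`
for each absorbed record, and a group absorbs a record only once.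

A run is cut off beyond `(N / P) ^ 2` records. As `P ^ 2 ≤ N`, it costs `O((h + 1) N ^ 2 / P)`
(`run_cost`). Starting near the fourth root of `N`, the number `P` is halved after every run that
was cut off; the costs grow geometrically, so the last run dominates (`runAll_spec`). Either `P` was
never halved, or `(N / (2 P)) ^ 2` is at most the number of significant pairs, which bounds `N / P`
by `O(n / √t + 1)`. The claimed bound follows in both cases, because `h = O(log log n)` unless `P ≥
t` (`time_bound`). The program itself knows nothing about `t`.

The records are ordered by rows, so one backward sweep recovers an optimal sequence
(`traceBack_spec`).

The algorithm is written in a small language over natural numbers with weakest preconditions, a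
frame rule and a clock, and is compiled to the word RAM (`Cmd.comp_correct`, `Cmd.program_correct`).
Negative words are read as zero, so every initial memory represents some program state and nothing
has to be initialized. -/

/-- Program variables. -/
inductive Var where
  | a | b | m | p | h | sp | np | cap | cnt | x | y | z | i | j | k | l | lo | hi | mid | le | old | fin
  | u | cur | last | node | res | wd | lev | done
  deriving DecidableEq

/-- Program arrays, each of them three-dimensional. -/
inductive Arr where
  | sort | pv | grp | d | nxt | ptr | tree | pre | rz | ru | rg | rx | ox | oy
  deriving DecidableEq

/-- States of a program: variables, arrays, the input region, and a ghost clock. -/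
structure St where
  v : Var → ℕ
  a : Arr → ℕ → ℕ → ℕ → ℕ
  inp : ℕ → ℤ
  clk : ℕ

namespace St

def set (s : St) (x : Var) (n : ℕ) : St := { s with v := Function.update s.v x n }

def sto (s : St) (k : Arr) (i j l n : ℕ) : St :=
  { s with a := fun k' i' j' l' => if k' = k ∧ i' = i ∧ j' = j ∧ l' = l then n else s.a k' i' j' l' }

def put (s : St) (i : ℕ) (n : ℤ) : St := { s with inp := Function.update s.inp i n }

def tick (s : St) (n : ℕ) : St := { s with clk := s.clk + n }

variable (s : St) (x y : Var) (n : ℕ) (k k' : Arr) (i j l i' j' l' : ℕ) (z : ℤ)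

@[simp] theorem set_v : (s.set x n).v y = if y = x then n else s.v y := by
  simp [set, Function.update_apply]
@[simp] theorem set_a : (s.set x n).a = s.a := rfl
@[simp] theorem set_inp : (s.set x n).inp = s.inp := rfl
@[simp] theorem set_clk : (s.set x n).clk = s.clk := rfl
@[simp] theorem sto_v : (s.sto k i j l n).v = s.v := rfl
@[simp] theorem sto_a : (s.sto k i j l n).a k' i' j' l' =
    if k' = k ∧ i' = i ∧ j' = j ∧ l' = l then n else s.a k' i' j' l' := rfl
@[simp] theorem sto_inp : (s.sto k i j l n).inp = s.inp := rfl
@[simp] theorem sto_clk : (s.sto k i j l n).clk = s.clk := rfl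
@[simp] theorem put_v : (s.put i z).v = s.v := rfl
@[simp] theorem put_a : (s.put i z).a = s.a := rfl
@[simp] theorem put_inp : (s.put i z).inp j = if j = i then z else s.inp j := by
  simp [put, Function.update_apply]
@[simp] theorem put_clk : (s.put i z).clk = s.clk := rfl
@[simp] theorem tick_v : (s.tick n).v = s.v := rfl
@[simp] theorem tick_a : (s.tick n).a = s.a := rfl
@[simp] theorem tick_inp : (s.tick n).inp = s.inp := rfl
@[simp] theorem tick_clk : (s.tick n).clk = s.clk + n := rfl

end St

/-- Expressions over natural numbers; subtraction is truncated. -/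
inductive Expr where
  | var (x : Var)
  | lit (n : ℕ)
  | add (e f : Expr)
  | sub (e f : Expr)
  | mul (e f : Expr)
  | div (e f : Expr)
  | ld (k : Arr) (i j l : Expr)

instance : Add Expr := ⟨.add⟩
instance : Sub Expr := ⟨.sub⟩
instance : Mul Expr := ⟨.mul⟩
instance : Div Expr := ⟨.div⟩
instance (n : ℕ) : OfNat Expr n := ⟨.lit n⟩
instance : Coe Var Expr := ⟨.var⟩

/-- Conditions: comparison of numbers, and of two input entries. -/
inductive Cond where
  | lt (e f : Expr)
  | ilt (e f : Expr)

inductive Cmd where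
  | skip
  | assign (x : Var) (e : Expr)
  | store (k : Arr) (i j l e : Expr)
  | out (i e : Expr)
  | seq (c d : Cmd)
  | ite (t : Cond) (c d : Cmd)
  | whileDo (t : Cond) (c : Cmd)

infixl:50 " ≔ " => Cmd.assign
infixr:40 " ;; " => Cmd.seq

/-! ### Compilation -/

/-- Variables live in even registers; `a` is register `0`, which holds `|A|` at the start and the
output length at the end. The odd registers below `9` keep the constants `0`, `16`, the size of the
input and the bound on array indices; temporaries are the odd registers from `9` on. -/
def Var.reg (x : Var) : ℕ := 2 * x.ctorIdx

/-- Register `1` holds zero. Clamping turns arbitrary words into natural numbers and integer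
subtraction into truncated subtraction. -/
def clamp (r pos : ℕ) : List Instr := [.jumpLt 1 r (pos + 2), .const r 0]

/-- The `i`-th temporary register. -/
def tmp (i : ℕ) : ℕ := 2 * i + 9

/-- Turn the three indices in the temporaries `i`, `i + 1`, `i + 2` into an address. -/
def addrCode (k : Arr) (i t : ℕ) : List Instr :=
  [.mul (tmp i) (tmp i) 7, .add (tmp i) (tmp i) (tmp (i + 1)), .mul (tmp i) (tmp i) 7,
    .add (tmp i) (tmp i) (tmp (i + 2)), .mul (tmp i) (tmp i) 3, .add (tmp i) (tmp i) 5,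
    .const (tmp t) k.ctorIdx, .add (tmp i) (tmp i) (tmp t)]

namespace Expr

def cost : Expr → ℕ
  | var _ => 3
  | lit _ => 1
  | add e f => e.cost + f.cost + 1
  | sub e f => e.cost + f.cost + 3
  | mul e f => e.cost + f.cost + 1
  | div e f => e.cost + f.cost + 1
  | ld _ i j l => i.cost + j.cost + l.cost + 11

/-- The numbers are the position of the code, needed for its jump targets, and the first free
temporary, which receives the value. Adding register `1` serves as a move instruction. -/
def comp : Expr → ℕ → ℕ → List Instr
  | var x, pos, t => .add (tmp t) x.reg 1 :: clamp (tmp t) (pos + 1)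
  | lit n, _, t => [.const (tmp t) n]
  | add e f, pos, t => e.comp pos t ++ (f.comp (pos + e.cost) (t + 1) ++
      [.add (tmp t) (tmp t) (tmp (t + 1))])
  | sub e f, pos, t => e.comp pos t ++ (f.comp (pos + e.cost) (t + 1) ++
      (.sub (tmp t) (tmp t) (tmp (t + 1)) :: clamp (tmp t) (pos + e.cost + f.cost + 1)))
  | mul e f, pos, t => e.comp pos t ++ (f.comp (pos + e.cost) (t + 1) ++
      [.mul (tmp t) (tmp t) (tmp (t + 1))])
  | div e f, pos, t => e.comp pos t ++ (f.comp (pos + e.cost) (t + 1) ++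
      [.div (tmp t) (tmp t) (tmp (t + 1))])
  | ld k i j l, pos, t => i.comp pos t ++ (j.comp (pos + i.cost) (t + 1) ++
      (l.comp (pos + i.cost + j.cost) (t + 2) ++ (addrCode k t (t + 3) ++
        (.load (tmp t) (tmp t) :: clamp (tmp t) (pos + i.cost + j.cost + l.cost + 9)))))

theorem length_comp (e : Expr) : ∀ pos t, (e.comp pos t).length = e.cost := by
  induction e <;> intro pos t <;> simp_all [comp, cost, clamp, addrCode] <;> omega

def eval (s : St) : Expr → ℕ
  | var x => s.v x
  | lit n => n
  | add e f => e.eval s + f.eval s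
  | sub e f => e.eval s - f.eval s
  | mul e f => e.eval s * f.eval s
  | div e f => e.eval s / f.eval s
  | ld k i j l => s.a k (i.eval s) (j.eval s) (l.eval s)

/-- No overflow beyond `bd` and no division by zero. -/
def ok (bd : ℕ) (s : St) : Expr → Prop
  | var _ => True
  | lit n => n < bd
  | add e f => e.ok bd s ∧ f.ok bd s ∧ e.eval s + f.eval s < bd
  | sub e f => e.ok bd s ∧ f.ok bd s
  | mul e f => e.ok bd s ∧ f.ok bd s ∧ e.eval s * f.eval s < bd
  | div e f => e.ok bd s ∧ f.ok bd s ∧ f.eval s ≠ 0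
  | ld _ i j l => i.ok bd s ∧ j.ok bd s ∧ l.ok bd s ∧ i.eval s < bd ∧ j.eval s < bd ∧ l.eval s < bd

end Expr

namespace Cond

def cost : Cond → ℕ
  | lt e f => e.cost + f.cost
  | ilt e f => e.cost + f.cost + 2

/-- The code only brings the two sides into the temporaries `0` and `1`; the comparison itself is
the jump of the enclosing command. -/
def comp : Cond → ℕ → List Instr
  | lt e f, pos => e.comp pos 0 ++ f.comp (pos + e.cost) 1
  | ilt e f, pos => e.comp pos 0 ++ (f.comp (pos + e.cost) 1 ++
      [.load (tmp 0) (tmp 0), .load (tmp 1) (tmp 1)])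

theorem length_comp (t : Cond) (pos : ℕ) : (t.comp pos).length = t.cost := by
  cases t <;> simp [comp, cost, Expr.length_comp]; omega

def holds (s : St) : Cond → Prop
  | lt e f => e.eval s < f.eval s
  | ilt e f => s.inp (e.eval s) < s.inp (f.eval s)

def ok (bd len : ℕ) (s : St) : Cond → Prop
  | lt e f => e.ok bd s ∧ f.ok bd s
  | ilt e f => e.ok bd s ∧ f.ok bd s ∧ e.eval s < len ∧ f.eval s < len

end Cond

namespace Cmd

def size : Cmd → ℕ
  | skip => 0
  | assign _ e => e.cost + 1
  | store _ i j l e => i.cost + j.cost + l.cost + e.cost + 9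
  | out i e => i.cost + e.cost + 1
  | seq c d => c.size + d.size
  | ite t c d => t.cost + c.size + d.size + 2
  | .whileDo t c => t.cost + c.size + 3

/-- As the conditional jump is taken when the test holds, the code of the other branch comes first.
-/
def comp : Cmd → ℕ → List Instr
  | skip, _ => []
  | assign x e, pos => e.comp pos 0 ++ [.add x.reg (tmp 0) 1]
  | store k i j l e, pos => i.comp pos 0 ++ (j.comp (pos + i.cost) 1 ++
      (l.comp (pos + i.cost + j.cost) 2 ++ (e.comp (pos + i.cost + j.cost + l.cost) 3 ++
        (addrCode k 0 4 ++ [.store (tmp 0) (tmp 3)]))))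
  | out i e, pos => i.comp pos 0 ++ (e.comp (pos + i.cost) 1 ++ [.store (tmp 0) (tmp 1)])
  | seq c d, pos => c.comp pos ++ d.comp (pos + c.size)
  | ite t c d, pos => t.comp pos ++ (.jumpLt (tmp 0) (tmp 1) (pos + t.cost + d.size + 2) ::
      (d.comp (pos + t.cost + 1) ++ (.jump (pos + t.cost + d.size + 2 + c.size) ::
        c.comp (pos + t.cost + d.size + 2))))
  | .whileDo t c, pos => t.comp pos ++ (.jumpLt (tmp 0) (tmp 1) (pos + t.cost + 2) ::
      .jump (pos + t.cost + c.size + 3) :: (c.comp (pos + t.cost + 2) ++ [.jump pos]))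

theorem length_comp (c : Cmd) : ∀ pos, (c.comp pos).length = c.size := by
  induction c <;> intro pos <;>
    simp_all [comp, size, Expr.length_comp, Cond.length_comp, addrCode] <;> omega

/-! ### Weakest preconditions -/

open scoped Classical in
/-- `n` unfoldings of a loop with test `t`, body transformer `W` and postcondition `Q`. -/
def loop (bd len : ℕ) (t : Cond) (W : (St → Prop) → St → Prop) (Q : St → Prop) : ℕ → St → Prop
  | 0, _ => False
  | n + 1, s => t.ok bd len s ∧
      if t.holds s then W (loop bd len t W Q n) (s.tick (t.cost + 3)) else Q (s.tick (t.cost + 3))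

open scoped Classical in
/-- Started in `s`, the command terminates without a crash in a state satisfying `Q`. -/
def wp (bd len : ℕ) : Cmd → (St → Prop) → St → Prop
  | skip, Q, s => Q s
  | assign x e, Q, s => e.ok bd s ∧ Q ((s.set x (e.eval s)).tick (e.cost + 1))
  | store k i j l e, Q, s => i.ok bd s ∧ j.ok bd s ∧ l.ok bd s ∧ e.ok bd s ∧
      i.eval s < bd ∧ j.eval s < bd ∧ l.eval s < bd ∧
      Q ((s.sto k (i.eval s) (j.eval s) (l.eval s) (e.eval s)).tick
        (i.cost + j.cost + l.cost + e.cost + 9))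
  | out i e, Q, s => i.ok bd s ∧ e.ok bd s ∧ i.eval s < len ∧
      Q ((s.put (i.eval s) (e.eval s)).tick (i.cost + e.cost + 1))
  | seq c d, Q, s => c.wp bd len (d.wp bd len Q) s
  | ite t c d, Q, s => t.ok bd len s ∧
      if t.holds s then c.wp bd len Q (s.tick (t.cost + 2)) else d.wp bd len Q (s.tick (t.cost + 2))
  | .whileDo t c, Q, s => ∃ n, loop bd len t (c.wp bd len) Q n s

theorem loop_mono {bd len : ℕ} {t : Cond} {W : (St → Prop) → St → Prop}
    (hW : ∀ {Q R : St → Prop}, (∀ s, Q s → R s) → ∀ s, W Q s → W R s)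
    {Q R : St → Prop} (hQR : ∀ s, Q s → R s) :
    ∀ n s, loop bd len t W Q n s → loop bd len t W R n s := by
  intro n
  induction n with
  | zero => intro s h; exact h
  | succ n ih =>
    rintro s ⟨h1, h2⟩
    refine ⟨h1, ?_⟩
    split_ifs with hc
    · rw [if_pos hc] at h2; exact hW ih _ h2
    · rw [if_neg hc] at h2; exact hQR _ h2

theorem wp_mono {bd len : ℕ} (c : Cmd) : ∀ {Q R : St → Prop}, (∀ s, Q s → R s) →
    ∀ s, c.wp bd len Q s → c.wp bd len R s := by
  induction c with
  | skip => intro Q R hQR s h; exact hQR _ h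
  | assign x e => intro Q R hQR s h; exact ⟨h.1, hQR _ h.2⟩
  | store k i j l e =>
    rintro Q R hQR s ⟨h1, h2, h3, h4, h5, h6, h7, h8⟩
    exact ⟨h1, h2, h3, h4, h5, h6, h7, hQR _ h8⟩
  | out i e => rintro Q R hQR s ⟨h1, h2, h3, h4⟩; exact ⟨h1, h2, h3, hQR _ h4⟩
  | seq c d ihc ihd => intro Q R hQR s h; exact ihc (ihd hQR) _ h
  | ite t c d ihc ihd =>
    rintro Q R hQR s ⟨h1, h2⟩
    refine ⟨h1, ?_⟩
    split_ifs with hc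
    · rw [if_pos hc] at h2; exact ihc hQR _ h2
    · rw [if_neg hc] at h2; exact ihd hQR _ h2
  | whileDo t c ih =>
    rintro Q R hQR s ⟨n, h⟩
    exact ⟨n, loop_mono (fun h => ih h) hQR n s h⟩

/-- Loop rule with an invariant and a variant. -/
theorem wp_while {bd len : ℕ} {t : Cond} {c : Cmd} {Q : St → Prop} (I : St → Prop) (μ : St → ℕ)
    (hok : ∀ s, I s → t.ok bd len s)
    (hstep : ∀ s, I s → t.holds s →
      c.wp bd len (fun s' => I s' ∧ μ s' < μ s) (s.tick (t.cost + 3)))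
    (hexit : ∀ s, I s → ¬ t.holds s → Q (s.tick (t.cost + 3))) (s : St) (hs : I s) :
    (Cmd.whileDo t c).wp bd len Q s := by
  -- The variant bounds the number of unfoldings that are needed.
  have key : ∀ n s, I s → μ s < n → loop bd len t (c.wp bd len) Q n s := by
    intro n
    induction n with
    | zero => intro s _ h; exact absurd h (by omega)
    | succ n ih =>
      intro s hI hn
      refine ⟨hok s hI, ?_⟩
      split_ifs with hc
      · exact wp_mono c (fun s' h => ih s' h.1 (by omega)) _ (hstep s hI hc)
      · exact hexit s hI hc
  exact ⟨_, key _ s hs (Nat.lt_succ_self _)⟩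

/-! ### Frames -/

/-- Variables that the command may change. -/
def wv : Cmd → Var → Bool
  | assign x _, y => x == y
  | seq c d, y => c.wv y || d.wv y
  | ite _ c d, y => c.wv y || d.wv y
  | .whileDo _ c, y => c.wv y
  | _, _ => false

/-- Arrays that the command may change. -/
def wa : Cmd → Arr → Bool
  | store k _ _ _ _, k' => k == k'
  | seq c d, y => c.wa y || d.wa y
  | ite _ c d, y => c.wa y || d.wa y
  | .whileDo _ c, y => c.wa y
  | _, _ => false

/-- Whether the command may change the input region. -/
def wi : Cmd → Bool
  | out _ _ => true
  | seq c d => c.wi || d.wi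
  | ite _ c d => c.wi || d.wi
  | .whileDo _ c => c.wi
  | _ => false

/-- `s'` differs from `s` at most in what `c` may change, and time has not gone back. -/
structure Same (c : Cmd) (s s' : St) : Prop where
  v : ∀ x, c.wv x = false → s'.v x = s.v x
  a : ∀ k, c.wa k = false → s'.a k = s.a k
  inp : c.wi = false → s'.inp = s.inp
  clk : s.clk ≤ s'.clk

theorem Same.trans {c d e : Cmd} {s s' s'' : St} (h : Same c s s') (h' : Same d s' s'')
    (hv : ∀ x, e.wv x = false → c.wv x = false ∧ d.wv x = false)
    (ha : ∀ x, e.wa x = false → c.wa x = false ∧ d.wa x = false)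
    (hi : e.wi = false → c.wi = false ∧ d.wi = false) : Same e s s'' where
  v x hx := (h'.v x (hv x hx).2).trans (h.v x (hv x hx).1)
  a x hx := (h'.a x (ha x hx).2).trans (h.a x (ha x hx).1)
  inp hx := (h'.inp (hi hx).2).trans (h.inp (hi hx).1)
  clk := h.clk.trans h'.clk

theorem Same.tick (c : Cmd) (s : St) (n : ℕ) : Same c s (s.tick n) :=
  ⟨fun _ _ => rfl, fun _ _ => rfl, fun _ => rfl, Nat.le_add_right _ _⟩

/-- The frame rule. Write sets are computed from the syntax, so that something is unchanged is
mostly proved by `rfl`, and specifications need not list what a command leaves alone. -/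
theorem wp_same {bd len : ℕ} (c : Cmd) : ∀ {Q : St → Prop} (s : St), c.wp bd len Q s →
    c.wp bd len (fun s' => Q s' ∧ Same c s s') s := by
  induction c with
  | skip => intro Q s h; exact ⟨h, fun _ _ => rfl, fun _ _ => rfl, fun _ => rfl, le_rfl⟩
  | assign x e =>
    intro Q s h
    refine ⟨h.1, h.2, fun y hy => ?_, fun _ _ => rfl, fun _ => rfl, Nat.le_add_right _ _⟩
    have : y ≠ x := by rintro rfl; simp [wv] at hy
    simp [this]
  | store k i j l e =>
    rintro Q s ⟨h1, h2, h3, h4, h5, h6, h7, h8⟩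
    refine ⟨h1, h2, h3, h4, h5, h6, h7, h8, fun _ _ => rfl, fun y hy => ?_, fun _ => rfl,
      Nat.le_add_right _ _⟩
    have : y ≠ k := by rintro rfl; simp [wa] at hy
    funext i' j' l'
    simp [this]
  | out i e =>
    rintro Q s ⟨h1, h2, h3, h4⟩
    exact ⟨h1, h2, h3, h4, fun _ _ => rfl, fun _ _ => rfl, fun h => absurd h (by simp [wi]),
      Nat.le_add_right _ _⟩
  | seq c d ihc ihd =>
    intro Q s h
    refine wp_mono c ?_ s (ihc s h)
    rintro s1 ⟨h1, f1⟩
    refine wp_mono d ?_ s1 (ihd s1 h1)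
    rintro s2 ⟨h2, f2⟩
    exact ⟨h2, f1.trans f2 (by simp [wv]) (by simp [wa]) (by simp [wi])⟩
  | ite t c d ihc ihd =>
    rintro Q s ⟨h1, h2⟩
    refine ⟨h1, ?_⟩
    split_ifs with hc
    · rw [if_pos hc] at h2
      refine wp_mono c ?_ _ (ihc _ h2)
      rintro s1 ⟨h1, f1⟩
      exact ⟨h1, (Same.tick .skip s _).trans f1 (by simp +contextual [wv])
        (by simp +contextual [wa]) (by simp +contextual [wi])⟩
    · rw [if_neg hc] at h2
      refine wp_mono d ?_ _ (ihd _ h2)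
      rintro s1 ⟨h1, f1⟩
      exact ⟨h1, (Same.tick .skip s _).trans f1 (by simp +contextual [wv])
        (by simp +contextual [wa]) (by simp +contextual [wi])⟩
  | whileDo t c ih =>
    rintro Q s ⟨n, h⟩
    refine ⟨n, ?_⟩
    -- The frame stays relative to the first state `s` while the current state `s0` of the loop
    -- varies.
    have key : ∀ n s0, loop bd len t (c.wp bd len) Q n s0 → Same (.whileDo t c) s s0 →
        loop bd len t (c.wp bd len) (fun s' => Q s' ∧ Same (.whileDo t c) s s') n s0 := by
      intro n
      induction n with
      | zero => intro s0 h _; exact h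
      | succ n ihn =>
        rintro s0 ⟨h1, h2⟩ f0
        refine ⟨h1, ?_⟩
        split_ifs with hc
        · rw [if_pos hc] at h2
          refine wp_mono c ?_ _ (ih _ h2)
          rintro s1 ⟨h1, f1⟩
          refine ihn s1 h1 ?_
          exact (f0.trans (e := .whileDo t c) (Same.tick .skip s0 _) (by simp [wv]) (by simp [wa])
            (by simp [wi])).trans f1 (by simp [wv]) (by simp [wa]) (by simp [wi])
        · rw [if_neg hc] at h2
          exact ⟨h2, f0.trans (Same.tick .skip s0 _) (by simp [wv]) (by simp [wa]) (by simp [wi])⟩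
    exact key n s h ⟨fun _ _ => rfl, fun _ _ => rfl, fun _ => rfl, le_rfl⟩

/-- Sequencing with an explicit specification of the first part. -/
theorem wp_seq {bd len : ℕ} {c d : Cmd} {Q R : St → Prop} {s : St} (h : c.wp bd len R s)
    (h' : ∀ s', R s' → Same c s s' → d.wp bd len Q s') : (c.seq d).wp bd len Q s :=
  wp_mono c (fun s' h => h' s' h.1 h.2) s (wp_same c s h)

theorem wp_conseq {bd len : ℕ} {c : Cmd} {Q R : St → Prop} {s : St} (h : c.wp bd len R s)
    (h' : ∀ s', R s' → Same c s s' → Q s') : c.wp bd len Q s :=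
  wp_mono c (fun s' h => h' s' h.1 h.2) s (wp_same c s h)

end Cmd

end Imp


namespace Imp

open WordRAM

/-! ### Correctness of the compiler -/

theorem Var.ctorIdx_inj : ∀ {x y : Var}, x.ctorIdx = y.ctorIdx → x = y := by
  intro x y h
  rw [← Var.ofNat_ctorIdx x, ← Var.ofNat_ctorIdx y, h]

theorem Arr.ctorIdx_inj : ∀ {x y : Arr}, x.ctorIdx = y.ctorIdx → x = y := by
  intro x y h
  rw [← Arr.ofNat_ctorIdx x, ← Arr.ofNat_ctorIdx y, h]

theorem Arr.ctorIdx_lt (k : Arr) : k.ctorIdx < 16 := by cases k <;> decide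

theorem Var.reg_inj {x y : Var} (h : x.reg = y.reg) : x = y :=
  Var.ctorIdx_inj (by unfold Var.reg at h; omega)

theorem Var.reg_ne_tmp (x : Var) (i : ℕ) : x.reg ≠ tmp i := by unfold Var.reg tmp; omega

theorem tmp_inj {i j : ℕ} : tmp i = tmp j ↔ i = j := by unfold tmp; omega

def CodeAt (P : Program) (pos : ℕ) (code : List Instr) : Prop :=
  ∀ i (h : i < code.length), P[pos + i]? = some code[i]

theorem CodeAt.left {P : Program} {pos : ℕ} {c d : List Instr} (h : CodeAt P pos (c ++ d)) :
    CodeAt P pos c := by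
  intro i hi
  rw [h i (by simp; omega), List.getElem_append_left hi]

theorem CodeAt.right {P : Program} {pos n : ℕ} {c d : List Instr} (h : CodeAt P pos (c ++ d))
    (hn : c.length = n) : CodeAt P (pos + n) d := by
  subst hn
  intro i hi
  rw [add_assoc, h (c.length + i) (by simp; omega)]
  simp

theorem CodeAt.head {P : Program} {pos : ℕ} {c : Instr} {d : List Instr}
    (h : CodeAt P pos (c :: d)) : P[pos]? = some c := h 0 (by simp)

theorem CodeAt.tail {P : Program} {pos : ℕ} {c : Instr} {d : List Instr}
    (h : CodeAt P pos (c :: d)) : CodeAt P (pos + 1) d :=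
  CodeAt.right (c := [c]) h rfl

/-! ### Straight-line code, word sizes and evaluation of expressions -/

section

variable {w : ℕ} {P : Program}

theorem run_add {m n : ℕ} {s s' s'' : State} (h : run w P m s = some s')
    (h' : run w P n s' = some s'') : run w P (m + n) s = some s'' := by
  induction m generalizing s with
  | zero => simp only [run, Option.some.injEq] at h; subst h; simpa using h'
  | succ m ih =>
    rw [Nat.add_right_comm]
    simp only [run, Option.bind_eq_some_iff] at h ⊢
    obtain ⟨s1, h1, h2⟩ := h
    exact ⟨s1, h1, ih h2⟩

theorem run_one {s s' : State} {c : Instr} (hc : P[s.pc]? = some c) (h : exec w s c = some s') :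
    run w P 1 s = some s' := by
  simp [run, step, hc, h]

/-- Execution of straight-line code. -/
def execSeq (w : ℕ) : List Instr → State → Option State
  | [], s => some s
  | c :: d, s => (exec w s c).bind fun s1 => if s1.pc = s.pc + 1 then execSeq w d s1 else none

theorem run_execSeq : ∀ {code : List Instr} {s s' : State}, CodeAt P s.pc code →
    execSeq w code s = some s' → run w P code.length s = some s'
  | [], s, s', _, h => h
  | c :: d, s, s', hc, h => by
    simp only [execSeq, Option.bind_eq_some_iff] at h
    obtain ⟨s1, h1, h2⟩ := h
    split_ifs at h2 with hpc
    rw [List.length_cons, add_comm]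
    exact run_add (run_one hc.head h1) (run_execSeq (by rw [hpc]; exact hc.tail) h2)

theorem setReg_eq {s : State} {d : ℕ} {v : ℤ} (h : Fits w v) :
    s.setReg w d v = some { s with pc := s.pc + 1, reg := Function.update s.reg d v } :=
  if_pos h

/-- After `clamp`, the register holds the non-negative part of its former value. -/
theorem run_clamp {s : State} {r : ℕ} (hc : CodeAt P s.pc (clamp r s.pc)) (hz : s.reg 1 = 0) :
    ∃ n ≤ 2, run w P n s =
      some ⟨s.pc + 2, Function.update s.reg r ((s.reg r).toNat : ℤ), s.mem⟩ := by
  by_cases h : 0 < s.reg r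
  · refine ⟨1, by omega, run_one hc.head ?_⟩
    have : ((s.reg r).toNat : ℤ) = s.reg r := Int.toNat_of_nonneg h.le
    simp [exec, hz, h, this]
  · refine ⟨2, le_rfl, ?_⟩
    have h0 : (s.reg r).toNat = 0 := by omega
    refine run_add (m := 1) (n := 1) (s' := { s with pc := s.pc + 1 }) (run_one hc.head ?_)
      (run_one (c := .const r 0) hc.tail.head ?_)
    · simp [exec, hz, h]
    · rw [exec, setReg_eq (by simp [Fits])]; simp [h0]

theorem fits_natCast {n : ℕ} : Fits w (n : ℤ) ↔ n < 2 ^ w := by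
  unfold Fits
  rw [abs_of_nonneg (by positivity)]
  exact_mod_cast Iff.rfl

theorem fits_toNat {v : ℤ} (h : Fits w v) : Fits w (v.toNat : ℤ) := by
  unfold Fits at *
  rw [abs_lt] at h
  rw [abs_lt]
  omega

theorem fits_sub {m n : ℕ} (h : Fits w (m : ℤ)) (h' : Fits w (n : ℤ)) : Fits w ((m : ℤ) - n) := by
  unfold Fits at *
  rw [abs_lt] at h h' ⊢
  omega

/-- The memory cell of an array entry. -/
def addr (bd base : ℕ) (k : Arr) (i j l : ℕ) : ℕ := 16 * ((i * bd + j) * bd + l) + base + k.ctorIdx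

theorem digits_inj {d i j i' j' : ℕ} (hj : j < d) (hj' : j' < d) (h : i * d + j = i' * d + j') :
    i = i' ∧ j = j' := by
  have h1 : (i * d + j) / d = i := by
    rw [mul_comm, Nat.mul_add_div (by omega), Nat.div_eq_of_lt hj, add_zero]
  have h2 : (i' * d + j') / d = i' := by
    rw [mul_comm, Nat.mul_add_div (by omega), Nat.div_eq_of_lt hj', add_zero]
  have : i = i' := by rw [← h1, ← h2, h]
  subst this
  exact ⟨rfl, by omega⟩

/-- Up to the shift by `base`, an address is a number in mixed radix with the digits `k < 16`, `l <
bd`, `j < bd`; the leading digit `i` needs no bound. -/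
theorem addr_inj {bd base : ℕ} {k k' : Arr} {i j l i' j' l' : ℕ} (hj : j < bd) (hl : l < bd)
    (hj' : j' < bd) (hl' : l' < bd) (h : addr bd base k i j l = addr bd base k' i' j' l') :
    k = k' ∧ i = i' ∧ j = j' ∧ l = l' := by
  unfold addr at h
  have hk := k.ctorIdx_lt
  have hk' := k'.ctorIdx_lt
  have h1 : k.ctorIdx = k'.ctorIdx := by omega
  obtain ⟨h2, h3⟩ := digits_inj hl hl'
    (show (i * bd + j) * bd + l = (i' * bd + j') * bd + l' by omega)
  obtain ⟨h4, h5⟩ := digits_inj hj hj' h2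
  exact ⟨Arr.ctorIdx_inj h1, h4, h5, h3⟩

theorem addr_lt {bd base : ℕ} {k : Arr} {i j l : ℕ} (hi : i < bd) (hj : j < bd) (hl : l < bd) :
    addr bd base k i j l < 16 * (bd * bd * bd) + base := by
  have hk := k.ctorIdx_lt
  have h1 : i * bd + j + 1 ≤ bd * bd := by
    have := Nat.mul_le_mul_right bd (show i + 1 ≤ bd from hi)
    rw [add_mul] at this; omega
  have h2 : (i * bd + j) * bd + l + 1 ≤ bd * bd * bd := by
    have := Nat.mul_le_mul_right bd h1
    rw [add_mul] at this; omega
  unfold addr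
  omega

/-- A machine state represents a program state. -/
structure Match (w bd base : ℕ) (m : State) (s : St) : Prop where
  r1 : m.reg 1 = 0
  r3 : m.reg 3 = 16
  r5 : m.reg 5 = base
  r7 : m.reg 7 = bd
  v : ∀ x : Var, (m.reg x.reg).toNat = s.v x
  inp : ∀ i < base, m.mem i = s.inp i
  a : ∀ k i j l, i < bd → j < bd → l < bd → (m.mem (addr bd base k i j l)).toNat = s.a k i j l
  freg : ∀ r, Fits w (m.reg r)
  fmem : ∀ r, Fits w (m.mem r)

theorem Match.tick {bd base : ℕ} {m : State} {s : St} (h : Match w bd base m s) (n : ℕ) :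
    Match w bd base m (s.tick n) := ⟨h.1, h.2, h.3, h.4, h.5, h.6, h.7, h.8, h.9⟩

theorem Match.of_tmp {bd base : ℕ} {m m' : State} {s : St} (h : Match w bd base m s)
    (hr : ∀ r, (∀ i, r ≠ tmp i) → m'.reg r = m.reg r) (hm : m'.mem = m.mem)
    (hf : ∀ r, Fits w (m'.reg r)) : Match w bd base m' s where
  r1 := (hr 1 (by unfold tmp; omega)).trans h.r1
  r3 := (hr 3 (by unfold tmp; omega)).trans h.r3
  r5 := (hr 5 (by unfold tmp; omega)).trans h.r5
  r7 := (hr 7 (by unfold tmp; omega)).trans h.r7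
  v x := by rw [hr _ (x.reg_ne_tmp)]; exact h.v x
  inp := by rw [hm]; exact h.inp
  a := by rw [hm]; exact h.a
  freg := hf
  fmem := by rw [hm]; exact h.fmem

/-- `m'` is reached from `m` in at most `N` steps, at position `pos'`, and only temporaries
from `t` on have changed. -/
def Eval (w : ℕ) (P : Program) (m : State) (N t pos' : ℕ) (R : State → Prop) : Prop :=
  ∃ n ≤ N, ∃ m', run w P n m = some m' ∧ m'.pc = pos' ∧
    (∀ r, (∀ i, t ≤ i → r ≠ tmp i) → m'.reg r = m.reg r) ∧ m'.mem = m.mem ∧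
    (∀ r, Fits w (m'.reg r)) ∧ R m'

theorem Eval.bind {m : State} {N N' K t t' p p' : ℕ} {R R' : State → Prop}
    (h : Eval w P m N t p R) (ht : t ≤ t')
    (h' : ∀ m', m'.pc = p → (∀ r, (∀ i, t ≤ i → r ≠ tmp i) → m'.reg r = m.reg r) →
      m'.mem = m.mem → (∀ r, Fits w (m'.reg r)) → R m' → Eval w P m' N' t' p' R')
    (hK : N + N' = K) : Eval w P m K t p' R' := by
  obtain ⟨n, hn, m1, hr, hp, hreg, hmem, hf, hR⟩ := h
  obtain ⟨n', hn', m2, hr', hp', hreg', hmem', hf', hR'⟩ := h' m1 hp hreg hmem hf hR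
  refine ⟨n + n', by omega, m2, run_add hr hr', hp', fun r h => ?_, hmem'.trans hmem, hf', hR'⟩
  rw [hreg' r (fun i hi => h i (ht.trans hi)), hreg r h]

theorem Eval.set {m : State} {N t p : ℕ} {v : ℤ} {c : Instr} {R : State → Prop}
    (hc : P[m.pc]? = some c) (he : exec w m c = m.setReg w (tmp t) v) (hv : Fits w v)
    (hf : ∀ r, Fits w (m.reg r)) (hp : m.pc + 1 = p) (hN : 1 ≤ N)
    (hR : R ⟨p, Function.update m.reg (tmp t) v, m.mem⟩) : Eval w P m N t p R := by
  refine ⟨1, hN, _, run_one hc (he.trans (setReg_eq hv)), hp, fun r h => ?_, rfl, fun r => ?_, ?_⟩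
  · exact Function.update_of_ne (h t le_rfl) _ _
  · by_cases hrt : r = tmp t
    · subst hrt; simpa using hv
    · simpa [hrt] using hf r
  · subst hp; exact hR

theorem Eval.mono {m : State} {N t p : ℕ} {R R' : State → Prop} (h : Eval w P m N t p R)
    (hR : ∀ m', R m' → R' m') : Eval w P m N t p R' := by
  obtain ⟨n, hn, m1, hr, hp, hreg, hmem, hf, h⟩ := h
  exact ⟨n, hn, m1, hr, hp, hreg, hmem, hf, hR _ h⟩

theorem Eval.clamp {m : State} {t : ℕ} (hc : CodeAt P m.pc (Imp.clamp (tmp t) m.pc))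
    (hz : m.reg 1 = 0) (hf : ∀ r, Fits w (m.reg r)) :
    Eval w P m 2 t (m.pc + 2) (fun m' => m'.reg (tmp t) = ((m.reg (tmp t)).toNat : ℤ)) := by
  obtain ⟨n, hn, h⟩ := run_clamp (w := w) hc hz
  refine ⟨n, hn, _, h, rfl, fun r h => Function.update_of_ne (h t le_rfl) _ _, rfl, fun r => ?_,
    by simp⟩
  by_cases hrt : r = tmp t
  · subst hrt; simpa using fits_toNat (hf _)
  · simpa [hrt] using hf r

theorem Match.of_eval {bd base t : ℕ} {m m' : State} {s : St} (h : Match w bd base m s)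
    (hr : ∀ r, (∀ i, t ≤ i → r ≠ tmp i) → m'.reg r = m.reg r) (hm : m'.mem = m.mem)
    (hf : ∀ r, Fits w (m'.reg r)) : Match w bd base m' s :=
  h.of_tmp (fun r hr' => hr r fun i _ => hr' i) hm hf

theorem tmp_ne {r t : ℕ} (hr : r < 9) : ∀ i, t ≤ i → r ≠ tmp i := by
  intro i _; unfold tmp; omega

theorem tmp_lt {r t : ℕ} (hr : r < t) : ∀ i, t ≤ i → tmp r ≠ tmp i := by
  intro i _; unfold tmp; omega

/-- Horner's rule. All intermediate results are below the bound in `hw`, so none of the eight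
instructions overflows. -/
theorem addrCode_correct {bd base : ℕ} (hw : 16 * (bd * bd * bd) + base + 16 ≤ 2 ^ w)
    {m : State} {s : St} (hm : Match w bd base m s) {k : Arr} {i t I J L : ℕ} (hit : i + 3 ≤ t)
    (hc : CodeAt P m.pc (addrCode k i t)) (hI : m.reg (tmp i) = I) (hJ : m.reg (tmp (i + 1)) = J)
    (hL : m.reg (tmp (i + 2)) = L) (hIb : I < bd) (hJb : J < bd) (hLb : L < bd) :
    ∃ m', run w P 8 m = some m' ∧ m'.pc = m.pc + 8 ∧ m'.mem = m.mem ∧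
      m'.reg (tmp i) = (addr bd base k I J L : ℕ) ∧
      (∀ r, r ≠ tmp i → r ≠ tmp t → m'.reg r = m.reg r) ∧ (∀ r, Fits w (m'.reg r)) := by
  have hk := k.ctorIdx_lt
  have h1 : I * bd + J + 1 ≤ bd * bd := by
    have := Nat.mul_le_mul_right bd (show I + 1 ≤ bd from hIb)
    rw [add_mul] at this; omega
  have h2 : (I * bd + J) * bd + L + 1 ≤ bd * bd * bd := by
    have := Nat.mul_le_mul_right bd h1
    rw [add_mul] at this; omega
  have h3 : bd * bd ≤ bd * bd * bd := Nat.le_mul_of_pos_right _ (by omega)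
  have h4 : bd * bd * bd < 2 ^ w := by omega
  have f1 : Fits w ((I : ℤ) * bd) := by
    rw [← Nat.cast_mul, fits_natCast]; omega
  have f2 : Fits w ((I : ℤ) * bd + J) := by
    rw [← Nat.cast_mul, ← Nat.cast_add, fits_natCast]; omega
  have f3 : Fits w (((I : ℤ) * bd + J) * bd) := by
    rw [← Nat.cast_mul, ← Nat.cast_add, ← Nat.cast_mul, fits_natCast]; omega
  have f4 : Fits w (((I : ℤ) * bd + J) * bd + L) := by
    rw [← Nat.cast_mul, ← Nat.cast_add, ← Nat.cast_mul, ← Nat.cast_add, fits_natCast]; omega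
  have f5 : Fits w ((((I : ℤ) * bd + J) * bd + L) * 16) := by
    rw [← Nat.cast_mul, ← Nat.cast_add, ← Nat.cast_mul, ← Nat.cast_add,
      show (16 : ℤ) = ((16 : ℕ) : ℤ) from rfl, ← Nat.cast_mul, fits_natCast]; omega
  have f6 : Fits w ((((I : ℤ) * bd + J) * bd + L) * 16 + base) := by
    rw [← Nat.cast_mul, ← Nat.cast_add, ← Nat.cast_mul, ← Nat.cast_add,
      show (16 : ℤ) = ((16 : ℕ) : ℤ) from rfl, ← Nat.cast_mul, ← Nat.cast_add, fits_natCast]; omega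
  have f7 : Fits w (k.ctorIdx : ℤ) := by rw [fits_natCast]; omega
  have f8 : Fits w ((((I : ℤ) * bd + J) * bd + L) * 16 + base + k.ctorIdx) := by
    rw [← Nat.cast_mul, ← Nat.cast_add, ← Nat.cast_mul, ← Nat.cast_add,
      show (16 : ℤ) = ((16 : ℕ) : ℤ) from rfl, ← Nat.cast_mul, ← Nat.cast_add, ← Nat.cast_add,
      fits_natCast]; omega
  have n7 : (7 : ℕ) ≠ tmp i := by unfold tmp; omega
  have n5 : (5 : ℕ) ≠ tmp i := by unfold tmp; omega
  have n3 : (3 : ℕ) ≠ tmp i := by unfold tmp; omega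
  have ni1 : tmp (i + 1) ≠ tmp i := by unfold tmp; omega
  have ni2 : tmp (i + 2) ≠ tmp i := by unfold tmp; omega
  have nt : tmp i ≠ tmp t := by unfold tmp; omega
  have hlt := addr_lt (base := base) (k := k) hIb hJb hLb
  refine ⟨⟨m.pc + 8, Function.update (Function.update m.reg (tmp t) k.ctorIdx) (tmp i)
    (addr bd base k I J L : ℕ), m.mem⟩, run_execSeq hc ?_, rfl, rfl, by simp, ?_, ?_⟩
  · simp only [addrCode, execSeq, exec, State.setReg, hI, hm.r7, f1, if_true, Option.bind_some,
      Function.update_self, ne_eq, ni1, not_false_eq_true, Function.update_of_ne, hJ, f2, n7, f3,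
      ni2, hL, f4, n3, hm.r3, f5, n5, hm.r5, f6, f7, nt, f8, Function.update_idem]
    simp only [Option.some.injEq, State.mk.injEq, and_true]
    refine ⟨trivial, ?_⟩
    rw [Function.update_comm nt, Function.update_idem]
    congr 1
    simp only [addr]
    push_cast
    ring
  · intro r hr hr'
    simp [hr, hr']
  · intro r
    simp only [Function.update_apply]
    split_ifs
    · rw [fits_natCast]; omega
    · exact f7
    · exact hm.freg r

theorem le_cube (bd : ℕ) : bd ≤ bd * bd * bd := by
  rcases Nat.eq_zero_or_pos bd with h | h
  · simp [h]
  · calc bd ≤ bd * bd := Nat.le_mul_of_pos_right _ h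
      _ ≤ _ := Nat.le_mul_of_pos_right _ h

/-- The statement of correctness for one expression. -/
def Expr.Correct (w : ℕ) (P : Program) (bd base : ℕ) (s : St) (e : Expr) : Prop :=
  ∀ (m : State) (pos t : ℕ), m.pc = pos → Match w bd base m s → CodeAt P pos (e.comp pos t) →
    e.ok bd s → Eval w P m e.cost t (pos + e.cost) (fun m' => m'.reg (tmp t) = e.eval s)

/-- The second operand is evaluated in temporaries beyond `t`, so the value of the first one in `tmp
t` survives. -/
theorem Expr.Correct.pair {bd base : ℕ} {s : St} {e f : Expr} (he : e.Correct w P bd base s)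
    (hf : f.Correct w P bd base s) {m : State} {pos t : ℕ} (hp : m.pc = pos)
    (hm : Match w bd base m s) (hc : CodeAt P pos (e.comp pos t))
    (hc' : CodeAt P (pos + e.cost) (f.comp (pos + e.cost) (t + 1))) (ho : e.ok bd s)
    (ho' : f.ok bd s) :
    Eval w P m (e.cost + f.cost) t (pos + e.cost + f.cost)
      (fun m' => m'.reg (tmp t) = e.eval s ∧ m'.reg (tmp (t + 1)) = f.eval s) := by
  refine (he m pos t hp hm hc ho).bind (t' := t + 1) (by omega)
    (fun m1 hp1 hr1 hm1 hf1 hR1 => ?_) rfl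
  obtain ⟨n, hn, m2, hr, hp2, hreg, hmem, hf2, h⟩ :=
    hf m1 _ (t + 1) hp1 (hm.of_eval hr1 hm1 hf1) hc' ho'
  exact ⟨n, hn, m2, hr, hp2, hreg, hmem, hf2, by rw [hreg _ (tmp_lt (by omega)), hR1], h⟩

theorem Expr.Correct.triple {bd base : ℕ} {s : St} {e f g : Expr} (he : e.Correct w P bd base s)
    (hf : f.Correct w P bd base s) (hg : g.Correct w P bd base s) {m : State} {pos t : ℕ}
    (hp : m.pc = pos) (hm : Match w bd base m s) (hc : CodeAt P pos (e.comp pos t))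
    (hc' : CodeAt P (pos + e.cost) (f.comp (pos + e.cost) (t + 1)))
    (hc'' : CodeAt P (pos + e.cost + f.cost) (g.comp (pos + e.cost + f.cost) (t + 2)))
    (ho : e.ok bd s) (ho' : f.ok bd s) (ho'' : g.ok bd s) :
    Eval w P m (e.cost + f.cost + g.cost) t (pos + e.cost + f.cost + g.cost)
      (fun m' => m'.reg (tmp t) = e.eval s ∧ m'.reg (tmp (t + 1)) = f.eval s ∧
        m'.reg (tmp (t + 2)) = g.eval s) := by
  refine (he.pair hf hp hm hc hc' ho ho').bind (t' := t + 2) (by omega)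
    (fun m1 hp1 hr1 hm1 hf1 hR1 => ?_) rfl
  obtain ⟨n, hn, m2, hr, hp2, hreg, hmem, hf2, h⟩ :=
    hg m1 _ (t + 2) hp1 (hm.of_eval hr1 hm1 hf1) hc'' ho''
  exact ⟨n, hn, m2, hr, hp2, hreg, hmem, hf2, by rw [hreg _ (tmp_lt (by omega)), hR1.1],
    by rw [hreg _ (tmp_lt (by omega)), hR1.2], h⟩

theorem Expr.comp_correct {bd base : ℕ} (hw : 16 * (bd * bd * bd) + base + 16 ≤ 2 ^ w) {s : St}
    (e : Expr) : e.Correct w P bd base s := by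
  have hbd := le_cube bd
  induction e with
  | var x =>
    intro m pos t hp hm hc _
    subst hp
    have h0 := Eval.set (w := w) (P := P) (m := m) (N := 1) (t := t) (p := m.pc + 1)
      (v := m.reg x.reg)
      (R := fun m' => m'.reg (tmp t) = m.reg x.reg) hc.head (by simp [exec, hm.r1])
      (hm.freg _) hm.freg rfl le_rfl (by simp)
    refine h0.bind (N' := 2) le_rfl (fun m' hp hr hmem hf hR => ?_) (by simp [cost])
    have hz : m'.reg 1 = 0 := by rw [hr 1 (tmp_ne (by omega)), hm.r1]
    have := Eval.clamp (w := w) (P := P) (m := m') (t := t) (by rw [hp]; exact hc.tail) hz hf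
    rw [hp] at this
    refine Eval.mono this fun m2 h2 => ?_
    rw [h2, hR, hm.v]; rfl
  | lit n =>
    intro m pos t hp hm hc hok
    subst hp
    have hn : Fits w (n : ℤ) := by rw [fits_natCast]; simp only [ok] at hok; omega
    exact Eval.set (v := n) hc.head rfl hn hm.freg rfl le_rfl (by simp [eval])
  | add e f ihe ihf =>
    intro m pos t hp hm hc ⟨oe, of, ob⟩
    have hc1 := hc.right (length_comp ..)
    refine (ihe.pair ihf hp hm hc.left hc1.left oe of).bind (t' := t) (N' := 1) le_rfl
      (fun m1 hp1 hr1 hm1 hf1 hR1 => ?_) rfl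
    have hc2 := (hc1.right (length_comp ..)).head
    rw [← hp1] at hc2
    refine Eval.set (v := (e.eval s + f.eval s : ℕ)) hc2
      (by simp [exec, hR1]) (by rw [fits_natCast]; omega) hf1 (by rw [hp1]; simp [cost]; omega)
      le_rfl (by simp [eval])
  | mul e f ihe ihf =>
    intro m pos t hp hm hc ⟨oe, of, ob⟩
    have hc1 := hc.right (length_comp ..)
    refine (ihe.pair ihf hp hm hc.left hc1.left oe of).bind (t' := t) (N' := 1) le_rfl
      (fun m1 hp1 hr1 hm1 hf1 hR1 => ?_) rfl
    have hc2 := (hc1.right (length_comp ..)).head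
    rw [← hp1] at hc2
    refine Eval.set (v := (e.eval s * f.eval s : ℕ)) hc2
      (by simp [exec, hR1]) (by rw [fits_natCast]; omega) hf1 (by rw [hp1]; simp [cost]; omega)
      le_rfl (by simp [eval])
  | div e f ihe ihf =>
    intro m pos t hp hm hc ⟨oe, of, ob⟩
    have hc1 := hc.right (length_comp ..)
    refine (ihe.pair ihf hp hm hc.left hc1.left oe of).bind (t' := t) (N' := 1) le_rfl
      (fun m1 hp1 hr1 hm1 hf1 hR1 => ?_) rfl
    have hc2 := (hc1.right (length_comp ..)).head
    rw [← hp1] at hc2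
    have hfe : Fits w (e.eval s : ℤ) := by rw [← hR1.1]; exact hf1 _
    refine Eval.set (v := (e.eval s / f.eval s : ℕ)) hc2
      (by simp [exec, hR1, ob]) ?_ hf1 (by rw [hp1]; simp [cost]; omega)
      le_rfl (by simp [eval])
    rw [fits_natCast] at hfe ⊢
    exact (Nat.div_le_self _ _).trans_lt hfe
  | sub e f ihe ihf =>
    intro m pos t hp hm hc ⟨oe, of⟩
    have hc1 := hc.right (length_comp ..)
    refine (ihe.pair ihf hp hm hc.left hc1.left oe of).bind (t' := t) (N' := 3) le_rfl
      (fun m1 hp1 hr1 hm1 hf1 hR1 => ?_) rfl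
    have hc2 := hc1.right (length_comp ..)
    have hfe : Fits w ((e.eval s : ℤ) - f.eval s) :=
      fits_sub (by rw [← hR1.1]; exact hf1 _) (by rw [← hR1.2]; exact hf1 _)
    have hz : m1.reg 1 = 0 := by rw [hr1 1 (tmp_ne (by omega)), hm.r1]
    have hc3 := hc2.head
    rw [← hp1] at hc3
    have h0 := Eval.set (w := w) (P := P) (m := m1) (N := 1) (t := t) (p := m1.pc + 1)
      (R := fun m' => m'.reg (tmp t) = (e.eval s : ℤ) - f.eval s) hc3 (by simp [exec, hR1])
      hfe hf1 rfl le_rfl (by simp)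
    refine h0.bind (N' := 2) le_rfl (fun m' hp' hr hmem hf hR => ?_) rfl
    have hz' : m'.reg 1 = 0 := by rw [hr 1 (tmp_ne (by omega)), hz]
    have := Eval.clamp (w := w) (P := P) (m := m') (t := t)
      (by rw [hp', hp1]; exact hc2.tail) hz' hf
    rw [hp', hp1] at this
    rw [show pos + (e.sub f).cost = pos + e.cost + f.cost + 1 + 2 by simp [cost]; omega]
    refine Eval.mono this fun m2 h2 => ?_
    rw [h2, hR]; simp [eval]
  | ld k i j l ihi ihj ihl =>
    intro m pos t hp hm hc ⟨oi, oj, ol, bi, bj, bl⟩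
    have hc1 := hc.right (length_comp ..)
    have hc2 := hc1.right (length_comp ..)
    have hc3 := hc2.right (length_comp ..)
    refine (ihi.triple ihj ihl hp hm hc.left hc1.left hc2.left oi oj ol).bind (t' := t) (N' := 11)
      le_rfl (fun m1 hp1 hr1 hm1 hf1 hR1 => ?_) rfl
    have hM := hm.of_eval hr1 hm1 hf1
    have hca := hc3.left
    rw [← hp1] at hca
    obtain ⟨m2, run2, hp2, hm2, hR2, hr2, hf2⟩ := addrCode_correct hw hM (i := t) (t := t + 3)
      le_rfl hca hR1.1 hR1.2.1 hR1.2.2 bi bj bl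
    have hc4 := hc3.right (n := 8) rfl
    have hz : m2.reg 1 = 0 := by
      rw [hr2 1 (by unfold tmp; omega) (by unfold tmp; omega), hM.r1]
    have hE : Eval w P m1 8 t (m1.pc + 8) (fun m' => m'.reg (tmp t) = (addr bd base k (i.eval s)
        (j.eval s) (l.eval s) : ℕ)) :=
      ⟨8, le_rfl, m2, run2, hp2, fun r h => hr2 r (h t le_rfl) (h (t + 3) (by omega)), hm2, hf2, hR2⟩
    refine hE.bind (t' := t) (N' := 3) le_rfl (fun m3 hp3 hr3 hm3 hf3 hR3 => ?_) rfl
    have hM3 := hM.of_eval hr3 hm3 hf3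
    have hc5 := hc4.head
    rw [← hp1, ← hp3] at hc5
    have h0 := Eval.set (w := w) (P := P) (m := m3) (N := 1) (t := t) (p := m3.pc + 1)
      (v := m3.mem (addr bd base k (i.eval s) (j.eval s) (l.eval s)))
      (R := fun m' => m'.reg (tmp t) = m3.mem (addr bd base k (i.eval s) (j.eval s) (l.eval s)))
      hc5 (by simp [exec, hR3]) (hM3.fmem _) hf3 rfl le_rfl (by simp)
    refine h0.bind (N' := 2) le_rfl (fun m' hp' hr hmem hf hR => ?_) rfl
    have hz' : m'.reg 1 = 0 := by rw [hr 1 (tmp_ne (by omega)), hM3.r1]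
    have := Eval.clamp (w := w) (P := P) (m := m') (t := t)
      (by rw [hp', hp3, hp1]; exact hc4.tail) hz' hf
    rw [hp', hp3, hp1] at this
    rw [show pos + (ld k i j l).cost = pos + i.cost + j.cost + l.cost + 8 + 1 + 2 by
      simp [cost]; omega]
    refine Eval.mono this fun m2 h2 => ?_
    rw [h2, hR, hM3.a _ _ _ _ bi bj bl]; rfl

end

end Imp


namespace Imp

open WordRAM

/-! ### Correctness of the code of conditions and commands -/

section

variable {w : ℕ} {P : Program}

theorem Cond.comp_correct {bd base : ℕ} (hw : 16 * (bd * bd * bd) + base + 16 ≤ 2 ^ w) {s : St}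
    (c : Cond) {m : State} {pos : ℕ} (hp : m.pc = pos) (hm : Match w bd base m s)
    (hc : CodeAt P pos (c.comp pos)) (hok : c.ok bd base s) :
    Eval w P m c.cost 0 (pos + c.cost)
      (fun m' => m'.reg (tmp 0) < m'.reg (tmp 1) ↔ c.holds s) := by
  cases c with
  | lt e f =>
    have := (Expr.comp_correct (P := P) hw e).pair (Expr.comp_correct hw f) hp hm hc.left
      (hc.right (Expr.length_comp ..)) hok.1 hok.2
    rw [add_assoc] at this
    refine Eval.mono this fun m' h => ?_
    rw [h.1, h.2]
    simp [holds]
  | ilt e f =>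
    obtain ⟨oe, of, be, bf⟩ := hok
    have hc1 := hc.right (Expr.length_comp ..)
    refine ((Expr.comp_correct (P := P) hw e).pair (Expr.comp_correct hw f) hp hm hc.left
      hc1.left oe of).bind (t' := 0) (N' := 2) le_rfl (fun m1 hp1 hr1 hm1 hf1 hR1 => ?_) rfl
    have hM := hm.of_eval hr1 hm1 hf1
    have hc2 := hc1.right (Expr.length_comp ..)
    have hc3 := hc2.head
    rw [← hp1] at hc3
    have h0 := Eval.set (w := w) (P := P) (m := m1) (N := 1) (t := 0) (p := m1.pc + 1)
      (v := s.inp (e.eval s))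
      (R := fun m' => m'.reg (tmp 0) = s.inp (e.eval s) ∧ m'.reg (tmp 1) = f.eval s)
      hc3 (by simp [exec, hR1, hM.inp _ be]) (by rw [← hM.inp _ be]; exact hM.fmem _) hf1 rfl le_rfl
      (by simp [hR1, tmp_inj])
    refine h0.bind (N' := 1) (t' := 1) (by omega) (fun m' hp' hr hmem hf hR => ?_) rfl
    have hM' := hM.of_eval hr hmem hf
    have hc4 := hc2.tail.head
    rw [← hp1, ← hp'] at hc4
    refine Eval.set (v := s.inp (f.eval s)) hc4 (by simp [exec, hR, hM'.inp _ bf])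
      (by rw [← hM'.inp _ bf]; exact hM'.fmem _) hf (by rw [hp', hp1]; simp [cost]; omega) le_rfl ?_
    simp [tmp_inj, hR, holds]

theorem Match.pc {bd base : ℕ} {m : State} {s : St} (h : Match w bd base m s) (p : ℕ) :
    Match w bd base { m with pc := p } s := ⟨h.1, h.2, h.3, h.4, h.5, h.6, h.7, h.8, h.9⟩

theorem Match.set {bd base : ℕ} {m : State} {s : St} (hm : Match w bd base m s) (x : Var) {n p : ℕ}
    (hn : Fits w (n : ℤ)) :
    Match w bd base ⟨p, Function.update m.reg x.reg n, m.mem⟩ (s.set x n) where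
  r1 := (Function.update_of_ne (by unfold Var.reg; omega) _ _).trans hm.r1
  r3 := (Function.update_of_ne (by unfold Var.reg; omega) _ _).trans hm.r3
  r5 := (Function.update_of_ne (by unfold Var.reg; omega) _ _).trans hm.r5
  r7 := (Function.update_of_ne (by unfold Var.reg; omega) _ _).trans hm.r7
  v y := by
    by_cases h : y = x
    · subst h; simp
    · have : y.reg ≠ x.reg := fun h' => h (Var.reg_inj h')
      simp [h, this, hm.v]
  inp := hm.inp
  a := hm.a
  freg r := by
    by_cases h : r = x.reg
    · subst h; simpa using hn
    · simpa [h] using hm.freg r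
  fmem := hm.fmem

theorem Match.sto {bd base : ℕ} {m : State} {s : St} (hm : Match w bd base m s) (k : Arr)
    {i j l n p : ℕ} (hj : j < bd) (hl : l < bd) (hn : Fits w (n : ℤ)) :
    Match w bd base ⟨p, m.reg, Function.update m.mem (addr bd base k i j l) n⟩
      (s.sto k i j l n) where
  r1 := hm.r1
  r3 := hm.r3
  r5 := hm.r5
  r7 := hm.r7
  v := hm.v
  inp r hr := by
    have : r ≠ addr bd base k i j l := by unfold addr; omega
    simp [this, hm.inp r hr]
  a k' i' j' l' hi' hj' hl' := by
    by_cases h : k' = k ∧ i' = i ∧ j' = j ∧ l' = l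
    · obtain ⟨rfl, rfl, rfl, rfl⟩ := h; simp
    · have : addr bd base k' i' j' l' ≠ addr bd base k i j l :=
        fun h' => h (addr_inj hj' hl' hj hl h')
      simp [h, this, hm.a _ _ _ _ hi' hj' hl']
  freg := hm.freg
  fmem r := by
    by_cases h : r = addr bd base k i j l
    · subst h; simpa using hn
    · simpa [h] using hm.fmem r

theorem Match.put {bd base : ℕ} {m : State} {s : St} (hm : Match w bd base m s)
    {i n p : ℕ} (hi : i < base) (hn : Fits w (n : ℤ)) :
    Match w bd base ⟨p, m.reg, Function.update m.mem i n⟩ (s.put i n) where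
  r1 := hm.r1
  r3 := hm.r3
  r5 := hm.r5
  r7 := hm.r7
  v := hm.v
  inp r hr := by
    by_cases h : r = i
    · subst h; simp
    · simp [h, hm.inp r hr]
  a k' i' j' l' hi' hj' hl' := by
    have : addr bd base k' i' j' l' ≠ i := by unfold addr; omega
    simp [this, hm.a _ _ _ _ hi' hj' hl']
  freg := hm.freg
  fmem r := by
    by_cases h : r = i
    · subst h; simpa using hn
    · simpa [h] using hm.fmem r

/-- The code of `c`, started in a state that represents `s`, reaches its end within the time
measured by the clock, in a state representing one that satisfies the postcondition. -/
theorem Cmd.comp_correct {bd base : ℕ} (hw : 16 * (bd * bd * bd) + base + 16 ≤ 2 ^ w) (c : Cmd) :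
    ∀ {Q : St → Prop} {s : St} {m : State} {pos : ℕ}, m.pc = pos → Match w bd base m s →
      CodeAt P pos (c.comp pos) → c.wp bd base Q s →
      ∃ n m' s', run w P n m = some m' ∧ m'.pc = pos + c.size ∧ Match w bd base m' s' ∧ Q s' ∧
        n + s.clk ≤ s'.clk := by
  induction c with
  | skip =>
    intro Q s m pos hp hm _ h
    exact ⟨0, m, s, rfl, by simp [hp, size], hm, h, by simp⟩
  | assign x e =>
    intro Q s m pos hp hm hc h
    obtain ⟨n, hn, m1, hr1, hp1, hreg, hmem, hf, hR⟩ :=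
      Expr.comp_correct (P := P) hw e m pos 0 hp hm hc.left h.1
    have hM := hm.of_eval hreg hmem hf
    have hfe : Fits w (e.eval s : ℤ) := by rw [← hR]; exact hf _
    have hc1 := (hc.right (Expr.length_comp ..)).head
    rw [← hp1] at hc1
    refine ⟨n + 1, _, _, run_add hr1 (run_one hc1 (s' := ⟨m1.pc + 1,
      Function.update m1.reg x.reg (e.eval s : ℕ), m1.mem⟩) ?_), ?_,
      (hM.set x hfe).tick _, h.2, ?_⟩
    · simp [exec, hR, hM.r1, setReg_eq hfe]
    · simp [hp1, size]; omega
    · simp; omega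
  | store k i j l e =>
    rintro Q s m pos hp hm hc ⟨oi, oj, ol, oe, bi, bj, bl, hQ⟩
    have hc1 := hc.right (Expr.length_comp ..)
    have hc2 := hc1.right (Expr.length_comp ..)
    have hc3 := hc2.right (Expr.length_comp ..)
    have hc4 := hc3.right (Expr.length_comp ..)
    obtain ⟨n, hn, m1, hr1, hp1, hreg, hmem, hf, hR⟩ :=
      (Expr.comp_correct (P := P) hw i).triple (Expr.comp_correct hw j) (Expr.comp_correct hw l)
        hp hm hc.left hc1.left hc2.left oi oj ol
    have hM := hm.of_eval hreg hmem hf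
    obtain ⟨n', hn', m2, hr2, hp2, hreg2, hmem2, hf2, hR2⟩ :=
      Expr.comp_correct (P := P) hw e m1 _ 3 hp1 hM hc3.left oe
    have hM2 := hM.of_eval hreg2 hmem2 hf2
    have hca := hc4.left
    rw [← hp2] at hca
    obtain ⟨m3, run3, hp3, hm3, hR3, hr3, hf3⟩ := addrCode_correct hw hM2 (i := 0) (t := 4)
      (by omega) hca ((hreg2 _ (tmp_lt (by omega))).trans hR.1)
      ((hreg2 _ (tmp_lt (by omega))).trans hR.2.1) ((hreg2 _ (tmp_lt (by omega))).trans hR.2.2)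
      bi bj bl
    have hM3 : Match w bd base m3 s := hM2.of_tmp (fun r h => hr3 r (h 0) (h 4)) hm3 hf3
    have hR4 : m3.reg (tmp 3) = e.eval s := by
      rw [hr3 _ (by simp [tmp_inj]) (by simp [tmp_inj]), hR2]
    have hfe : Fits w (e.eval s : ℤ) := by rw [← hR2]; exact hf2 _
    have hc5 := (hc4.right (n := 8) rfl).head
    rw [← hp2, ← hp3] at hc5
    refine ⟨n + n' + 8 + 1, _, _, run_add (run_add (run_add hr1 hr2) run3) (run_one hc5
      (s' := ⟨m3.pc + 1, m3.reg, Function.update m3.mem (addr bd base k (i.eval s) (j.eval s)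
        (l.eval s)) (e.eval s : ℕ)⟩) ?_), ?_,
      (hM3.sto k bj bl hfe).tick _, hQ, ?_⟩
    · simp [exec, hR3, hR4]
    · simp [hp3, hp2, size]; omega
    · simp; omega
  | out i e =>
    rintro Q s m pos hp hm hc ⟨oi, oe, bi, hQ⟩
    have hc1 := hc.right (Expr.length_comp ..)
    have hc2 := (hc1.right (Expr.length_comp ..)).head
    obtain ⟨n, hn, m1, hr1, hp1, hreg, hmem, hf, hR⟩ :=
      (Expr.comp_correct (P := P) hw i).pair (Expr.comp_correct hw e) hp hm hc.left hc1.left oi oe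
    have hM := hm.of_eval hreg hmem hf
    rw [← hp1] at hc2
    have hfe : Fits w (e.eval s : ℤ) := by rw [← hR.2]; exact hf _
    refine ⟨n + 1, _, _, run_add hr1 (run_one hc2
      (s' := ⟨m1.pc + 1, m1.reg, Function.update m1.mem (i.eval s) (e.eval s : ℕ)⟩) ?_), ?_,
      (hM.put bi hfe).tick _, hQ, ?_⟩
    · simp [exec, hR]
    · simp [hp1, size]; omega
    · simp; omega
  | seq c d ihc ihd =>
    intro Q s m pos hp hm hc h
    obtain ⟨n, m1, s1, hr1, hp1, hM1, hQ1, hn⟩ := ihc hp hm hc.left h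
    obtain ⟨n', m2, s2, hr2, hp2, hM2, hQ2, hn'⟩ :=
      ihd hp1 hM1 (hc.right (length_comp ..)) hQ1
    exact ⟨n + n', m2, s2, run_add hr1 hr2, by rw [hp2]; simp [size]; omega, hM2, hQ2, by omega⟩
  | ite t c d ihc ihd =>
    rintro Q s m pos hp hm hc ⟨hok, h⟩
    obtain ⟨n, hn, m1, hr1, hp1, hreg, hmem, hf, hR⟩ :=
      Cond.comp_correct (P := P) hw t hp hm hc.left hok
    have hM := hm.of_eval hreg hmem hf
    have hc1 := hc.right (Cond.length_comp ..)
    have hj := hc1.head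
    rw [← hp1] at hj
    have hc2 := hc1.tail
    have hc3 := hc2.right (length_comp ..)
    by_cases ht : t.holds s
    · rw [if_pos ht] at h
      have hstep : run w P 1 m1 = some { m1 with pc := pos + t.cost + d.size + 2 } :=
        run_one hj (by simp [exec, hR.2 ht, hp1])
      have hM' : Match w bd base { m1 with pc := pos + t.cost + d.size + 2 } s :=
        hM.pc _
      have hc4 := hc3.tail
      rw [show pos + t.cost + 1 + d.size + 1 = pos + t.cost + d.size + 2 by omega] at hc4
      obtain ⟨n', m2, s2, hr2, hp2, hM2, hQ2, hn'⟩ := ihc rfl (hM'.tick _) hc4 h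
      refine ⟨n + 1 + n', m2, s2, run_add (run_add hr1 hstep) hr2, ?_, hM2, hQ2, ?_⟩
      · rw [hp2]; simp [size]; omega
      · simp at hn'; omega
    · rw [if_neg ht] at h
      have hstep : run w P 1 m1 = some { m1 with pc := pos + t.cost + 1 } :=
        run_one hj (by simp [exec, hR, ht, hp1])
      have hM' : Match w bd base { m1 with pc := pos + t.cost + 1 } s :=
        hM.pc _
      obtain ⟨n', m2, s2, hr2, hp2, hM2, hQ2, hn'⟩ := ihd rfl (hM'.tick _) hc2.left h
      have hj2 := hc3.head
      rw [← hp2] at hj2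
      refine ⟨n + 1 + n' + 1, _, s2, run_add (run_add (run_add hr1 hstep) hr2)
        (run_one hj2 (s' := { m2 with pc := pos + t.cost + d.size + 2 + c.size }) rfl), ?_,
        hM2.pc _, hQ2, ?_⟩
      · simp [size]; omega
      · simp at hn'; omega
  | whileDo t c ih =>
    rintro Q s m pos hp hm hc ⟨N, h⟩
    -- Inner induction on the number of unfoldings; `ih` remains the statement about the body.
    induction N generalizing s m with
    | zero => exact h.elim
    | succ N ihN =>
      obtain ⟨hok, h⟩ := h
      obtain ⟨n, hn, m1, hr1, hp1, hreg, hmem, hf, hR⟩ :=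
        Cond.comp_correct (P := P) hw t hp hm hc.left hok
      have hM := hm.of_eval hreg hmem hf
      have hc1 := hc.right (Cond.length_comp ..)
      have hj := hc1.head
      rw [← hp1] at hj
      have hc2 := hc1.tail
      by_cases ht : t.holds s
      · rw [if_pos ht] at h
        have hstep : run w P 1 m1 = some { m1 with pc := pos + t.cost + 2 } :=
          run_one hj (by simp [exec, hR.2 ht, hp1])
        have hM' : Match w bd base { m1 with pc := pos + t.cost + 2 } s :=
          hM.pc _
        have hc3 := hc2.tail
        obtain ⟨n', m2, s2, hr2, hp2, hM2, hQ2, hn'⟩ := ih rfl (hM'.tick _) hc3.left h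
        have hj2 := (hc3.right (length_comp ..)).head
        rw [show pos + t.cost + 1 + 1 + c.size = m2.pc by rw [hp2]] at hj2
        have hM2' : Match w bd base { m2 with pc := pos } s2 :=
          hM2.pc _
        obtain ⟨n3, m3, s3, hr3, hp3, hM3, hQ3, hn3⟩ := ihN rfl hM2' hQ2
        refine ⟨n + 1 + n' + 1 + n3, m3, s3, run_add (run_add (run_add (run_add hr1 hstep) hr2)
          (run_one hj2 rfl)) hr3, hp3, hM3, hQ3, ?_⟩
        simp at hn'; omega
      · rw [if_neg ht] at h
        have hstep : run w P 1 m1 = some { m1 with pc := pos + t.cost + 1 } :=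
          run_one hj (by simp [exec, hR, ht, hp1])
        have hj2 := hc2.head
        refine ⟨n + 1 + 1, _, _, run_add (run_add hr1 hstep) (run_one (by exact hj2)
          (s' := { m1 with pc := pos + t.cost + c.size + 3 }) rfl), ?_,
          (hM.pc _).tick _, h, ?_⟩
        · simp [size]; omega
        · simp; omega

/-! ### Whole programs -/

/-- Sets up the special registers; the bound on numbers is `(|A| + |B| + 2) ^ 8`. -/
def prologue : List Instr :=
  [.const 9 0, .add 2 1 9, .add 5 0 2, .const 1 0, .const 3 16, .const 9 2, .add 7 5 9,
    .mul 7 7 7, .mul 7 7 7, .mul 7 7 7]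

/-- The closing clamp makes register `0` equal to the natural number that `a` denotes, since a
negative word would also represent zero. -/
def Cmd.program (c : Cmd) : Program :=
  prologue ++ (c.comp 10 ++ (clamp 0 (10 + c.size) ++ [.halt]))

theorem execSeq_prologue {m : State} {a b : ℤ} (hpc : m.pc = 0) (h0 : m.reg 0 = a)
    (h1 : m.reg 1 = b) (f0 : Fits w 0) (f16 : Fits w 16) (f2 : Fits w 2) (fb : Fits w b)
    (fab : Fits w (a + b)) (f : Fits w (a + b + 2)) (g : Fits w ((a + b + 2) * (a + b + 2)))
    (g' : Fits w ((a + b + 2) * (a + b + 2) * ((a + b + 2) * (a + b + 2))))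
    (g'' : Fits w ((a + b + 2) * (a + b + 2) * ((a + b + 2) * (a + b + 2)) *
      ((a + b + 2) * (a + b + 2) * ((a + b + 2) * (a + b + 2))))) :
    ∃ m1, execSeq w prologue m = some m1 ∧ m1.pc = 10 ∧
      m1.mem = m.mem ∧ m1.reg = Function.update (Function.update (Function.update (Function.update
        (Function.update (Function.update m.reg 2 b) 5 (a + b)) 1 0) 3 16) 9 2) 7
          ((a + b + 2) * (a + b + 2) * ((a + b + 2) * (a + b + 2)) *
            ((a + b + 2) * (a + b + 2) * ((a + b + 2) * (a + b + 2)))) := by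
  generalize hv : a + b + 2 = v at *
  generalize hv2 : v * v = v2 at *
  generalize hv4 : v2 * v2 = v4 at *
  generalize hv8 : v4 * v4 = v8 at *
  refine ⟨⟨10, Function.update (Function.update (Function.update (Function.update (Function.update
    (Function.update m.reg 2 b) 5 (a + b)) 1 0) 3 16) 9 2) 7 v8, m.mem⟩, ?_, rfl, rfl, rfl⟩
  simp only [prologue, execSeq, exec, State.setReg, f0, f16, f2, if_true, Option.bind_some,
    Function.update_self, hpc, h0, h1, add_zero, fb, fab, ne_eq, 
    OfNat.ofNat_ne_one, OfNat.one_ne_ofNat, OfNat.zero_ne_ofNat,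
    not_false_eq_true, Function.update_of_ne, Nat.reduceEqDiff, f, g, g', g'', hv, hv2, hv4, hv8,
    zero_add, Nat.reduceAdd, Option.some.injEq, State.mk.injEq, and_true, true_and,
    Function.update_idem]
  funext r
  simp only [Function.update_apply]
  split_ifs <;> simp_all

theorem Cmd.program_correct (c : Cmd) {A B : List ℤ} {m : State}
    (hw : (A.length + B.length + 2) ^ 30 ≤ 2 ^ w) (hm : IsInput w A B m) {Q : St → Prop}
    (h : ∀ s : St, s.v .a = A.length → s.v .b = B.length → s.clk = 0 →
      (∀ i (hi : i < (A ++ B).length), s.inp i = (A ++ B)[i]) →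
      c.wp ((A.length + B.length + 2) ^ 8) (A.length + B.length) Q s) :
    ∃ n m' s', HaltsIn w c.program m n m' ∧ n ≤ s'.clk + 12 ∧ Q s' ∧
      m'.reg 0 = s'.v .a ∧ m'.reg 1 = 0 ∧ ∀ i < A.length + B.length, m'.mem i = s'.inp i := by
  obtain ⟨hpc, h0, h1, hin, hfr, hfm⟩ := hm
  obtain ⟨N, hN⟩ : ∃ N, A.length + B.length + 2 = N := ⟨_, rfl⟩
  rw [hN] at hw h
  -- Indices are bounded by `N ^ 8`, addresses hence by about `16 * N ^ 24`. As `N ≥ 2`, the six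
  -- remaining powers give a factor `64`, enough for the stride `16` and the lower terms.
  have h24 : N ^ 24 * 64 ≤ 2 ^ w := by
    refine le_trans ?_ hw
    rw [show (30 : ℕ) = 24 + 6 from rfl, pow_add]
    exact Nat.mul_le_mul_left _
      (le_trans (by norm_num) (Nat.pow_le_pow_left (show 2 ≤ N by omega) 6))
  have hpos : 0 < N := by omega
  have hle : ∀ k, 1 ≤ k → k ≤ 24 → N ^ k ≤ N ^ 24 := fun k _ hk => Nat.pow_le_pow_right hpos hk
  have hN1 : N ≤ N ^ 24 := by simpa using hle 1 le_rfl (by omega)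
  have hN8 : N ^ 8 * N ^ 8 * N ^ 8 = N ^ 24 := by ring
  have hbound : 16 * (N ^ 8 * N ^ 8 * N ^ 8) + (A.length + B.length) + 16 ≤ 2 ^ w := by
    have : 1 ≤ N ^ 24 := Nat.one_le_pow _ _ hpos
    omega
  have fle : ∀ n : ℕ, n ≤ 63 * N ^ 24 → Fits w (n : ℤ) := by
    intro n hn
    have : 1 ≤ N ^ 24 := Nat.one_le_pow _ _ hpos
    rw [fits_natCast]; omega
  have hN1' : 1 ≤ N ^ 24 := Nat.one_le_pow _ _ hpos
  have f0 : Fits w 0 := fle 0 (by omega)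
  have f16 : Fits w 16 := fle 16 (by omega)
  have f2 : Fits w 2 := fle 2 (by omega)
  have fB : Fits w (B.length : ℤ) := fle _ (by omega)
  have fAB : Fits w ((A.length : ℤ) + B.length) := by
    exact_mod_cast fle (A.length + B.length) (by omega)
  have eN : (A.length : ℤ) + B.length + 2 = (N : ℕ) := by rw [← hN]; push_cast; ring
  have e2 : (N : ℤ) * N = ((N ^ 2 : ℕ) : ℤ) := by push_cast; ring
  have fN2 : Fits w ((N : ℤ) * N) := by
    rw [e2]; exact fle _ ((hle 2 (by omega) (by omega)).trans (by omega))
  have e4 : (N : ℤ) * N * (N * N) = ((N ^ 4 : ℕ) : ℤ) := by push_cast; ring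
  have fN4 : Fits w ((N : ℤ) * N * (N * N)) := by
    rw [e4]; exact fle _ ((hle 4 (by omega) (by omega)).trans (by omega))
  have e8 : (N : ℤ) * N * (N * N) * (N * N * (N * N)) = ((N ^ 8 : ℕ) : ℤ) := by push_cast; ring
  have fN8 : Fits w ((N : ℤ) * N * (N * N) * (N * N * (N * N))) := by
    rw [e8]; exact fle _ ((hle 8 (by omega) (by omega)).trans (by omega))
  have hcode : ∀ code, code = c.program → CodeAt c.program 0 code := by
    rintro code rfl i hi
    simp
  have hc := hcode _ rfl
  have hpro := hc.left
  have hrest := hc.right (n := 10) rfl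
  rw [zero_add] at hrest
  obtain ⟨m1, run1, hp1, hmem1, hreg1⟩ : ∃ m1, run w c.program 10 m = some m1 ∧ m1.pc = 10 ∧
      m1.mem = m.mem ∧ m1.reg = Function.update (Function.update (Function.update (Function.update
        (Function.update (Function.update m.reg 2 (B.length : ℤ)) 5 ((A.length : ℤ) + B.length)) 1 0)
          3 16) 9 2) 7 ((N ^ 8 : ℕ) : ℤ) := by
    obtain ⟨m1, h1, h2, h3, h4⟩ := execSeq_prologue hpc h0 h1 f0 f16 f2 fB fAB
      (by rw [eN]; exact fle _ (by omega)) (by rw [eN]; exact fN2) (by rw [eN]; exact fN4)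
      (by rw [eN]; exact fN8)
    rw [eN, e8] at h4
    exact ⟨m1, run_execSeq (by rw [hpc]; exact hpro) h1, h2, h3, h4⟩
  -- The represented state is read off the machine by `toNat`, whatever the uninitialized cells and
  -- registers contain.
  have hM : Match w (N ^ 8) (A.length + B.length) m1
      ⟨fun x => (m1.reg x.reg).toNat, fun k i j l =>
        (m1.mem (addr (N ^ 8) (A.length + B.length) k i j l)).toNat, m1.mem, 0⟩ := by
    refine ⟨?_, ?_, ?_, ?_, fun _ => rfl, fun _ _ => rfl, fun _ _ _ _ _ _ _ => rfl, fun r => ?_,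
      fun r => by rw [hmem1]; exact hfm r⟩
    · rw [hreg1]; simp
    · rw [hreg1]; simp
    · rw [hreg1]; simp
    · rw [hreg1]; simp
    · have f8 : Fits w ((N ^ 8 : ℕ) : ℤ) := fle _ (by have := hle 8 (by omega) (by omega); omega)
      rw [hreg1]
      simp only [Function.update_apply]
      split_ifs
      · exact f8
      · exact f2
      · exact f16
      · exact f0
      · exact fAB
      · exact fB
      · exact hfr r
  obtain ⟨n, m2, s2, run2, hp2, hM2, hQ, hn⟩ := c.comp_correct (P := c.program) hbound hp1 hM
    hrest.left (h _ (by simp [hreg1, Var.reg, Var.ctorIdx, h0])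
      (by simp [hreg1, Var.reg, Var.ctorIdx]) rfl
      (fun i hi => by simp only [hmem1]; exact hin i hi))
  have hcl := hrest.right (length_comp ..)
  have hcl1 := hcl.left
  rw [← hp2] at hcl1
  obtain ⟨n3, hn3, run3⟩ := run_clamp (w := w) hcl1 hM2.r1
  have hhalt := (hcl.right (n := 2) rfl).head
  rw [← hp2] at hhalt
  -- Ten steps of the prologue and at most two of the final clamp make up the additive `12`.
  refine ⟨10 + n + n3, _, s2, ⟨run_add (run_add run1 run2) run3, hhalt⟩, ?_, hQ, ?_, ?_, ?_⟩
  · simp only [add_zero] at hn; omega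
  · have := hM2.v .a
    simp only [Var.reg, Var.ctorIdx, mul_zero] at this
    simp [this]
  · simp [hM2.r1]
  · exact hM2.inp

end

end Imp


/-! ## Significant pairs -/

namespace LCIS

/-- The symbol at a position, with a default value outside the list. -/
def sym (L : List ℤ) (i : ℕ) : ℤ := L.getD i 0

/-- `(x, y)` is a matching pair. -/
def Mt (A B : List ℤ) (x y : ℕ) : Prop := x < A.length ∧ y < B.length ∧ sym A x = sym B y

variable {A B : List ℤ}

theorem getElem?_eq_some_iff_sym {L : List ℤ} {i : ℕ} {σ : ℤ} :
    L[i]? = some σ ↔ i < L.length ∧ sym L i = σ := by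
  unfold sym
  by_cases h : i < L.length
  · simp [h, List.getD]
  · simp [h]

theorem isSigmaPair_iff {σ : ℤ} {p : ℕ × ℕ} :
    IsSigmaPair A B σ p ↔ Mt A B p.1 p.2 ∧ sym B p.2 = σ := by
  unfold IsSigmaPair Mt
  rw [getElem?_eq_some_iff_sym, getElem?_eq_some_iff_sym]
  constructor
  · rintro ⟨⟨h1, h2⟩, h3, h4⟩
    exact ⟨⟨h1, h3, h2.trans h4.symm⟩, h4⟩
  · rintro ⟨⟨h1, h2, h3⟩, h4⟩
    exact ⟨⟨h1, h3.trans h4⟩, h2, h4⟩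

theorem isMatching_iff {p : ℕ × ℕ} : IsMatching A B p ↔ Mt A B p.1 p.2 := by
  simp [IsMatching, isSigmaPair_iff]

theorem prec_iff {p q : ℕ × ℕ} : Prec A B p q ↔ Mt A B p.1 p.2 ∧ Mt A B q.1 q.2 ∧
    p.1 < q.1 ∧ p.2 < q.2 ∧ sym B p.2 < sym B q.2 := by
  unfold Prec
  simp only [isSigmaPair_iff]
  constructor
  · rintro ⟨h1, h2, σ, τ, ⟨h3, rfl⟩, ⟨h4, rfl⟩, h5⟩
    exact ⟨h3, h4, h1, h2, h5⟩
  · rintro ⟨h3, h4, h1, h2, h5⟩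
    exact ⟨h1, h2, _, _, ⟨h3, rfl⟩, ⟨h4, rfl⟩, h5⟩

theorem Prec.trans {p q r : ℕ × ℕ} (h : Prec A B p q) (h' : Prec A B q r) : Prec A B p r := by
  rw [prec_iff] at *
  exact ⟨h.1, h'.2.1, h.2.2.1.trans h'.2.2.1, h.2.2.2.1.trans h'.2.2.2.1,
    h.2.2.2.2.trans h'.2.2.2.2⟩

instance : Trans (Prec A B) (Prec A B) (Prec A B) := ⟨Prec.trans⟩

/-- Both coordinates increase strictly along a chain. Besides bounding all values, this later
ensures that the output fits into the cells of the input. -/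
theorem IsCIS.length_le {L : List (ℕ × ℕ)} (h : IsCIS A B L) :
    L.length ≤ A.length ∧ L.length ≤ B.length := by
  have hp : L.Pairwise (Prec A B) := List.isChain_iff_pairwise.mp h.2
  have key : ∀ (f : ℕ × ℕ → ℕ) (n : ℕ), (∀ p q, Prec A B p q → f p < f q) →
      (∀ p ∈ L, f p < n) → L.length ≤ n := by
    intro f n hf hn
    have h1 : (L.map f).Nodup := by
      rw [List.Nodup, List.pairwise_map]
      exact hp.imp fun h => (hf _ _ h).ne
    have h2 : (L.map f).toFinset ⊆ Finset.range n := by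
      intro z hz
      simp only [List.mem_toFinset, List.mem_map] at hz
      obtain ⟨p, hp, rfl⟩ := hz
      simpa using hn p hp
    have := Finset.card_le_card h2
    rw [List.toFinset_card_of_nodup h1] at this
    simpa using this
  have hm : ∀ p ∈ L, Mt A B p.1 p.2 := fun p hp => isMatching_iff.mp (h.1 p hp)
  exact ⟨key Prod.fst _ (fun p q h => h.1) fun p hp => (hm p hp).1,
    key Prod.snd _ (fun p q h => h.2.1) fun p hp => (hm p hp).2.1⟩

theorem bddAbove_lengths (p : ℕ × ℕ) :
    BddAbove {k | ∃ L, IsCIS A B L ∧ L.getLast? = some p ∧ L.length = k} :=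
  ⟨A.length, by rintro k ⟨L, hL, -, rfl⟩; exact hL.length_le.1⟩

theorem IsCIS.le_lcisTo {L : List (ℕ × ℕ)} (h : IsCIS A B L) {p : ℕ × ℕ}
    (hp : L.getLast? = some p) : L.length ≤ lcisTo A B p :=
  le_csSup (bddAbove_lengths p) ⟨L, h, hp, rfl⟩

theorem exists_lcisTo {p : ℕ × ℕ} (hp : Mt A B p.1 p.2) :
    ∃ L, IsCIS A B L ∧ L.getLast? = some p ∧ L.length = lcisTo A B p := by
  have : ({k | ∃ L, IsCIS A B L ∧ L.getLast? = some p ∧ L.length = k} : Set ℕ).Nonempty :=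
    ⟨1, [p], ⟨by simpa [isMatching_iff] using hp, by simp⟩, by simp, rfl⟩
  exact Nat.sSup_mem this (bddAbove_lengths p)

theorem one_le_lcisTo {p : ℕ × ℕ} (hp : Mt A B p.1 p.2) : 1 ≤ lcisTo A B p :=
  IsCIS.le_lcisTo (L := [p]) ⟨by simpa [isMatching_iff] using hp, by simp⟩ (by simp)

theorem isCIS_append_singleton {L : List (ℕ × ℕ)} {p : ℕ × ℕ} : IsCIS A B (L ++ [p]) ↔
    IsCIS A B L ∧ Mt A B p.1 p.2 ∧ ∀ q, L.getLast? = some q → Prec A B q p := by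
  unfold IsCIS
  rw [List.isChain_append]
  simp only [List.mem_append, List.mem_singleton, or_imp, forall_and, forall_eq, isMatching_iff,
    List.isChain_singleton, List.head?_cons, Option.mem_def, Option.some.injEq, forall_eq',
    true_and]
  tauto

theorem lcisTo_lt {p q : ℕ × ℕ} (h : Prec A B q p) : lcisTo A B q + 1 ≤ lcisTo A B p := by
  have h' := prec_iff.mp h
  obtain ⟨L, hL, hq, hl⟩ := exists_lcisTo h'.1
  have : IsCIS A B (L ++ [p]) := isCIS_append_singleton.mpr ⟨hL, h'.2.1, fun r hr => by
    rw [hq] at hr; obtain rfl := Option.some.inj hr; exact h⟩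
  have := this.le_lcisTo (p := p) (by simp)
  simpa [hl] using this

/-- Remove the last pair of an optimal sequence; `lcisTo_lt` shows that the value drops by exactly
one. -/
theorem exists_prec {p : ℕ × ℕ} (hp : Mt A B p.1 p.2) :
    lcisTo A B p = 1 ∨ ∃ q, Prec A B q p ∧ lcisTo A B p = lcisTo A B q + 1 := by
  obtain ⟨L, hL, hq, hl⟩ := exists_lcisTo hp
  obtain ⟨L', rfl⟩ : ∃ L', L = L' ++ [p] := by
    rw [List.getLast?_eq_some_iff] at hq; exact hq
  rcases h : L'.getLast? with _ | q
  · rw [List.getLast?_eq_none_iff] at h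
    subst h
    left; simpa using hl.symm
  · right
    obtain ⟨h1, h2, h3⟩ := isCIS_append_singleton.mp hL
    refine ⟨q, h3 q h, ?_⟩
    have h4 := h1.le_lcisTo h
    have h5 := lcisTo_lt (h3 q h)
    simp only [List.length_append, List.length_singleton] at hl
    omega

/-- `lcisTo` is monotone on the pairs with a fixed symbol. -/
theorem lcisTo_mono {p q : ℕ × ℕ} (hq : Mt A B q.1 q.2) (hp : Mt A B p.1 p.2) (h1 : q.1 ≤ p.1)
    (h2 : q.2 ≤ p.2) (hs : sym B q.2 = sym B p.2) : lcisTo A B q ≤ lcisTo A B p := by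
  rcases exists_prec hq with h | ⟨r, hr, h⟩
  · rw [h]; exact one_le_lcisTo hp
  · rw [h]
    rw [prec_iff] at hr
    exact lcisTo_lt (prec_iff.mpr ⟨hr.1, hp, hr.2.2.1.trans_le h1, hr.2.2.2.1.trans_le h2,
      hs ▸ hr.2.2.2.2⟩)

theorem IsSignificant.mt {x y : ℕ} (h : IsSignificant A B (x, y)) : Mt A B x y := by
  obtain ⟨σ, h, -⟩ := h
  exact (isSigmaPair_iff.mp h).1

/-- Descent on the sum of the coordinates: a pair that is not significant has another pair of its
symbol below it with at least its value, hence by `lcisTo_mono` with the same value. -/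
theorem exists_significant_aux (n : ℕ) : ∀ p : ℕ × ℕ, p.1 + p.2 ≤ n → Mt A B p.1 p.2 →
    ∃ q, IsSignificant A B q ∧ q.1 ≤ p.1 ∧ q.2 ≤ p.2 ∧ sym B q.2 = sym B p.2 ∧
      lcisTo A B q = lcisTo A B p := by
  induction n with
  | zero =>
    intro p hn hp
    refine ⟨p, ⟨_, isSigmaPair_iff.mpr ⟨hp, rfl⟩, fun q _ hle hne => ?_⟩, le_rfl, le_rfl, rfl, rfl⟩
    exact absurd (Prod.ext (by have := hle.1; omega) (by have := hle.2; omega)) hne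
  | succ n ih =>
    intro p hn hp
    by_cases h : IsSignificant A B p
    · exact ⟨p, h, le_rfl, le_rfl, rfl, rfl⟩
    · unfold IsSignificant at h
      push Not at h
      obtain ⟨q, hq, hle, hne, hl⟩ := h _ (isSigmaPair_iff.mpr ⟨hp, rfl⟩)
      obtain ⟨hq, hs⟩ := isSigmaPair_iff.mp hq
      have h1 := lcisTo_mono hq hp hle.1 hle.2 hs
      have h2 : q.1 + q.2 ≤ n := by
        have h3 := hle.1
        have h4 := hle.2
        by_contra hcon
        exact hne (Prod.ext (by omega) (by omega))
      obtain ⟨r, hr, ha, hb, hc, hd⟩ := ih q h2 hq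
      exact ⟨r, hr, ha.trans hle.1, hb.trans hle.2, hc.trans hs, by omega⟩

theorem exists_significant {p : ℕ × ℕ} (hp : Mt A B p.1 p.2) :
    ∃ q, IsSignificant A B q ∧ q.1 ≤ p.1 ∧ q.2 ≤ p.2 ∧ sym B q.2 = sym B p.2 ∧
      lcisTo A B q = lcisTo A B p := exists_significant_aux _ p le_rfl hp

/-! ### Values of pairs and a local test for significance -/

/-- The length of a longest common increasing subsequence ending with `(x, y)`. -/
noncomputable def val (A B : List ℤ) (x y : ℕ) : ℕ := lcisTo A B (x, y)

theorem val_pos {x y : ℕ} (h : Mt A B x y) : 1 ≤ val A B x y := one_le_lcisTo (p := (x, y)) h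

theorem val_lt {x y x' y' : ℕ} (h : Mt A B x y) (h' : Mt A B x' y') (hx : x' < x) (hy : y' < y)
    (hs : sym B y' < sym B y) : val A B x' y' + 1 ≤ val A B x y :=
  lcisTo_lt (p := (x, y)) (q := (x', y')) (prec_iff.mpr ⟨h', h, hx, hy, hs⟩)

theorem val_mono {x y x' y' : ℕ} (h : Mt A B x y) (h' : Mt A B x' y') (hx : x' ≤ x) (hy : y' ≤ y)
    (hs : sym B y' = sym B y) : val A B x' y' ≤ val A B x y :=
  lcisTo_mono (p := (x, y)) (q := (x', y')) h' h hx hy hs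

/-- The value of a pair is one more than that of some significant pair preceding it, if any. -/
theorem val_eq {x y : ℕ} (h : Mt A B x y) : val A B x y = 1 ∨ ∃ x' y',
    IsSignificant A B (x', y') ∧ x' < x ∧ y' < y ∧ sym B y' < sym B y ∧
      val A B x y = val A B x' y' + 1 := by
  rcases exists_prec (p := (x, y)) h with h1 | ⟨q, hq, h1⟩
  · exact Or.inl h1
  · right
    rw [prec_iff] at hq
    obtain ⟨⟨x', y'⟩, hr, ha, hb, hc, hd⟩ := exists_significant hq.1
    refine ⟨x', y', hr, ha.trans_lt hq.2.2.1, hb.trans_lt hq.2.2.2.1, ?_, ?_⟩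
    · have : sym B y' = sym B q.2 := hc
      rw [this]; exact hq.2.2.2.2
    · change lcisTo A B (x, y) = lcisTo A B (x', y') + 1
      rw [h1, hd]

/-- A pair is significant iff its value exceeds those to the left in its row and those of the
earlier significant pairs of its column. -/
theorem isSignificant_iff {x y : ℕ} (h : Mt A B x y) : IsSignificant A B (x, y) ↔
    (∀ y' < y, sym B y' = sym B y → val A B x y' < val A B x y) ∧
      ∀ x' < x, IsSignificant A B (x', y) → val A B x' y < val A B x y := by
  constructor
  · rintro ⟨σ, hσ, hmin⟩
    obtain ⟨-, hs⟩ := isSigmaPair_iff.mp hσ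
    refine ⟨fun y' hy' hs' => ?_, fun x' hx' hsig => ?_⟩
    · exact hmin (x, y') (isSigmaPair_iff.mpr ⟨⟨h.1, hy'.trans h.2.1, h.2.2.trans hs'.symm⟩,
        hs'.trans hs⟩) ⟨le_rfl, hy'.le⟩ (by simp [hy'.ne])
    · exact hmin (x', y) (isSigmaPair_iff.mpr ⟨hsig.mt, hs⟩) ⟨hx'.le, le_rfl⟩ (by simp [hx'.ne])
  · rintro ⟨h1, h2⟩
    refine ⟨sym B y, isSigmaPair_iff.mpr ⟨h, rfl⟩, ?_⟩
    -- A pair in an earlier column can be moved to row `x` of that column without losing value,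
    -- where the condition on the row applies.
    have key : ∀ x' y', Mt A B x' y' → sym B y' = sym B y → x' ≤ x → y' < y →
        val A B x' y' < val A B x y := by
      intro x' y' hm hs hx hy
      exact (val_mono ⟨h.1, hm.2.1, h.2.2.trans hs.symm⟩ hm hx le_rfl rfl).trans_lt (h1 y' hy hs)
    rintro ⟨x', y'⟩ hq hle hne
    obtain ⟨hm, hs⟩ := isSigmaPair_iff.mp hq
    have hx : x' ≤ x := hle.1
    have hy : y' ≤ y := hle.2
    rcases hy.lt_or_eq with hy | rfl
    · exact key x' y' hm hs hx hy
    · have hx : x' < x := lt_of_le_of_ne hx fun h => hne (by rw [h])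
      -- In the same column, pass to a significant pair of equal value: it lies in an earlier
      -- column, or the condition on the column applies to it.
      obtain ⟨⟨x2, y2⟩, hr, ha, hb, hc, hd⟩ := exists_significant hm
      have ha : x2 ≤ x' := ha
      have hb : y2 ≤ y' := hb
      rw [← hd]
      rcases hb.lt_or_eq with hb | rfl
      · exact key x2 y2 hr.mt hc (ha.trans hx.le) hb
      · exact h2 x2 (ha.trans_lt hx) hr

/-- The end of any sequence has the same value as some significant pair, so comparing with
significant pairs suffices. -/
theorem isLongestCIS_of {L : List (ℕ × ℕ)} (hL : IsCIS A B L)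
    (h : ∀ x y, IsSignificant A B (x, y) → val A B x y ≤ L.length) : IsLongestCIS A B L := by
  refine ⟨hL, fun L' hL' => ?_⟩
  rcases hp : L'.getLast? with _ | p
  · rw [List.getLast?_eq_none_iff] at hp
    simp [hp]
  · have h1 := hL'.le_lcisTo hp
    have hm : Mt A B p.1 p.2 := isMatching_iff.mp (hL'.1 p (List.mem_of_getLast? hp))
    obtain ⟨⟨x, y⟩, hq, -, -, -, h2⟩ := exists_significant hm
    have := h x y hq
    unfold val at this
    omega

theorem val_le {x y : ℕ} (h : Mt A B x y) : val A B x y ≤ A.length ∧ val A B x y ≤ B.length := by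
  obtain ⟨L, hL, -, hl⟩ := exists_lcisTo (p := (x, y)) h
  unfold val
  rw [← hl]
  exact hL.length_le

end LCIS


/-! ## Program logic -/

namespace Imp

open LCIS

section

variable (s : St) (bd len : ℕ) (e f : Expr) (n : ℕ) (x : Var)

@[simp] theorem Expr.eval_add : (e + f).eval s = e.eval s + f.eval s := rfl
@[simp] theorem Expr.eval_sub : (e - f).eval s = e.eval s - f.eval s := rfl
@[simp] theorem Expr.eval_mul : (e * f).eval s = e.eval s * f.eval s := rfl
@[simp] theorem Expr.eval_div : (e / f).eval s = e.eval s / f.eval s := rfl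
@[simp] theorem Expr.eval_zero : (0 : Expr).eval s = 0 := rfl
@[simp] theorem Expr.eval_one : (1 : Expr).eval s = 1 := rfl
@[simp] theorem Expr.eval_ofNat : (no_index (OfNat.ofNat n) : Expr).eval s = OfNat.ofNat n := rfl
@[simp] theorem Expr.eval_var : (x : Expr).eval s = s.v x := rfl
@[simp] theorem Expr.eval_ld (k : Arr) (i j l : Expr) :
    (Expr.ld k i j l).eval s = s.a k (i.eval s) (j.eval s) (l.eval s) := rfl

@[simp] theorem Expr.ok_add :
    (e + f).ok bd s ↔ e.ok bd s ∧ f.ok bd s ∧ e.eval s + f.eval s < bd := Iff.rfl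
@[simp] theorem Expr.ok_sub : (e - f).ok bd s ↔ e.ok bd s ∧ f.ok bd s := Iff.rfl
@[simp] theorem Expr.ok_mul :
    (e * f).ok bd s ↔ e.ok bd s ∧ f.ok bd s ∧ e.eval s * f.eval s < bd := Iff.rfl
@[simp] theorem Expr.ok_div :
    (e / f).ok bd s ↔ e.ok bd s ∧ f.ok bd s ∧ f.eval s ≠ 0 := Iff.rfl
@[simp] theorem Expr.ok_zero : (0 : Expr).ok bd s ↔ 0 < bd := Iff.rfl
@[simp] theorem Expr.ok_one : (1 : Expr).ok bd s ↔ 1 < bd := Iff.rfl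
@[simp] theorem Expr.ok_ofNat :
    (no_index (OfNat.ofNat n) : Expr).ok bd s ↔ OfNat.ofNat n < bd := Iff.rfl
@[simp] theorem Expr.ok_var : (x : Expr).ok bd s ↔ True := Iff.rfl
@[simp] theorem Expr.ok_ld (k : Arr) (i j l : Expr) : (Expr.ld k i j l).ok bd s ↔
    i.ok bd s ∧ j.ok bd s ∧ l.ok bd s ∧ i.eval s < bd ∧ j.eval s < bd ∧ l.eval s < bd := Iff.rfl

@[simp] theorem Expr.cost_add : (e + f).cost = e.cost + f.cost + 1 := rfl
@[simp] theorem Expr.cost_sub : (e - f).cost = e.cost + f.cost + 3 := rfl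
@[simp] theorem Expr.cost_mul : (e * f).cost = e.cost + f.cost + 1 := rfl
@[simp] theorem Expr.cost_div : (e / f).cost = e.cost + f.cost + 1 := rfl
@[simp] theorem Expr.cost_zero : (0 : Expr).cost = 1 := rfl
@[simp] theorem Expr.cost_one : (1 : Expr).cost = 1 := rfl
@[simp] theorem Expr.cost_ofNat : (no_index (OfNat.ofNat n) : Expr).cost = 1 := rfl
@[simp] theorem Expr.cost_var : (x : Expr).cost = 3 := rfl
@[simp] theorem Expr.cost_ld (k : Arr) (i j l : Expr) :
    (Expr.ld k i j l).cost = i.cost + j.cost + l.cost + 11 := rfl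

end

attribute [simp] Cond.holds Cond.ok Cond.cost

section

variable {bd len : ℕ} {Q : St → Prop} {s : St}

@[simp] theorem Cmd.wp_skip : Cmd.skip.wp bd len Q s ↔ Q s := Iff.rfl

@[simp] theorem Cmd.wp_assign {x : Var} {e : Expr} : (x ≔ e).wp bd len Q s ↔
    e.ok bd s ∧ Q ((s.set x (e.eval s)).tick (e.cost + 1)) := Iff.rfl

@[simp] theorem Cmd.wp_store {k : Arr} {i j l e : Expr} : (Cmd.store k i j l e).wp bd len Q s ↔
    i.ok bd s ∧ j.ok bd s ∧ l.ok bd s ∧ e.ok bd s ∧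
      i.eval s < bd ∧ j.eval s < bd ∧ l.eval s < bd ∧
      Q ((s.sto k (i.eval s) (j.eval s) (l.eval s) (e.eval s)).tick
        (i.cost + j.cost + l.cost + e.cost + 9)) := Iff.rfl

@[simp] theorem Cmd.wp_out {i e : Expr} : (Cmd.out i e).wp bd len Q s ↔
    i.ok bd s ∧ e.ok bd s ∧ i.eval s < len ∧
      Q ((s.put (i.eval s) (e.eval s)).tick (i.cost + e.cost + 1)) := Iff.rfl

@[simp] theorem Cmd.wp_seq' {c d : Cmd} :
    (c ;; d).wp bd len Q s ↔ c.wp bd len (d.wp bd len Q) s := Iff.rfl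

theorem Cmd.wp_ite {t : Cond} {c d : Cmd} (h : t.ok bd len s)
    (h1 : t.holds s → c.wp bd len Q (s.tick (t.cost + 2)))
    (h2 : ¬ t.holds s → d.wp bd len Q (s.tick (t.cost + 2))) : (Cmd.ite t c d).wp bd len Q s := by
  refine ⟨h, ?_⟩
  split_ifs with hc
  · exact h1 hc
  · exact h2 hc

/-- Repeat the body while the variable, incremented after each round, is below `e`. -/
def Cmd.upto (i : Var) (e : Expr) (c : Cmd) : Cmd := .whileDo (.lt i e) (c ;; i ≔ i + 1)

/-- The invariant is indexed by the counter. Apart from evaluating `e`, a round spends `6` on test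
and jumps and `6` on the increment. -/
theorem Cmd.wp_upto {i : Var} {e : Expr} {c : Cmd} (I : ℕ → St → Prop) (n N : ℕ) (hnN : n ≤ N)
    (hN : N < bd) (hI : ∀ k s, I k s → s.v i = k ∧ e.eval s = N ∧ e.ok bd s) (h0 : I n s)
    (hstep : ∀ k s, n ≤ k → k < N → I k s → c.wp bd len
      (fun s' => s'.v i = k ∧ I (k + 1) ((s'.set i (k + 1)).tick 6)) (s.tick (e.cost + 6)))
    (hexit : ∀ s, I N s → Q (s.tick (e.cost + 6))) : (Cmd.upto i e c).wp bd len Q s := by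
  refine Cmd.wp_while (fun s => ∃ k, n ≤ k ∧ k ≤ N ∧ I k s) (fun s => N - s.v i) ?_ ?_ ?_ s
    ⟨n, le_rfl, hnN, h0⟩
  · rintro s ⟨k, -, -, h⟩
    exact ⟨trivial, (hI k s h).2.2⟩
  · rintro s ⟨k, h1, h2, h⟩ ht
    obtain ⟨h3, h4, h5⟩ := hI k s h
    simp only [Cond.holds, Expr.eval_var, h3, h4] at ht
    have hc : (Cond.lt i e).cost + 3 = e.cost + 6 := by simp; ring
    rw [hc]
    refine Cmd.wp_mono c ?_ _ (hstep k s h1 ht h)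
    rintro s' ⟨h6, h7⟩
    simp only [wp_assign, Expr.ok_add, Expr.ok_var, Expr.ok_one, Expr.eval_add, Expr.eval_var, h6,
      Expr.eval_one, true_and]
    refine ⟨⟨by omega, by omega⟩, ⟨k + 1, by omega, by omega, h7⟩, ?_⟩
    simp only [St.tick_v, St.set_v, if_true, h3]
    omega
  · rintro s ⟨k, h1, h2, h⟩ ht
    obtain ⟨h3, h4, h5⟩ := hI k s h
    simp only [Cond.holds, Expr.eval_var, h3, h4] at ht
    have hc : (Cond.lt i e).cost + 3 = e.cost + 6 := by simp; ring
    rw [hc]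
    obtain rfl : k = N := by omega
    exact hexit s h

end

/-- The variables `a`, `b` and the input region hold the input. -/
structure Base (A B : List ℤ) (s : St) : Prop where
  a : s.v .a = A.length
  b : s.v .b = B.length
  inpA : ∀ x < A.length, s.inp x = sym A x
  inpB : ∀ y < B.length, s.inp (A.length + y) = sym B y

theorem Base.congr {A B : List ℤ} {s s' : St} (h : Base A B s) (ha : s'.v .a = s.v .a)
    (hb : s'.v .b = s.v .b) (hi : s'.inp = s.inp) : Base A B s' :=
  ⟨ha.trans h.a, hb.trans h.b, by rw [hi]; exact h.inpA, by rw [hi]; exact h.inpB⟩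

theorem Base.same {A B : List ℤ} {s s' : St} {c : Cmd} (h : Base A B s) (hs : Cmd.Same c s s')
    (ha : c.wv .a = false) (hb : c.wv .b = false) (hi : c.wi = false) : Base A B s' :=
  h.congr (hs.v _ ha) (hs.v _ hb) (hs.inp hi)

end Imp


/-! ## Sorting the columns by their symbols -/

namespace Imp

open LCIS

/-- The values of `f` on `[lo, hi)`. -/
def seg (f : ℕ → ℕ) (lo hi : ℕ) : List ℕ := (List.range' lo (hi - lo)).map f

theorem seg_self (f : ℕ → ℕ) (lo : ℕ) : seg f lo lo = [] := by simp [seg]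

theorem seg_cons (f : ℕ → ℕ) {lo hi : ℕ} (h : lo < hi) :
    seg f lo hi = f lo :: seg f (lo + 1) hi := by
  unfold seg
  rw [show hi - lo = (hi - (lo + 1)) + 1 by omega, List.range'_succ]
  simp

theorem seg_append (f : ℕ → ℕ) {lo mid hi : ℕ} (h : lo ≤ mid) (h' : mid ≤ hi) :
    seg f lo mid ++ seg f mid hi = seg f lo hi := by
  unfold seg
  rw [← List.map_append]
  have := List.range'_append (s := lo) (m := mid - lo) (n := hi - mid) (step := 1)
  rw [one_mul, show lo + (mid - lo) = mid by omega] at this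
  rw [this, show mid - lo + (hi - mid) = hi - lo by omega]

theorem seg_snoc (f : ℕ → ℕ) {lo hi : ℕ} (h : lo ≤ hi) :
    seg f lo (hi + 1) = seg f lo hi ++ [f hi] := by
  rw [← seg_append f h (Nat.le_succ hi), seg_cons f (Nat.lt_succ_self hi), seg_self]

theorem seg_congr {f g : ℕ → ℕ} {lo hi : ℕ} (h : ∀ i, lo ≤ i → i < hi → f i = g i) :
    seg f lo hi = seg g lo hi := by
  unfold seg
  apply List.map_congr_left
  intro i hi
  rw [List.mem_range'_1] at hi
  exact h i hi.1 (by omega)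

theorem mem_seg {f : ℕ → ℕ} {lo hi y : ℕ} : y ∈ seg f lo hi ↔ ∃ i, lo ≤ i ∧ i < hi ∧ f i = y := by
  unfold seg
  simp only [List.mem_map, List.mem_range'_1]
  constructor
  · rintro ⟨i, h, rfl⟩; exact ⟨i, h.1, by omega, rfl⟩
  · rintro ⟨i, h1, h2, rfl⟩; exact ⟨i, ⟨h1, by omega⟩, rfl⟩

theorem pairwise_seg {f : ℕ → ℕ} {R : ℕ → ℕ → Prop} {lo hi : ℕ} :
    (seg f lo hi).Pairwise R ↔ ∀ i j, lo ≤ i → i < j → j < hi → R (f i) (f j) := by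
  unfold seg
  rw [List.pairwise_map, List.pairwise_iff_getElem]
  simp only [List.length_range', List.getElem_range', one_mul]
  constructor
  · intro h i j h1 h2 h3
    have := h (i - lo) (j - lo) (by omega) (by omega) (by omega)
    rwa [show lo + (i - lo) = i by omega, show lo + (j - lo) = j by omega] at this
  · intro h i j h1 h2 h3
    exact h _ _ (by omega) (by omega) (by omega)

def mergeTakeL : Cmd :=
  .store .sort (Var.lev + 1) Var.k 0 (.ld .sort Var.lev Var.i 0) ;; Var.i ≔ Var.i + 1

def mergeTakeR : Cmd :=
  .store .sort (Var.lev + 1) Var.k 0 (.ld .sort Var.lev Var.j 0) ;; Var.j ≔ Var.j + 1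

def mergeBody : Cmd :=
  .ite (.lt Var.i Var.mid)
    (.ite (.lt Var.j Var.hi)
      (.ite (.ilt (Var.a + Expr.ld .sort Var.lev Var.j 0) (Var.a + Expr.ld .sort Var.lev Var.i 0))
        mergeTakeR mergeTakeL)
      mergeTakeL)
    mergeTakeR

/-- Merge the sorted blocks `[lo, mid)` and `[mid, hi)` of the level `lev` into the next level. -/
def mergeBlock : Cmd :=
  Var.i ≔ Var.lo ;; Var.j ≔ Var.mid ;; Var.k ≔ Var.lo ;; .upto .k Var.hi mergeBody

/-- With truncated subtraction, `b - (b - n)` is `min n b`; this clips the last blocks to the number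
of columns. -/
def mergePass : Cmd :=
  Var.lo ≔ 0 ;;
  .whileDo (.lt Var.lo Var.b)
    (Var.mid ≔ Var.b - (Var.b - (Var.lo + Var.wd)) ;;
      Var.hi ≔ Var.b - (Var.b - (Var.mid + Var.wd)) ;; mergeBlock ;; Var.lo ≔ Var.hi)

def sortInit : Cmd := Var.i ≔ 0 ;; .upto .i Var.b (.store .sort 0 Var.i 0 Var.i)

/-- Mergesort; the result is in the row `lev` of the array. -/
def sortCols : Cmd :=
  sortInit ;; Var.lev ≔ 0 ;; Var.wd ≔ 1 ;;
  .whileDo (.lt Var.wd Var.b) (mergePass ;; Var.lev ≔ Var.lev + 1 ;; Var.wd ≔ Var.wd + Var.wd)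

variable {A B : List ℤ} {bd : ℕ}

/-- The order used for merging. -/
def symLe (B : List ℤ) (y y' : ℕ) : Bool := decide (sym B y ≤ sym B y')

def row (s : St) (l : ℕ) : ℕ → ℕ := fun i => s.a .sort l i 0

@[simp] theorem row_tick (s : St) (l n : ℕ) : row (s.tick n) l = row s l := rfl

@[simp] theorem row_set (s : St) (l n : ℕ) (x : Var) : row (s.set x n) l = row s l := rfl

/-- The hypothesis covers both an exhausted right block and a head that is not smaller, in line with
the branches of `mergeBody`; ties are taken from the left. -/
theorem merge_left {f : ℕ → ℕ} {i j mid hi : ℕ} (hi' : i < mid)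
    (h : j < hi → ¬ sym B (f j) < sym B (f i)) :
    (seg f i mid).merge (seg f j hi) (symLe B) =
      f i :: (seg f (i + 1) mid).merge (seg f j hi) (symLe B) := by
  by_cases hj : j < hi
  · rw [seg_cons f hi', seg_cons f hj, List.cons_merge_cons, if_pos]
    simpa [symLe] using h hj
  · have : seg f j hi = [] := by unfold seg; rw [show hi - j = 0 by omega]; rfl
    rw [this, List.merge_right, List.merge_right, seg_cons f hi']

theorem merge_right {f : ℕ → ℕ} {i j mid hi : ℕ} (hj : j < hi)
    (h : i < mid → sym B (f j) < sym B (f i)) :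
    (seg f i mid).merge (seg f j hi) (symLe B) =
      f j :: (seg f i mid).merge (seg f (j + 1) hi) (symLe B) := by
  by_cases hi' : i < mid
  · rw [seg_cons f hi', seg_cons f hj, List.cons_merge_cons, if_neg]
    simpa [symLe] using h hi'
  · have : seg f i mid = [] := by unfold seg; rw [show mid - i = 0 by omega]; rfl
    rw [this, List.nil_merge, List.nil_merge, seg_cons f hj]

/-- The loop invariant of `mergeBlock`, after the output of the cells below `k`. -/
structure MergeInv (A B : List ℤ) (s : St) (L lo mid hi c k i j : ℕ) (s' : St) : Prop where
  base : Base A B s'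
  eq_lev : s'.v .lev = L
  eq_mid : s'.v .mid = mid
  eq_hi : s'.v .hi = hi
  eq_i : s'.v .i = i
  eq_j : s'.v .j = j
  le : lo ≤ i ∧ i ≤ mid ∧ mid ≤ j ∧ j ≤ hi ∧ i + j = k + mid
  merged : seg (row s' (L + 1)) lo k ++
    (seg (row s L) i mid).merge (seg (row s L) j hi) (symLe B) =
      (seg (row s L) lo mid).merge (seg (row s L) mid hi) (symLe B)
  frame : ∀ l i, ¬ (l = L + 1 ∧ lo ≤ i ∧ i < hi) → row s' l i = row s l i
  clk : s'.clk ≤ c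

/-- One round of the loop, stated so that it serves for both sides: `y` is the head of what remains
to be merged. -/
theorem MergeInv.take {s s' s'' : St} {L lo mid hi c c' k i j i' j' y : ℕ}
    (h : MergeInv A B s L lo mid hi c k i j s')
    (hk : lo ≤ k ∧ k < hi)
    (hy : (seg (row s L) i mid).merge (seg (row s L) j hi) (symLe B) =
      y :: (seg (row s L) i' mid).merge (seg (row s L) j' hi) (symLe B))
    (ha : ∀ l n, row s'' l n = if l = L + 1 ∧ n = k then y else row s' l n)
    (hb : Base A B s'') (h1 : s''.v .lev = L) (h2 : s''.v .mid = mid) (h3 : s''.v .hi = hi)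
    (h4 : s''.v .i = i') (h5 : s''.v .j = j') (h6 : s''.clk ≤ c')
    (h7 : lo ≤ i' ∧ i' ≤ mid ∧ mid ≤ j' ∧ j' ≤ hi ∧ i' + j' = k + 1 + mid) :
    MergeInv A B s L lo mid hi c' (k + 1) i' j' s'' where
  base := hb
  eq_lev := h1
  eq_mid := h2
  eq_hi := h3
  eq_i := h4
  eq_j := h5
  le := h7
  merged := by
    rw [seg_snoc _ hk.1, ← h.merged, hy, ha]
    simp only [and_self, if_true, List.append_assoc, List.singleton_append]
    rw [seg_congr (g := row s' (L + 1))]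
    intro n _ hn
    rw [ha, if_neg (by omega)]
  frame l n hln := by
    rw [ha, if_neg (by omega), h.frame l n hln]
  clk := h6

theorem mergeBlock_spec {s : St} (hs : Base A B s) {L lo mid hi : ℕ}
    (hL : s.v .lev = L) (hlo : s.v .lo = lo) (hmid : s.v .mid = mid) (hhi : s.v .hi = hi)
    (h1 : lo ≤ mid) (h2 : mid ≤ hi) (h3 : hi ≤ B.length) (hLb : L + 1 < bd)
    (hbd : A.length + B.length + 2 < bd)
    (hr : ∀ i < B.length, row s L i < B.length) :
    mergeBlock.wp bd (A.length + B.length) (fun s' =>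
      seg (row s' (L + 1)) lo hi = (seg (row s L) lo mid).merge (seg (row s L) mid hi) (symLe B) ∧
      (∀ l i, ¬ (l = L + 1 ∧ lo ≤ i ∧ i < hi) → row s' l i = row s l i) ∧
      s'.clk ≤ s.clk + 300 * (hi - lo) + 100) s := by
  simp only [mergeBlock, Cmd.wp_seq', Cmd.wp_assign, Expr.ok_var, true_and, Expr.eval_var,
    Expr.cost_var, St.tick_v, St.set_v, reduceCtorEq, if_false]
  refine Cmd.wp_upto (fun k s' => s'.v .k = k ∧ ∃ i j, MergeInv A B s L lo mid hi
    (s.clk + 300 * (k - lo) + 12) k i j s') lo hi (by omega) (by omega)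
    (fun k s' h => ?_) ?_ (fun k s' hk1 hk2 h => ?_) (fun s' h => ?_)
  · obtain ⟨h, i, j, hI⟩ := h
    exact ⟨h, hI.eq_hi, trivial⟩
  · refine ⟨by simp [hlo], lo, mid, hs.congr (by simp) (by simp) (by simp), by simpa using hL,
      by simpa using hmid, by simpa using hhi, by simp [hlo], by simp [hmid], by omega, ?_,
      fun l i _ => rfl, by simp⟩
    rw [seg_self, List.nil_append]
  · obtain ⟨hk, i, j, hI⟩ := h
    have hle := hI.le
    have hrow : ∀ n, row s' L n = row s L n := fun n => hI.frame L n (by omega)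
    have hld : ∀ n, s'.a .sort L n 0 = row s L n := hrow
    have hinp : ∀ y < B.length, s'.inp (A.length + y) = sym B y := hI.base.inpB
    have takeL : i < mid → (j < hi → ¬ sym B (row s L j) < sym B (row s L i)) → ∀ n ≤ 100,
        mergeTakeL.wp bd (A.length + B.length) (fun s' => s'.v .k = k ∧
          (fun k s' => s'.v .k = k ∧ ∃ i j, MergeInv A B s L lo mid hi
            (s.clk + 300 * (k - lo) + 12) k i j s') (k + 1) ((s'.set .k (k + 1)).tick 6))
          (s'.tick n) := by
      intro hi1 hi2 n hn
      have hc := hI.clk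
      simp only [mergeTakeL, Cmd.wp_seq', Cmd.wp_store, Cmd.wp_assign, Expr.ok_add, Expr.ok_var,
        Expr.ok_one, Expr.ok_zero, Expr.ok_ld, Expr.eval_add, Expr.eval_var, Expr.eval_one,
        Expr.eval_zero, Expr.eval_ld, St.tick_v, St.tick_a, St.sto_v, St.set_v, hI.eq_lev, hI.eq_i, hk,
        true_and, reduceCtorEq, if_false]
      refine ⟨by omega, by omega, by omega, by omega, by omega, by omega, by omega, by simp,
        i + 1, j,
        hI.take (y := row s L i) (by omega) (merge_left hi1 hi2) (fun l m => ?_)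
        (hI.base.congr (by simp) (by simp) (by simp)) (by simp [hI.eq_lev]) (by simp [hI.eq_mid])
        (by simp [hI.eq_hi]) (by simp) (by simp [hI.eq_j]) ?_ (by omega)⟩
      · simp [row, hld]
      · simp; omega
    have takeR : j < hi → (i < mid → sym B (row s L j) < sym B (row s L i)) → ∀ n ≤ 100,
        mergeTakeR.wp bd (A.length + B.length) (fun s' => s'.v .k = k ∧
          (fun k s' => s'.v .k = k ∧ ∃ i j, MergeInv A B s L lo mid hi
            (s.clk + 300 * (k - lo) + 12) k i j s') (k + 1) ((s'.set .k (k + 1)).tick 6))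
          (s'.tick n) := by
      intro hi1 hi2 n hn
      have hc := hI.clk
      simp only [mergeTakeR, Cmd.wp_seq', Cmd.wp_store, Cmd.wp_assign, Expr.ok_add, Expr.ok_var,
        Expr.ok_one, Expr.ok_zero, Expr.ok_ld, Expr.eval_add, Expr.eval_var, Expr.eval_one,
        Expr.eval_zero, Expr.eval_ld, St.tick_v, St.tick_a, St.sto_v, St.set_v, hI.eq_lev, hI.eq_j, hk,
        true_and, reduceCtorEq, if_false]
      refine ⟨by omega, by omega, by omega, by omega, by omega, by omega, by omega, by simp,
        i, j + 1,
        hI.take (y := row s L j) (by omega) (merge_right hi1 hi2) (fun l m => ?_)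
        (hI.base.congr (by simp) (by simp) (by simp)) (by simp [hI.eq_lev]) (by simp [hI.eq_mid])
        (by simp [hI.eq_hi]) (by simp [hI.eq_i]) (by simp) ?_ (by omega)⟩
      · simp [row, hld]
      · simp; omega
    have tick2 : ∀ (n m : ℕ), (s'.tick n).tick m = s'.tick (n + m) := by
      intro n m; simp [St.tick, add_assoc]
    unfold mergeBody
    refine Cmd.wp_ite (by simp) (fun ht => ?_) (fun ht => ?_)
    · simp only [Cond.holds, Expr.eval_var, St.tick_v, hI.eq_i, hI.eq_mid] at ht
      refine Cmd.wp_ite (by simp) (fun ht2 => ?_) (fun ht2 => ?_)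
      · simp only [Cond.holds, Expr.eval_var, St.tick_v, hI.eq_j, hI.eq_hi] at ht2
        have hri := hr i (by omega)
        have hrj := hr j (by omega)
        refine Cmd.wp_ite ?_ (fun ht3 => ?_) (fun ht3 => ?_)
        · simp [hI.eq_lev, hI.eq_i, hI.eq_j, hI.base.a, hld]
          omega
        · simp only [Cond.holds, Expr.eval_add, Expr.eval_var, Expr.eval_ld, Expr.eval_zero,
            St.tick_v, St.tick_a, St.tick_inp, hI.base.a, hI.eq_lev, hI.eq_i, hI.eq_j, hld, hinp _ hri,
            hinp _ hrj] at ht3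
          rw [tick2, tick2, tick2]
          exact takeR ht2 (fun _ => ht3) _ (by simp)
        · simp only [Cond.holds, Expr.eval_add, Expr.eval_var, Expr.eval_ld, Expr.eval_zero,
            St.tick_v, St.tick_a, St.tick_inp, hI.base.a, hI.eq_lev, hI.eq_i, hI.eq_j, hld, hinp _ hri,
            hinp _ hrj] at ht3
          rw [tick2, tick2, tick2]
          exact takeL ht (fun _ => ht3) _ (by simp)
      · simp only [Cond.holds, Expr.eval_var, St.tick_v, hI.eq_j, hI.eq_hi] at ht2
        rw [tick2, tick2]
        exact takeL ht (fun h => absurd h ht2) _ (by simp)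
    · simp only [Cond.holds, Expr.eval_var, St.tick_v, hI.eq_i, hI.eq_mid] at ht
      rw [tick2]
      exact takeR (by omega) (fun h => absurd h ht) _ (by simp)
  · obtain ⟨hk, i, j, hI⟩ := h
    have hle := hI.le
    have hc := hI.clk
    refine ⟨?_, hI.frame, by simp; omega⟩
    have := hI.merged
    obtain rfl : i = mid := by omega
    obtain rfl : j = hi := by omega
    simpa [seg_self] using this

/-- The aligned blocks of length `w` are sorted by symbols. -/
def BlockSorted (B : List ℤ) (f : ℕ → ℕ) (w t : ℕ) : Prop :=
  (seg f (min (t * w) B.length) (min (t * w + w) B.length)).Pairwise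
    fun y y' => sym B y ≤ sym B y'

theorem pairwise_merge_symLe {l₁ l₂ : List ℕ} (h₁ : l₁.Pairwise fun y y' => sym B y ≤ sym B y')
    (h₂ : l₂.Pairwise fun y y' => sym B y ≤ sym B y') :
    (l₁.merge l₂ (symLe B)).Pairwise fun y y' => sym B y ≤ sym B y' := by
  have := List.pairwise_merge (le := symLe B)
    (by intro x y z; simp only [symLe, decide_eq_true_eq]; exact le_trans)
    (by intro x y; simp only [symLe, Bool.or_eq_true, decide_eq_true_eq]; exact le_total _ _) l₁ l₂
    (by simpa [symLe] using h₁) (by simpa [symLe] using h₂)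
  simpa [symLe] using this

/-- Block `t` of length `2 W` consists of the blocks `2 t` and `2 t + 1` of length `W`, also after
clipping. Each pass writes a new row of the array, so nothing is overwritten or copied back. -/
theorem mergePass_spec {s : St} (hs : Base A B s) {L W : ℕ}
    (hL : s.v .lev = L) (hW : s.v .wd = W) (hW0 : 0 < W) (hWb : W < B.length) (hLb : L + 1 < bd)
    (hbd : 4 * (A.length + B.length) + 20 < bd)
    (hr : ∀ i < B.length, row s L i < B.length) (hsort : ∀ t, BlockSorted B (row s L) W t) :
    mergePass.wp bd (A.length + B.length) (fun s' =>
      (∀ t, BlockSorted B (row s' (L + 1)) (W + W) t) ∧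
      (seg (row s' (L + 1)) 0 B.length).Perm (seg (row s L) 0 B.length) ∧
      s'.clk ≤ s.clk + 1000 * B.length + 100) s := by
  simp only [mergePass, Cmd.wp_seq', Cmd.wp_assign, Expr.ok_zero, Expr.eval_zero, Expr.cost_zero]
  refine ⟨by omega, ?_⟩
  refine Cmd.wp_while (fun s' => ∃ t, s'.v .lo = min (t * (W + W)) B.length ∧ Base A B s' ∧
    s'.v .lev = L ∧ s'.v .wd = W ∧ (∀ l, l ≠ L + 1 → row s' l = row s l) ∧
    (seg (row s' (L + 1)) 0 (s'.v .lo)).Perm (seg (row s L) 0 (s'.v .lo)) ∧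
    (∀ t' < t, BlockSorted B (row s' (L + 1)) (W + W) t') ∧
    s'.clk ≤ s.clk + 1000 * s'.v .lo + 10) (fun s' => B.length - s'.v .lo) ?_ ?_ ?_ _ ?_
  · rintro s' -; simp
  · rintro s1 ⟨t, h1, h2, h3, h4, h5, h6, h7, h8⟩ ht
    simp only [Cond.holds, Expr.eval_var, h2.b] at ht
    have hlo : s1.v .lo = t * (W + W) := by omega
    have hmid : B.length - (B.length - (s1.v .lo + W)) = min (s1.v .lo + W) B.length := by omega
    have hhi : B.length - (B.length - (min (s1.v .lo + W) B.length + W)) =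
      min (s1.v .lo + W + W) B.length := by omega
    simp only [Cmd.wp_seq', Cmd.wp_assign, Expr.ok_sub, Expr.ok_var, Expr.ok_add, Expr.eval_var,
      St.tick_v, true_and, h4, Expr.eval_sub, Expr.eval_add, h2.b, St.set_v, if_true, reduceCtorEq,
      if_false, hmid, hhi]
    refine ⟨by omega, by omega, ?_⟩
    refine Cmd.wp_conseq (mergeBlock_spec (A := A) (B := B) (L := L) (lo := s1.v .lo)
      (mid := min (s1.v .lo + W) B.length) (hi := min (s1.v .lo + W + W) B.length)
      (h2.congr (by simp) (by simp) (by simp)) (by simp [h3]) (by simp) (by simp) (by simp)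
      (by omega) (by omega) (by omega) hLb (by omega) (by simpa [h5 L (by omega)] using hr)) ?_
    rintro s2 ⟨hm, hf, hc⟩ hsame
    have hv := hsame.v
    have hvhi : s2.v .hi = min (s1.v .lo + W + W) B.length := by
      rw [hv .hi rfl]; simp
    have hold := h5 L (by omega)
    simp only [row_tick, row_set, hold] at hm hf
    have hk : ∀ i, i < s1.v .lo → row s2 (L + 1) i = row s1 (L + 1) i := fun i hi =>
      hf (L + 1) i (by omega)
    simp only [Cmd.wp_assign, Expr.ok_var, true_and, Expr.eval_var, hvhi, St.tick_v, St.set_v,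
      if_true]
    refine ⟨⟨t + 1, ?_, h2.congr (by simp [hv .a rfl]) (by simp [hv .b rfl])
      (by simp [hsame.inp rfl]), by simp [hv .lev rfl, h3], by simp [hv .wd rfl, h4],
      fun l hl => ?_, ?_, fun t' ht' => ?_, ?_⟩, ?_⟩
    · rw [hlo, add_mul]; congr 1; omega
    · rw [← h5 l hl]
      funext i
      exact hf l i (by omega)
    · simp only [row_tick, row_set]
      rw [← seg_append _ (Nat.zero_le (s1.v .lo)) (by omega),
        ← seg_append (row s L) (Nat.zero_le (s1.v .lo)) (by omega), hm,
        seg_congr (fun i _ hi => hk i hi)]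
      refine h6.append ((List.merge_perm_append _).trans ?_)
      rw [seg_append _ (by omega) (by omega)]
    · unfold BlockSorted
      rcases Nat.lt_succ_iff_lt_or_eq.mp ht' with h | rfl
      · have h9 := h7 t' h
        unfold BlockSorted at h9
        have hle : t' * (W + W) + (W + W) ≤ t * (W + W) := by
          have := Nat.mul_le_mul_right (W + W) (show t' + 1 ≤ t from h)
          rwa [add_mul, one_mul] at this
        rw [seg_congr (g := row s1 (L + 1))]
        · exact h9
        · intro i _ hi
          exact hk i (by omega)
      · rw [← hlo, show min (s1.v .lo) B.length = s1.v .lo by omega, ← add_assoc, row_tick,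
          row_set, hm]
        have e1 : t' * (W + W) = 2 * t' * W := by ring
        have e2 : (2 * t' + 1) * W = 2 * t' * W + W := by ring
        have s1' := hsort (2 * t')
        have s2' := hsort (2 * t' + 1)
        unfold BlockSorted at s1' s2'
        rw [← e1, ← hlo, show min (s1.v .lo) B.length = s1.v .lo by omega] at s1'
        rw [e2, ← e1, ← hlo] at s2'
        exact pairwise_merge_symLe s1' s2'
    · simp only [St.tick_clk, St.set_clk, Expr.cost_var, Expr.cost_sub, Expr.cost_add,
        Cond.cost] at hc ⊢
      omega
    · omega
  · rintro s1 ⟨t, h1, h2, h3, h4, h5, h6, h7, h8⟩ ht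
    simp only [Cond.holds, Expr.eval_var, h2.b] at ht
    have hlo : s1.v .lo = B.length := by omega
    rw [hlo] at h6 h8
    refine ⟨fun t' => ?_, h6, ?_⟩
    · by_cases h : t' < t
      · exact h7 t' h
      · have : t * (W + W) ≤ t' * (W + W) := Nat.mul_le_mul_right _ (by omega)
        unfold BlockSorted
        rw [show min (t' * (W + W)) B.length = B.length by omega,
          show min (t' * (W + W) + (W + W)) B.length = B.length by omega, seg_self]
        exact List.Pairwise.nil
    · simp only [St.tick_clk, Expr.cost_var, Cond.cost]; omega
  · refine ⟨0, by simp, hs.congr (by simp) (by simp) (by simp), by simpa using hL,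
      by simpa using hW, fun _ _ => rfl, by simp [seg_self], by simp, by simp⟩

/-- A crude comparison of squared logarithms with the argument. It absorbs the logarithm in the cost
of sorting, and later the factor `h + 1` when `t ≤ 2 ^ h`. -/
theorem succ_sq_le (L : ℕ) : (L + 1) * (L + 1) ≤ 4 * 2 ^ L := by
  have aux : ∀ n, 4 ≤ n → 4 * n ≤ 4 * 2 ^ n ∧ (n + 1) * (n + 1) ≤ 4 * 2 ^ n := by
    intro n hn
    induction n, hn using Nat.le_induction with
    | base => norm_num
    | succ n hn ih =>
      have h1 := Nat.lt_two_pow_self (n := n)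
      rw [pow_succ]
      constructor
      · omega
      · nlinarith
  by_cases h : 4 ≤ L
  · exact (aux L h).2
  · interval_cases L <;> norm_num

theorem sortCols_spec {s : St} (hs : Base A B s)
    (hbd : 4 * (A.length + B.length) + 20 < bd) :
    sortCols.wp bd (A.length + B.length) (fun s' =>
      ∃ L, s'.v .lev = L ∧ L ≤ B.length ∧ (L + 1) * (L + 1) ≤ 8 * (A.length + B.length + 2) ∧
      (seg (row s' L) 0 B.length).Perm (List.range B.length) ∧
      (seg (row s' L) 0 B.length).Pairwise (fun y y' => sym B y ≤ sym B y') ∧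
      s'.clk ≤ s.clk + 2000 * (B.length + 1) * (L + 1)) s := by
  unfold sortCols
  refine Cmd.wp_seq (R := fun s' => (∀ i < B.length, row s' 0 i = i) ∧
    s'.clk ≤ s.clk + 50 * B.length + 20) ?_ ?_
  · simp only [sortInit, Cmd.wp_seq', Cmd.wp_assign, Expr.ok_zero, Expr.eval_zero, Expr.cost_zero]
    refine ⟨by omega, Cmd.wp_upto (fun k s' => s'.v .i = k ∧ s'.v .b = B.length ∧
      (∀ i < k, row s' 0 i = i) ∧ s'.clk ≤ s.clk + 50 * k + 3) 0 B.length (by omega) (by omega)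
      ?_ ?_ ?_ ?_⟩
    · rintro k s' ⟨h1, h2, -, -⟩; exact ⟨h1, h2, trivial⟩
    · simp [hs.b]
    · rintro k s' - hk ⟨h1, h2, h3, h4⟩
      simp only [Cmd.wp_store, Expr.ok_zero, Expr.ok_var, Expr.eval_zero, Expr.eval_var, St.tick_v,
        h1, true_and]
      refine ⟨by omega, by omega, by omega, by omega, by omega, by simpa using h1, by simp, by simpa using h2, ?_, ?_⟩
      · intro i hi
        rcases Nat.lt_succ_iff_lt_or_eq.mp hi with h | rfl
        · have := h3 i h
          simp only [row] at this ⊢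
          simp [this]; omega
        · simp [row]
      · simp; omega
    · rintro s' ⟨h1, h2, h3, h4⟩
      exact ⟨h3, by simp; omega⟩
  rintro s1 ⟨hi1, hc1⟩ hs1
  have hb1 := hs.same hs1 rfl rfl rfl
  simp only [Cmd.wp_seq', Cmd.wp_assign, Expr.ok_zero, Expr.eval_zero, Expr.cost_zero, Expr.ok_one,
    Expr.eval_one, Expr.cost_one]
  refine ⟨by omega, by omega, ?_⟩
  -- A pass starts only if the width is below `|B|`, so after doubling it is below `2 |B|`; the
  -- extra `1` admits an empty `B`.
  refine Cmd.wp_while (fun s' => ∃ L, s'.v .lev = L ∧ s'.v .wd = 2 ^ L ∧ 2 ^ L ≤ 2 * B.length + 1 ∧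
    Base A B s' ∧ (seg (row s' L) 0 B.length).Perm (List.range B.length) ∧
    (∀ t, BlockSorted B (row s' L) (2 ^ L) t) ∧
    s'.clk ≤ s.clk + 50 * B.length + 40 + L * (1000 * B.length + 200)) (fun s' => B.length - s'.v .wd)
    ?_ ?_ ?_ _ ?_
  · rintro s' -; simp
  · rintro s2 ⟨L, h1, h2, h3, h4, h5, h6, h7⟩ ht
    simp only [Cond.holds, Expr.eval_var, h2, h4.b] at ht
    have hL : L < 2 ^ L := Nat.lt_two_pow_self
    have hrow : ∀ i < B.length, row s2 L i < B.length := by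
      intro i hi
      have : row s2 L i ∈ seg (row s2 L) 0 B.length := mem_seg.mpr ⟨i, by omega, hi, rfl⟩
      simpa using h5.subset this
    refine Cmd.wp_seq (mergePass_spec (L := L) (W := 2 ^ L) (h4.congr (by simp) (by simp) (by simp))
      (by simpa using h1) (by simpa using h2) (by positivity) ht (by omega) hbd hrow h6) ?_
    rintro s3 ⟨h8, h9, h10⟩ hs3
    have h4' : Base A B s3 := h4.congr (by simp [hs3.v .a rfl]) (by simp [hs3.v .b rfl])
      (by simp [hs3.inp rfl])
    simp only [Cmd.wp_seq', Cmd.wp_assign, Expr.ok_var, Expr.ok_add, Expr.ok_one, Expr.eval_var,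
      Expr.eval_add, Expr.eval_one, St.tick_v, St.set_v, true_and, reduceCtorEq, if_false, if_true,
      hs3.v .lev rfl, hs3.v .wd rfl, h1, h2]
    refine ⟨by omega, by omega, ⟨L + 1, rfl, by ring, by rw [pow_succ]; omega,
      h4'.congr (by simp) (by simp) (by simp), ?_, ?_, ?_⟩, by omega⟩
    · simpa using h9.trans h5
    · intro t
      have := h8 t
      rw [pow_succ, mul_two]
      exact this
    · simp at h10 ⊢
      rw [add_mul]
      omega
  · rintro s2 ⟨L, h1, h2, h3, h4, h5, h6, h7⟩ ht
    simp only [Cond.holds, Expr.eval_var, h2, h4.b] at ht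
    have hL : L < 2 ^ L := Nat.lt_two_pow_self
    have h8 := succ_sq_le L
    refine ⟨L, h1, ?_, by omega, h5, ?_, ?_⟩
    · by_contra hcon
      have h9 : 2 ^ (B.length + 1) ≤ 2 ^ L := Nat.pow_le_pow_right (by omega) (by omega)
      have h10 := Nat.lt_two_pow_self (n := B.length)
      rw [pow_succ] at h9
      omega
    · have := h6 0
      unfold BlockSorted at this
      simpa [show min (2 ^ L) B.length = B.length by omega] using this
    · simp only [St.tick_clk, Cond.cost, Expr.cost_var]
      nlinarith
  · refine ⟨0, by simp, by simp, by simp, hb1.congr (by simp) (by simp) (by simp), ?_, ?_, ?_⟩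
    · have : seg (row s1 0) 0 B.length = List.range B.length := by
        rw [seg_congr (g := id) (fun i _ hi => hi1 i hi)]
        simp [seg, List.range_eq_range']
      simp [this]
    · intro t
      unfold BlockSorted
      rw [pairwise_seg]
      intro i j h1 h2 h3
      omega
    · simp; omega

end Imp


/-! ## Groups of symbols -/

namespace Imp

open LCIS

/-- The parameters of one run: the logarithm of the number of groups, and the pivots, given by
columns. -/
structure Par where
  h : ℕ
  np : ℕ
  pv : ℕ → ℕ

variable {A B : List ℤ} {bd : ℕ} {R : Par}

namespace Par

/-- The number of pivots below `σ`. -/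
def ltc (R : Par) (B : List ℤ) (σ : ℤ) (k : ℕ) : ℕ := Nat.count (fun i => sym B (R.pv i) < σ) k

/-- The number of pivots up to `σ`. -/
def lec (R : Par) (B : List ℤ) (σ : ℤ) (k : ℕ) : ℕ := Nat.count (fun i => sym B (R.pv i) ≤ σ) k

/-- The group of a symbol; each pivot is the only member of its group. -/
def grp (R : Par) (B : List ℤ) (σ : ℤ) : ℕ := R.ltc B σ R.np + R.lec B σ R.np + 1

theorem ltc_mono {σ τ : ℤ} (h : σ ≤ τ) (k : ℕ) : R.ltc B σ k ≤ R.ltc B τ k :=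
  Nat.count_mono_left fun _ _ h' => lt_of_lt_of_le h' h

theorem lec_mono {σ τ : ℤ} (h : σ ≤ τ) (k : ℕ) : R.lec B σ k ≤ R.lec B τ k :=
  Nat.count_mono_left fun _ _ h' => le_trans h' h

theorem ltc_le_lec (σ : ℤ) (k : ℕ) : R.ltc B σ k ≤ R.lec B σ k :=
  Nat.count_mono_left fun _ _ h' => le_of_lt h'

theorem lec_le_ltc {σ τ : ℤ} (h : σ < τ) (k : ℕ) : R.lec B σ k ≤ R.ltc B τ k :=
  Nat.count_mono_left fun _ _ h' => lt_of_le_of_lt h' h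

theorem lec_le (σ : ℤ) (k : ℕ) : R.lec B σ k ≤ k := Nat.count_le _

theorem grp_mono {σ τ : ℤ} (h : σ ≤ τ) : R.grp B σ ≤ R.grp B τ := by
  have := ltc_mono (R := R) (B := B) h R.np
  have := lec_mono (R := R) (B := B) h R.np
  unfold grp; omega

theorem grp_pos (σ : ℤ) : 1 ≤ R.grp B σ := by unfold grp; omega

theorem grp_le (σ : ℤ) : R.grp B σ ≤ 2 * R.np + 1 := by
  have := ltc_le_lec (R := R) (B := B) σ R.np
  have := lec_le (R := R) (B := B) σ R.np
  unfold grp; omega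

theorem lt_of_grp_lt {σ τ : ℤ} (h : R.grp B σ < R.grp B τ) : σ < τ := by
  by_contra hcon
  have := grp_mono (R := R) (B := B) (not_lt.mp hcon)
  omega

/-- `τ` is one of the pivots. -/
def IsPivot (R : Par) (B : List ℤ) (τ : ℤ) : Prop := R.ltc B τ R.np < R.lec B τ R.np

/-- For `σ < τ` both counts for `σ` are at most the number of pivots below `τ`, and a pivot `τ`
contributes itself to the second count. Adding the two counts is what separates pivots from their
neighbours. -/
theorem IsPivot.grp_lt_iff {σ τ : ℤ} (h : R.IsPivot B τ) : R.grp B σ < R.grp B τ ↔ σ < τ := by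
  refine ⟨lt_of_grp_lt, fun hlt => ?_⟩
  have h1 := lec_le_ltc (R := R) (B := B) hlt R.np
  have h2 := ltc_le_lec (R := R) (B := B) σ R.np
  unfold IsPivot at h
  unfold grp; omega

theorem IsPivot.grp_eq_iff {σ τ : ℤ} (h : R.IsPivot B τ) : R.grp B σ = R.grp B τ ↔ σ = τ := by
  refine ⟨fun he => ?_, fun he => by rw [he]⟩
  rcases lt_trichotomy σ τ with h1 | h1 | h1
  · have := h.grp_lt_iff.mpr h1; omega
  · exact h1
  · have h1 := lec_le_ltc (R := R) (B := B) h1 R.np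
    have h2 := ltc_le_lec (R := R) (B := B) σ R.np
    unfold IsPivot at h
    unfold grp at he; omega

/-- There are few groups, and few columns in each group not formed by a pivot. -/
structure Good (R : Par) (B : List ℤ) : Prop where
  np_le : R.np ≤ 2 ^ R.h
  sparse : ∀ σ, ¬ R.IsPivot B σ →
    Nat.count (fun y => R.grp B (sym B y) = R.grp B σ) B.length ≤ B.length / 2 ^ R.h + 1

/-- A symbol that is no pivot has the same number `k` of pivots below it and up to it, and its group
is determined by `k`. As pivots stand at the multiples of the spacing `sp` in the sorted order, `k`
is also determined by the quotient `i / sp` of a sorted position `i`. So a group occupies at most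
one interval of length `sp`. -/
theorem good_of_sorted {C : ℕ → ℕ} (hperm : (seg C 0 B.length).Perm (List.range B.length))
    (hsort : (seg C 0 B.length).Pairwise fun y y' => sym B y ≤ sym B y')
    (h1 : R.np ≤ 2 ^ R.h) (h2 : B.length ≤ R.np * (B.length / 2 ^ R.h + 1))
    (h3 : ∀ i < R.np, R.pv i = C (i * (B.length / 2 ^ R.h + 1)) ∧
      i * (B.length / 2 ^ R.h + 1) < B.length) : R.Good B := by
  refine ⟨h1, fun σ hσ => ?_⟩
  generalize B.length / 2 ^ R.h + 1 = sp at *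
  have hmono : ∀ i j, i ≤ j → j < B.length → sym B (C i) ≤ sym B (C j) := by
    intro i j hij hj
    rcases hij.lt_or_eq with h | rfl
    · exact pairwise_seg.mp hsort i j (Nat.zero_le _) h hj
    · exact le_rfl
  have hsp : 0 < sp ∨ B.length = 0 := by
    rcases Nat.eq_zero_or_pos sp with h | h
    · right; subst h; omega
    · exact Or.inl h
  rcases hsp with hsp | hb
  swap
  · rw [hb]; simp
  set k := R.lec B σ R.np with hk
  -- Count the columns in sorted order instead.
  have hcount : Nat.count (fun y => R.grp B (sym B y) = R.grp B σ) B.length =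
      Nat.count (fun i => R.grp B (sym B (C i)) = R.grp B σ) B.length := by
    have e1 : ∀ (P : ℕ → Prop) [DecidablePred P] n, Nat.count P n =
        (List.range n).countP (fun y => decide (P y)) := fun P _ n => rfl
    rw [e1, e1, ← hperm.countP_eq]
    unfold seg
    rw [List.countP_map, List.range_eq_range', Nat.sub_zero]
    rfl
  rw [hcount, Nat.count_eq_card_filter_range]
  have hsub : (Finset.range B.length).filter (fun i => R.grp B (sym B (C i)) = R.grp B σ) ⊆
      Finset.Ico ((k - 1) * sp) ((k - 1) * sp + sp) := by
    intro i hi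
    simp only [Finset.mem_filter, Finset.mem_range] at hi
    obtain ⟨hi, hg⟩ := hi
    set τ := sym B (C i) with hτ
    have hτp : ¬ R.IsPivot B τ := by
      intro hp
      have : σ = τ := hp.grp_eq_iff.mp hg.symm
      exact hσ (this ▸ hp)
    have a1 := ltc_le_lec (R := R) (B := B) σ R.np
    have a2 := ltc_le_lec (R := R) (B := B) τ R.np
    unfold IsPivot at hσ hτp
    unfold grp at hg
    have e1 : R.lec B τ R.np = k := by omega
    have e2 : R.ltc B τ R.np = k := by omega
    -- The pivots numbered `0, …, i / sp` stand at or before position `i`, so their symbols are at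
    -- most `τ`; conversely every pivot below `τ` is among them. Both counts being `k`, this yields
    -- `k = i / sp + 1`.
    have b1 : i / sp + 1 ≤ R.lec B τ R.np := by
      unfold lec
      rw [Nat.count_eq_card_filter_range]
      calc i / sp + 1 = (Finset.range (i / sp + 1)).card := by simp
        _ ≤ _ := by
          apply Finset.card_le_card
          intro n hn
          simp only [Finset.mem_range] at hn
          have hn1 : n * sp ≤ i := le_trans (Nat.mul_le_mul_right _ (Nat.lt_succ_iff.mp hn))
            (Nat.div_mul_le_self i sp)
          have hn2 : n < R.np := by
            by_contra hcon
            have := Nat.mul_le_mul_right sp (not_lt.mp hcon)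
            exact absurd (h2.trans (this.trans hn1)) (not_le.mpr hi)
          simp only [Finset.mem_filter, Finset.mem_range]
          refine ⟨hn2, ?_⟩
          rw [(h3 n hn2).1]
          exact hmono _ _ hn1 hi
    have b2 : R.ltc B τ R.np ≤ i / sp + 1 := by
      unfold ltc
      rw [Nat.count_eq_card_filter_range]
      calc _ ≤ (Finset.range (i / sp + 1)).card := by
            apply Finset.card_le_card
            intro n hn
            simp only [Finset.mem_filter, Finset.mem_range] at hn ⊢
            obtain ⟨hn1, hn2⟩ := hn
            rw [(h3 n hn1).1] at hn2
            by_contra hcon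
            have hn3 : i < n * sp := by
              have := Nat.lt_mul_div_succ i hsp
              have h5 := Nat.mul_le_mul_right sp (not_lt.mp hcon)
              rw [mul_comm] at this
              omega
            exact absurd (hmono _ _ hn3.le (h3 n hn1).2) (not_le.mpr hn2)
        _ = _ := by simp
    have e3 : k - 1 = i / sp := by
      rw [e1] at b1; rw [e2] at b2
      exact Nat.sub_eq_of_eq_add (le_antisymm b2 b1)
    rw [e3, Finset.mem_Ico]
    have := Nat.lt_mul_div_succ i hsp
    have := Nat.div_mul_le_self i sp
    constructor
    · assumption
    · calc i < sp * (i / sp + 1) := by assumption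
        _ = _ := by ring
  calc _ ≤ _ := Finset.card_le_card hsub
    _ = sp := by simp

end Par

/-- The first column of group `j` from column `z` on, or the number of columns. -/
structure IsNext (R : Par) (B : List ℤ) (j z y : ℕ) : Prop where
  le : z ≤ y
  le_length : y ≤ B.length
  grp_eq : y < B.length → R.grp B (sym B y) = j
  grp_ne : ∀ y', z ≤ y' → y' < y → R.grp B (sym B y') ≠ j

/-- The part of the state that is fixed during a run. -/
structure Env (A B : List ℤ) (R : Par) (s : St) : Prop where
  base : Base A B s
  eq_h : s.v .h = R.h
  eq_p : s.v .p = 2 ^ R.h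
  eq_np : s.v .np = R.np
  eq_m : s.v .m = A.length + B.length + 2
  pv : ∀ i < R.np, s.a .pv i 0 0 = A.length + R.pv i
  pv_lt : ∀ i < R.np, R.pv i < B.length
  nxt : ∀ j ≤ 2 * R.np + 1, ∀ z ≤ B.length, IsNext R B j z (s.a .nxt j z 0)

/-- Count the pivots below and up to the input entry at position `z`. -/
def countPivots : Cmd :=
  Var.lo ≔ 0 ;; Var.le ≔ 0 ;; Var.i ≔ 0 ;; .upto .i Var.np
    (.ite (.ilt (Expr.ld .pv Var.i 0 0) Var.z) (Var.lo ≔ Var.lo + 1) .skip ;;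
      .ite (.ilt Var.z (Expr.ld .pv Var.i 0 0)) .skip (Var.le ≔ Var.le + 1))

theorem countPivots_spec {s : St} (hs : Base A B s) (hnp : s.v .np = R.np)
    (hpv : ∀ i < R.np, s.a .pv i 0 0 = A.length + R.pv i ∧ R.pv i < B.length)
    (hbd : 4 * (A.length + B.length) + 20 < bd) (hnpb : R.np + 1 < bd)
    (hz : s.v .z < A.length + B.length) :
    countPivots.wp bd (A.length + B.length) (fun s' => s'.v .lo = R.ltc B (s.inp (s.v .z)) R.np ∧
      s'.v .le = R.lec B (s.inp (s.v .z)) R.np ∧ s'.clk ≤ s.clk + 200 * R.np + 50) s := by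
  simp only [countPivots, Cmd.wp_seq', Cmd.wp_assign, Expr.ok_zero, Expr.eval_zero, Expr.cost_zero]
  refine ⟨by omega, by omega, by omega, Cmd.wp_upto (fun k s' => s'.v .i = k ∧ s'.v .np = R.np ∧
    s'.inp = s.inp ∧ s'.a = s.a ∧ s'.v .z = s.v .z ∧ s'.v .a = A.length ∧
    s'.v .lo = R.ltc B (s.inp (s.v .z)) k ∧
    s'.v .le = R.lec B (s.inp (s.v .z)) k ∧ s'.clk ≤ s.clk + 200 * k + 10) 0 R.np (by omega)
    (by omega) ?_ ?_ ?_ ?_⟩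
  · rintro k s' ⟨h1, h2, -⟩; exact ⟨h1, h2, trivial⟩
  · simp [hnp, hs.a, Par.ltc, Par.lec]
  · rintro k s1 - hk ⟨h1, h2, h3, h4, h5, h6, h7, h8, h9⟩
    obtain ⟨hp1, hp2⟩ := hpv k hk
    have hinp := hs.inpB _ hp2
    have hl1 : R.ltc B (s.inp (s.v .z)) k ≤ k := Nat.count_le _
    have hl2 : R.lec B (s.inp (s.v .z)) k ≤ k := Nat.count_le _
    have e1 : R.ltc B (s.inp (s.v .z)) (k + 1) = R.ltc B (s.inp (s.v .z)) k +
      if sym B (R.pv k) < s.inp (s.v .z) then 1 else 0 := Nat.count_succ _ _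
    have e2 : R.lec B (s.inp (s.v .z)) (k + 1) = R.lec B (s.inp (s.v .z)) k +
      if sym B (R.pv k) ≤ s.inp (s.v .z) then 1 else 0 := Nat.count_succ _ _
    refine Cmd.wp_seq (R := fun s' => s'.v .lo = R.ltc B (s.inp (s.v .z)) (k + 1) ∧
      s'.clk ≤ s1.clk + 100) ?_ ?_
    · refine Cmd.wp_ite ?_ (fun ht => ?_) (fun ht => ?_)
      · simp [h1, h4, h5, hp1]; omega
      · simp [h1, h4, h5, h3, hp1, hinp] at ht
        simp [h1, h4, h5, h7, e1, ht]; omega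
      · simp [h1, h4, h5, h3, hp1, hinp] at ht
        simp [h1, h4, h5, h7, e1, ht]
    · rintro s2 ⟨g1, g2⟩ hsame
      have hv := hsame.v
      have g3 : s2.a = s.a := by
        funext k'; rw [hsame.a k' (by cases k' <;> rfl)]; simp [h4]
      have g4 : s2.inp = s.inp := by rw [hsame.inp rfl]; simp [h3]
      refine Cmd.wp_ite ?_ (fun ht => ?_) (fun ht => ?_)
      · simp [hv .i rfl, hv .z rfl, h1, h5, g3, hp1]; omega
      · simp [hv .i rfl, hv .z rfl, h1, h5, g3, g4, hp1, hinp] at ht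
        simp [hv .i rfl, hv .z rfl, hv .np rfl, hv .a rfl, hv .le rfl, h1, h2, h5, h6, g3, g4, g1,
          h8, e2, ht]
        omega
      · simp [hv .i rfl, hv .z rfl, h1, h5, g3, g4, hp1, hinp] at ht
        simp [hv .i rfl, hv .z rfl, hv .np rfl, hv .a rfl, hv .le rfl, h1, h2, h5, h6, g3, g4, g1,
          h8, e2, ht]
        omega
  · rintro s' ⟨h1, h2, h3, h4, h5, h6, h7, h8, h9⟩
    exact ⟨h7, h8, by simp; omega⟩

end Imp


/-! ## Setting up a run -/

namespace Imp

open LCIS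

variable {A B : List ℤ} {bd : ℕ} {R : Par}

/-- The last level of the array `sort` holds the columns sorted by their symbols. -/
structure Sorted (B : List ℤ) (L : ℕ) (s : St) : Prop where
  eq_lev : s.v .lev = L
  le : L ≤ B.length
  perm : (seg (row s L) 0 B.length).Perm (List.range B.length)
  sorted : (seg (row s L) 0 B.length).Pairwise (fun y y' => sym B y ≤ sym B y')

theorem Sorted.congr {L : ℕ} {s s' : St} (h : Sorted B L s) (h1 : s'.v .lev = s.v .lev)
    (h2 : s'.a .sort = s.a .sort) : Sorted B L s' := by
  have : row s' L = row s L := by unfold row; rw [h2]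
  exact ⟨h1.trans h.eq_lev, h.le, this ▸ h.perm, this ▸ h.sorted⟩

theorem Sorted.row_lt {L : ℕ} {s : St} (h : Sorted B L s) {i : ℕ} (hi : i < B.length) :
    row s L i < B.length := by
  have : row s L i ∈ seg (row s L) 0 B.length := mem_seg.mpr ⟨i, by omega, hi, rfl⟩
  simpa using h.perm.subset this

/-- Choose every `sp`-th column of the sorted order as a pivot. -/
def setPivots : Cmd :=
  Var.sp ≔ Var.b / Var.p + 1 ;; Var.np ≔ 0 ;;
  .whileDo (.lt (Var.np * Var.sp) Var.b)
    (.store .pv Var.np 0 0 (Var.a + Expr.ld .sort Var.lev (Var.np * Var.sp) 0) ;;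
      Var.np ≔ Var.np + 1)

theorem setPivots_spec {s : St} {L h : ℕ} (hs : Base A B s) (hL : Sorted B L s)
    (hp : s.v .p = 2 ^ h) (hbd : 64 * ((A.length + B.length + 2) * (A.length + B.length + 2)) ≤ bd) :
    setPivots.wp bd (A.length + B.length) (fun s' => ∃ R : Par, R.h = h ∧ R.Good B ∧
      s'.v .np = R.np ∧ R.np ≤ B.length ∧ s'.v .sp = B.length / 2 ^ h + 1 ∧
      (∀ i < R.np, s'.a .pv i 0 0 = A.length + R.pv i ∧ R.pv i < B.length) ∧
      s'.clk ≤ s.clk + 100 * 2 ^ h + 100) s := by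
  have hbl : 4 * (A.length + B.length) + 20 < bd := by nlinarith
  have hpp : 0 < 2 ^ h := by positivity
  set sp := B.length / 2 ^ h + 1 with hsp
  have hspb : sp ≤ B.length + 1 := by
    have := Nat.div_le_self B.length (2 ^ h); omega
  have hsp1 : 1 ≤ sp := Nat.succ_pos _
  -- Hence the multiples of `sp` below `|B|` number at most `2 ^ h`.
  have hlt : B.length < 2 ^ h * sp := by
    rw [hsp]; exact Nat.lt_mul_div_succ _ hpp
  simp only [setPivots, Cmd.wp_seq', Cmd.wp_assign, Expr.ok_add, Expr.ok_div, Expr.ok_var,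
    Expr.ok_one, Expr.ok_zero, Expr.eval_add, Expr.eval_div, Expr.eval_var, Expr.eval_one,
    Expr.eval_zero, hs.b, hp, ← hsp]
  refine ⟨⟨⟨trivial, trivial, by omega⟩, by omega, by omega⟩, by omega, ?_⟩
  refine Cmd.wp_while (fun s' => Base A B s' ∧ Sorted B L s' ∧ s'.v .sp = sp ∧
    s'.v .np ≤ 2 ^ h ∧ s'.v .np ≤ B.length ∧ row s' L = row s L ∧
    (∀ i < s'.v .np, s'.a .pv i 0 0 = A.length + row s L (i * sp) ∧ i * sp < B.length) ∧
    s'.clk ≤ s.clk + 70 * s'.v .np + 20) (fun s' => B.length + 1 - s'.v .np) ?_ ?_ ?_ _ ?_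
  · rintro s1 ⟨h1, h2, h3, h4, h5, h6, h7, h8⟩
    simp only [Cond.ok, Expr.ok_mul, Expr.ok_var, Expr.eval_var, true_and, and_true, h3]
    nlinarith
  · rintro s1 ⟨h1, h2, h3, h4, h5, h6, h7, h8⟩ ht
    simp only [Cond.holds, Expr.eval_mul, Expr.eval_var, h1.b, h3] at ht
    have hr := h2.row_lt ht
    have hnp : s1.v .np < 2 ^ h := by
      by_contra hcon
      have := Nat.mul_le_mul_right sp (not_lt.mp hcon)
      omega
    have hnp' : s1.v .np < B.length := by
      have : s1.v .np * 1 ≤ s1.v .np * sp := Nat.mul_le_mul_left _ hsp1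
      omega
    simp only [row] at hr
    simp [Cmd.wp_seq', h3, h1.a, h2.eq_lev]
    have := h2.le
    and_intros <;> try omega
    · exact h1.congr (by simp) (by simp) (by simp)
    · exact h2.congr (by simp [h2.eq_lev]) (by funext i j k; simp)
    · rw [← h6]; funext i; simp [row]
    · intro i hi
      split_ifs with hc
      · subst hc
        exact ⟨by rw [← h6]; simp [row], ht⟩
      · exact h7 i (by omega)
  · rintro s1 ⟨h1, h2, h3, h4, h5, h6, h7, h8⟩ ht
    simp only [Cond.holds, Expr.eval_mul, Expr.eval_var, h1.b, h3, not_lt] at ht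
    refine ⟨⟨h, s1.v .np, fun i => row s L (i * sp)⟩, rfl, ?_, rfl, h5, by simp [h3], fun i hi =>
      ⟨(h7 i hi).1, ?_⟩, by simp; omega⟩
    · exact Par.good_of_sorted hL.perm hL.sorted h4 ht fun i hi => ⟨rfl, (h7 i hi).2⟩
    · exact hL.row_lt (h7 i hi).2
  · simp [row]
    exact ⟨hs.congr (by simp) (by simp) (by simp), hL.congr (by simp) (by simp)⟩

/-- Compute the groups of the columns. -/
def setGroups : Cmd :=
  Var.y ≔ 0 ;; .upto .y Var.b
    (Var.z ≔ Var.a + Var.y ;; countPivots ;; .store .grp Var.y 0 0 (Var.lo + Var.le + 1) ;;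
      .store .d Var.y 0 0 0)

theorem setGroups_spec {s : St} (hs : Base A B s) (hnp : s.v .np = R.np) (hnb : R.np ≤ B.length)
    (hpv : ∀ i < R.np, s.a .pv i 0 0 = A.length + R.pv i ∧ R.pv i < B.length)
    (hbd : 4 * (A.length + B.length) + 20 < bd) :
    setGroups.wp bd (A.length + B.length) (fun s' =>
      (∀ y < B.length, s'.a .grp y 0 0 = R.grp B (sym B y) ∧ s'.a .d y 0 0 = 0) ∧
      s'.clk ≤ s.clk + B.length * (200 * R.np + 200) + 20) s := by
  simp only [setGroups, Cmd.wp_seq', Cmd.wp_assign, Expr.ok_zero, Expr.eval_zero, Expr.cost_zero]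
  refine ⟨by omega, Cmd.wp_upto (fun k s' => s'.v .y = k ∧ Base A B s' ∧ s'.v .np = R.np ∧
    s'.a .pv = s.a .pv ∧
    (∀ y < k, s'.a .grp y 0 0 = R.grp B (sym B y) ∧ s'.a .d y 0 0 = 0) ∧
      s'.clk ≤ s.clk + k * (200 * R.np + 200) + 5) 0 B.length (by omega) (by omega) ?_ ?_ ?_ ?_⟩
  · rintro k s1 ⟨h1, h2, -⟩
    exact ⟨h1, by simp [h2.b], trivial⟩
  · exact ⟨by simp, hs.congr (by simp) (by simp) (by simp), by simp [hnp], by simp, by simp, by simp⟩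
  · rintro k s1 - hk ⟨h1, h2, h3, h4, h5, h6⟩
    simp only [Cmd.wp_seq', Cmd.wp_assign, Expr.ok_add, Expr.ok_var, Expr.eval_add, Expr.eval_var,
      St.tick_v, h1, h2.a, true_and]
    refine ⟨by omega, ?_⟩
    refine Cmd.wp_conseq (countPivots_spec (R := R) (B := B) (A := A)
      (h2.congr (by simp) (by simp) (by simp)) (by simp [h3]) (by simpa [h4] using hpv) hbd
      (by omega) (by simp; omega)) ?_
    rintro s2 ⟨g1, g2, g3⟩ hs2
    simp [h2.inpB k hk] at g1 g2 g3
    have l1 := Par.ltc_le_lec (R := R) (B := B) (sym B k) R.np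
    have l2 := Par.lec_le (R := R) (B := B) (sym B k) R.np
    have hy : s2.v .y = k := by rw [hs2.v .y rfl]; simp [h1]
    simp [hy, g1, g2]
    and_intros <;> try omega
    · exact h2.congr (by simp [hs2.v .a rfl]) (by simp [hs2.v .b rfl]) (by simp [hs2.inp rfl])
    · rw [hs2.v .np rfl]; simp [h3]
    · rw [← h4]; funext i j l; simp [hs2.a .pv rfl]
    · intro y hy
      rw [hs2.a .grp rfl, hs2.a .d rfl]
      simp only [St.tick_a, St.set_a]
      rcases Nat.lt_succ_iff_lt_or_eq.mp (Nat.lt_succ_of_le hy) with h | rfl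
      · simp [h.ne, h5 y h]
      · simp [Par.grp]
    · rw [add_mul]; omega
  · rintro s1 ⟨h1, h2, h3, h4, h5, h6⟩
    exact ⟨h5, by simp; omega⟩

/-- Compute the row of the successor table of group `j`. -/
def setNext : Cmd :=
  Var.cur ≔ Var.b ;; .store .nxt Var.j Var.b 0 Var.b ;; Var.k ≔ 0 ;;
  .upto .k Var.b
    (Var.z ≔ Var.b - 1 - Var.k ;;
      .ite (.lt (Expr.ld .grp Var.z 0 0) Var.j) .skip
        (.ite (.lt Var.j (Expr.ld .grp Var.z 0 0)) .skip (Var.cur ≔ Var.z)) ;;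
      .store .nxt Var.j Var.z 0 Var.cur)

/-- Columns are visited from right to left, `cur` being the nearest column of the group seen so far,
or `|B|`. -/
theorem setNext_spec {s : St} {j : ℕ} (hs : Base A B s) (hj : s.v .j = j) (hjb : j < bd)
    (hg : ∀ y < B.length, s.a .grp y 0 0 = R.grp B (sym B y))
    (hbd : 4 * (A.length + B.length) + 20 < bd) :
    setNext.wp bd (A.length + B.length) (fun s' =>
      (∀ z ≤ B.length, IsNext R B j z (s'.a .nxt j z 0)) ∧
      (∀ j' z, j' ≠ j → s'.a .nxt j' z 0 = s.a .nxt j' z 0) ∧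
      s'.clk ≤ s.clk + 200 * B.length + 60) s := by
  have b0 : 0 < bd := by omega
  have b1 : 1 < bd := by omega
  have b2 : B.length < bd := by omega
  simp [setNext, hs.b, hj, b0, b1, b2, hjb]
  refine Cmd.wp_upto (fun k s' => s'.v .k = k ∧ Base A B s' ∧ s'.v .j = j ∧
    (∀ y < B.length, s'.a .grp y 0 0 = R.grp B (sym B y)) ∧
    (∀ z, B.length ≤ z + k → z ≤ B.length → IsNext R B j z (s'.a .nxt j z 0)) ∧
    IsNext R B j (B.length - k) (s'.v .cur) ∧
    (∀ j' z, j' ≠ j → s'.a .nxt j' z 0 = s.a .nxt j' z 0) ∧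
    s'.clk ≤ s.clk + 200 * k + 50) 0 B.length (by omega) (by omega) ?_ ?_ ?_ ?_
  · rintro k s1 ⟨h1, h2, -⟩
    exact ⟨h1, by simp [h2.b], trivial⟩
  · have hnb : IsNext R B j B.length B.length :=
      ⟨le_rfl, le_rfl, fun h => absurd h (lt_irrefl _), fun y' h h' => absurd h (not_le.mpr h')⟩
    refine ⟨by simp, hs.congr (by simp) (by simp) (by simp), by simp [hj], by simpa using hg, ?_,
      by simpa using hnb, ?_, ?_⟩
    · intro z hz hz'
      obtain rfl : z = B.length := by omega
      simpa using hnb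
    · intro j' z hj'
      simp [hj']
    · simp
  · rintro k s1 - hk ⟨h1, h2, h3, h4, h5, h6, h7, h8⟩
    have hzb : B.length - 1 - k < bd := by omega
    have hzlt : B.length - 1 - k < B.length := by omega
    have hgz := h4 _ hzlt
    simp only [Cmd.wp_seq', Cmd.wp_assign, Expr.ok_sub, Expr.ok_var, Expr.ok_one, Expr.eval_sub,
      Expr.eval_var, Expr.eval_one, St.tick_v, h1, h2.b, true_and, b1]
    set z := B.length - 1 - k with hz
    have hzk : B.length - k = z + 1 := by omega
    rw [hzk] at h6
    refine Cmd.wp_conseq (R := fun s' => IsNext R B j z (s'.v .cur) ∧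
      s'.clk ≤ s1.clk + 120) ?_ ?_
    · have hstay : R.grp B (sym B z) ≠ j → IsNext R B j z (s1.v .cur) := fun hne =>
        ⟨by have := h6.le; omega, h6.le_length, h6.grp_eq, fun y' hy1 hy2 => by
          rcases hy1.lt_or_eq with h | rfl
          · exact h6.grp_ne y' h hy2
          · exact hne⟩
      refine Cmd.wp_ite (by simp [b0, hzb]) (fun ht => ?_) (fun ht => ?_)
      · simp [hgz, h3] at ht
        exact ⟨by simpa using hstay ht.ne, by simp⟩
      · simp [hgz, h3] at ht
        refine Cmd.wp_ite (by simp [b0, hzb]) (fun ht' => ?_) (fun ht' => ?_)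
        · simp [hgz, h3] at ht'
          exact ⟨by simpa using hstay ht'.ne', by simp⟩
        · simp [hgz, h3] at ht'
          simp
          exact (⟨le_rfl, hzlt.le, fun _ => le_antisymm ht' ht, fun y' h h' => by omega⟩ :
            IsNext R B j z z)
    · rintro s2 ⟨g1, g2⟩ hs2
      have hz2 : s2.v .z = z := by rw [hs2.v .z rfl]; simp
      have hj2 : s2.v .j = j := by rw [hs2.v .j rfl]; simp [h3]
      have ha2 : s2.a = s1.a := by funext k'; rw [hs2.a k' (by cases k' <;> rfl)]; simp
      simp [hz2, hj2, b0, hjb, hzb, ha2]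
      and_intros
      · rw [hs2.v .k rfl]; simp [h1]
      · exact h2.congr (by simp [hs2.v .a rfl]) (by simp [hs2.v .b rfl]) (by simp [hs2.inp rfl])
      · simpa [ha2] using h4
      · intro z' hz1 hz3
        split_ifs with hc
        · rw [hc]; exact g1
        · exact h5 z' (by have : z' ≠ z := hc
                          omega) hz3
      · rw [show B.length - (k + 1) = z by omega]; exact g1
      · intro j' z' hj'
        simp [hj', ha2, h7 j' z' hj']
      · omega
  · rintro s1 ⟨h1, h2, h3, h4, h5, h6, h7, h8⟩
    exact ⟨fun z hz => by simpa using h5 z (by omega) hz, by simpa using h7, by simp; omega⟩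

/-- Clear the tree of group `j`. -/
def clearTree : Cmd :=
  Var.l ≔ 0 ;; .upto .l (Var.h + 1) (Var.i ≔ 0 ;; .upto .i (Var.b + 1)
    (.store .tree Var.j Var.l Var.i 0))

theorem clearTree_spec {s : St} {j h b len : ℕ} (hj : s.v .j = j) (hh : s.v .h = h)
    (hb : s.v .b = b) (hjb : j < bd) (hhb : h + 2 < bd) (hbb : b + 2 < bd) :
    clearTree.wp bd len (fun s' =>
      (∀ l ≤ h, ∀ n ≤ b, s'.a .tree j l n = 0) ∧
      (∀ j' l n, j' ≠ j → s'.a .tree j' l n = s.a .tree j' l n) ∧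
      s'.clk ≤ s.clk + (h + 1) * (50 * b + 100) + 20) s := by
  have b0 : 0 < bd := by omega
  have b1 : 1 < bd := by omega
  simp [clearTree, b0]
  refine Cmd.wp_upto (fun k s' => s'.v .l = k ∧ s'.v .h = h ∧ s'.v .b = b ∧ s'.v .j = j ∧
    (∀ l < k, ∀ n ≤ b, s'.a .tree j l n = 0) ∧
    (∀ j' l n, j' ≠ j → s'.a .tree j' l n = s.a .tree j' l n) ∧
    s'.clk ≤ s.clk + k * (50 * b + 100) + 5) 0 (h + 1) (by omega) (by omega) ?_ ?_ ?_ ?_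
  · rintro k s1 ⟨h1, h2, -⟩
    exact ⟨h1, by simp [h2], by simp [b1, h2]; omega⟩
  · simp [hh, hb, hj]
  · rintro k s1 - hk ⟨h1, h2, h3, h4, h5, h6, h7⟩
    simp [b0]
    refine Cmd.wp_upto (fun i s' => s'.v .i = i ∧ s'.v .l = k ∧ s'.v .h = h ∧ s'.v .b = b ∧
      s'.v .j = j ∧ (∀ l < k, ∀ n ≤ b, s'.a .tree j l n = 0) ∧
      (∀ n < i, s'.a .tree j k n = 0) ∧
      (∀ j' l n, j' ≠ j → s'.a .tree j' l n = s.a .tree j' l n) ∧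
      s'.clk ≤ s1.clk + i * 50 + 20) 0 (b + 1) (by omega) (by omega) ?_ ?_ ?_ ?_
    · rintro i s2 ⟨h1, h2, h3, h4, -⟩
      exact ⟨h1, by simp [h4], by simp [b1, h4]; omega⟩
    · simp [h1, h2, h3, h4]
      exact ⟨h5, h6⟩
    · rintro i s2 - hi ⟨g1, g2, g3, g4, g5, g6, g7, g8, g9⟩
      simp [g1, g2, g3, g4, g5, b0]
      and_intros <;> try omega
      · intro l hl n hn; simp [hl.ne, g6 l hl n hn]
      · intro n hn
        rcases (Nat.le_of_lt_succ (Nat.lt_succ_of_le hn)).lt_or_eq with h | rfl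
        · simp [g7 n h]
        · simp
      · intro j' l n hj'; simp [hj', g8 j' l n hj']
    · rintro s2 ⟨g1, g2, g3, g4, g5, g6, g7, g8, g9⟩
      simp [g2, g3, g4, g5]
      and_intros <;> try omega
      · intro l hl n hn
        rcases hl.lt_or_eq with h | rfl
        · exact g6 l h n hn
        · exact g7 n (by omega)
      · rw [add_mul k]; omega
  · rintro s1 ⟨h1, h2, h3, h4, h5, h6, h7⟩
    refine ⟨fun l hl n hn => h5 l (by omega) n hn, h6, by simp; omega⟩

/-- Set up the successor tables and the trees of all groups. -/
def setTables : Cmd :=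
  Var.j ≔ 0 ;; .upto .j (2 * Var.np + 2) (.store .ptr Var.j 0 0 0 ;; setNext ;; clearTree)

theorem setTables_spec {s : St} {h : ℕ} (hs : Base A B s) (hh : s.v .h = h) (hnp : s.v .np = R.np)
    (hg : ∀ y < B.length, s.a .grp y 0 0 = R.grp B (sym B y))
    (hnpb : R.np ≤ B.length) (hhb : h ≤ A.length + B.length + 2)
    (hbd : 4 * (A.length + B.length) + 20 < bd) :
    setTables.wp bd (A.length + B.length) (fun s' => (∀ j ≤ 2 * R.np + 1, s'.a .ptr j 0 0 = 0 ∧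
      (∀ z ≤ B.length, IsNext R B j z (s'.a .nxt j z 0)) ∧
      ∀ l ≤ h, ∀ n ≤ B.length, s'.a .tree j l n = 0) ∧
      s'.clk ≤ s.clk + (2 * R.np + 2) * ((h + 2) * (200 * B.length + 200)) + 20) s := by
  have b0 : 0 < bd := by omega
  have b1 : 1 < bd := by omega
  simp [setTables, b0]
  refine Cmd.wp_upto (fun k s' => s'.v .j = k ∧ Base A B s' ∧ s'.v .h = h ∧ s'.v .np = R.np ∧
    (∀ y < B.length, s'.a .grp y 0 0 = R.grp B (sym B y)) ∧
    (∀ j < k, s'.a .ptr j 0 0 = 0 ∧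
      (∀ z ≤ B.length, IsNext R B j z (s'.a .nxt j z 0)) ∧
      ∀ l ≤ h, ∀ n ≤ B.length, s'.a .tree j l n = 0) ∧
      s'.clk ≤ s.clk + k * ((h + 2) * (200 * B.length + 200)) + 3) 0 (2 * R.np + 2) (by omega)
      (by omega) ?_ ?_ ?_ ?_
  · rintro k s1 ⟨h1, h2, h3, h4, -⟩
    exact ⟨h1, by simp [h4], by simp [h4]; omega⟩
  · exact ⟨by simp, hs.congr (by simp) (by simp) (by simp), by simp [hh], by simp [hnp],
      by simpa using hg, by simp, by simp⟩
  · rintro k s1 - hk ⟨h1, h2, h3, h4, h5, h6, h7⟩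
    have hkb : k < bd := by omega
    simp [h1, b0, hkb]
    refine Cmd.wp_conseq (setNext_spec (R := R) (j := k) (h2.congr (by simp) (by simp) (by simp))
      (by simp [h1]) hkb (by simpa using h5) hbd) ?_
    rintro s2 ⟨g1, g2, g3⟩ hs2
    refine Cmd.wp_conseq (clearTree_spec (j := k) (h := h) (b := B.length)
      (by simp [hs2.v .j rfl, h1]) (by simp [hs2.v .h rfl, h3]) (by simp [hs2.v .b rfl, h2.b])
      hkb (by omega) (by omega)) ?_
    rintro s3 ⟨f1, f2, f3⟩ hs3
    have e1 : s3.a .nxt = s2.a .nxt := hs3.a .nxt rfl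
    have e2 : s3.a .ptr = fun j i l => if j = k ∧ i = 0 ∧ l = 0 then 0 else s1.a .ptr j i l := by
      rw [hs3.a .ptr rfl, hs2.a .ptr rfl]; funext j i l; simp
    have e3 : ∀ j z, j ≠ k → s2.a .nxt j z 0 = s1.a .nxt j z 0 := fun j z hj => by
      rw [g2 j z hj]; simp
    have e4 : ∀ j l n, j ≠ k → s3.a .tree j l n = s1.a .tree j l n := fun j l n hj => by
      rw [f2 j l n hj, hs2.a .tree rfl]; simp
    and_intros
    · simp [hs3.v .j rfl, hs2.v .j rfl, h1]
    · exact h2.congr (by simp [hs3.v .a rfl, hs2.v .a rfl]) (by simp [hs3.v .b rfl, hs2.v .b rfl])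
        (by simp [hs3.inp rfl, hs2.inp rfl])
    · simp [hs3.v .h rfl, hs2.v .h rfl, h3]
    · simp [hs3.v .np rfl, hs2.v .np rfl, h4]
    · simp [hs3.a .grp rfl, hs2.a .grp rfl]; exact h5
    · intro j hj
      rw [e1, e2]
      rcases Nat.lt_succ_iff_lt_or_eq.mp (Nat.lt_succ_of_le hj) with h | rfl
      · obtain ⟨p1, p2, p3⟩ := h6 j h
        refine ⟨by simp [p1], fun z hz => ?_, fun l hl n hn => ?_⟩
        · rw [e3 j z h.ne]; exact p2 z hz
        · rw [e4 j l n h.ne]; exact p3 l hl n hn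
      · exact ⟨by simp, g1, f1⟩
    · simp at f3 g3
      nlinarith
  · rintro s1 ⟨h1, h2, h3, h4, h5, h6, h7⟩
    exact ⟨fun j hj => by simpa using h6 j (by omega), by simp; omega⟩

/-- Prepare a run with `2 ^ h = p`. -/
def setup : Cmd :=
  setPivots ;; setGroups ;; setTables ;; .store .rz 0 0 0 0 ;; .store .ru 0 0 0 1 ;;
    .store .rg 0 0 0 0 ;; Var.cnt ≔ 1 ;; Var.cap ≔ (Var.m / Var.p) * (Var.m / Var.p)

/-- No row has been processed. -/
structure Fresh (A B : List ℤ) (R : Par) (s : St) : Prop where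
  env : Env A B R s
  good : R.Good B
  np_le : R.np ≤ B.length
  sp : s.v .sp = B.length / 2 ^ R.h + 1
  d : ∀ y < B.length, s.a .d y 0 0 = 0
  ptr : ∀ j ≤ 2 * R.np + 1, s.a .ptr j 0 0 = 0
  tree : ∀ j ≤ 2 * R.np + 1, ∀ l ≤ R.h, ∀ n ≤ B.length, s.a .tree j l n = 0
  rz : s.a .rz 0 0 0 = 0
  ru : s.a .ru 0 0 0 = 1
  rg : s.a .rg 0 0 0 = 0
  cnt : s.v .cnt = 1
  cap : s.v .cap = ((A.length + B.length + 2) / 2 ^ R.h) * ((A.length + B.length + 2) / 2 ^ R.h)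

theorem setup_spec {s : St} {L h : ℕ} (hs : Base A B s) (hL : Sorted B L s)
    (hp : s.v .p = 2 ^ h) (hh : s.v .h = h) (hm : s.v .m = A.length + B.length + 2)
    (hpm : 2 ^ h ≤ A.length + B.length + 2)
    (hbd : 64 * ((A.length + B.length + 2) * (A.length + B.length + 2)) ≤ bd) :
    setup.wp bd (A.length + B.length) (fun s' => ∃ R : Par, R.h = h ∧ Fresh A B R s' ∧
      s'.clk ≤ s.clk + 2500 * (2 ^ h * (A.length + B.length + 2) * (h + 1))) s := by
  have hbl : 4 * (A.length + B.length) + 20 < bd := by nlinarith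
  have b0 : 0 < bd := by omega
  have b1 : 1 < bd := by omega
  have hlt := Nat.lt_two_pow_self (n := h)
  unfold setup
  refine Cmd.wp_seq (setPivots_spec hs hL hp hbd) ?_
  rintro s1 ⟨R, rfl, hgood, h1, h2, h3, h4, h5⟩ hs1
  have hb1 : Base A B s1 := hs.same hs1 rfl rfl rfl
  refine Cmd.wp_seq (setGroups_spec hb1 h1 h2 h4 hbl) ?_
  rintro s2 ⟨g1, g2⟩ hs2
  have hb2 : Base A B s2 := hb1.same hs2 rfl rfl rfl
  refine Cmd.wp_seq (setTables_spec (R := R) (h := R.h) hb2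
    (by rw [hs2.v .h rfl, hs1.v .h rfl, hh])
    (by rw [hs2.v .np rfl, h1]) (fun y hy => (g1 y hy).1) h2 (hlt.le.trans hpm) hbl) ?_
  rintro s3 ⟨f1, f2⟩ hs3
  have hb3 : Base A B s3 := hb2.same hs3 rfl rfl rfl
  have hp3 : s3.v .p = 2 ^ R.h := by rw [hs3.v .p rfl, hs2.v .p rfl, hs1.v .p rfl, hp]
  have hm3 : s3.v .m = A.length + B.length + 2 := by
    rw [hs3.v .m rfl, hs2.v .m rfl, hs1.v .m rfl, hm]
  have hnp3 : s3.v .np = R.np := by rw [hs3.v .np rfl, hs2.v .np rfl, h1]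
  have hcap : (A.length + B.length + 2) / 2 ^ R.h * ((A.length + B.length + 2) / 2 ^ R.h) < bd := by
    have := Nat.div_le_self (A.length + B.length + 2) (2 ^ R.h)
    have := Nat.mul_le_mul this this
    nlinarith
  simp [b0, b1, hp3, hm3, hcap]
  refine ⟨R, rfl, ⟨⟨hb3.congr (by simp) (by simp) (by simp), ?_, ?_, ?_, ?_, ?_, fun i hi => (h4 i hi).2, ?_⟩, hgood, h2, ?_, ?_,
    ?_, ?_, ?_, ?_, ?_, ?_, ?_⟩, ?_⟩
  · simp [hs3.v .h rfl, hs2.v .h rfl, hs1.v .h rfl, hh]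
  · simp [hp3]
  · simp [hnp3]
  · simp [hm3]
  · intro i hi
    simp [hs3.a .pv rfl, hs2.a .pv rfl, (h4 i hi).1]
  · intro j hj z hz
    simpa using (f1 j hj).2.1 z hz
  · simp [hs3.v .sp rfl, hs2.v .sp rfl, h3]
  · intro y hy
    simp [hs3.a .d rfl, (g1 y hy).2]
  · intro j hj
    simpa using (f1 j hj).1
  · intro j hj l hl n hn
    simpa using (f1 j hj).2.2 l hl n hn
  · simp
  · simp
  · simp
  · simp
  · simp
  · have hnp2 := hgood.np_le
    have q1 : B.length * (200 * R.np + 200) ≤ 400 * (2 ^ R.h * (A.length + B.length + 2)) := by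
      nlinarith
    have q2 : (2 * R.np + 2) * ((R.h + 2) * (200 * B.length + 200)) ≤
        1600 * (2 ^ R.h * (A.length + B.length + 2) * (R.h + 1)) := by
      calc _ ≤ (4 * 2 ^ R.h) * ((2 * (R.h + 1)) * (200 * (A.length + B.length + 2))) := by
            apply Nat.mul_le_mul (by omega) (Nat.mul_le_mul (by omega) (by omega))
        _ = _ := by ring
    have q3 : 2 ^ R.h * (A.length + B.length + 2) ≤
      2 ^ R.h * (A.length + B.length + 2) * (R.h + 1) := Nat.le_mul_of_pos_right _ (by omega)
    have q4 : 2 ^ R.h * 2 ≤ 2 ^ R.h * (A.length + B.length + 2) := Nat.mul_le_mul_left _ (by omega)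
    have q5 := Nat.one_le_two_pow (n := R.h)
    omega

end Imp


/-! ## Range maxima over the recorded pairs -/

namespace Imp

open LCIS

variable {A B : List ℤ} {bd len : ℕ} {R : Par}

/-- The maximum of `f` over the numbers below `n` that satisfy `P`, or `0`. -/
def mx (f : ℕ → ℕ) (n : ℕ) (P : ℕ → Prop) [DecidablePred P] : ℕ :=
  ((Finset.range n).filter P).sup f

section

variable {f f' : ℕ → ℕ} {n : ℕ} {P P' P'' : ℕ → Prop} [DecidablePred P] [DecidablePred P']
  [DecidablePred P'']

theorem mx_zero : mx f 0 P = 0 := by simp [mx]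

theorem mx_succ : mx f (n + 1) P = if P n then max (mx f n P) (f n) else mx f n P := by
  unfold mx
  rw [Finset.range_add_one, Finset.filter_insert]
  split_ifs
  · rw [Finset.sup_insert, sup_comm]
  · rfl

theorem mx_congr (hf : ∀ i < n, P i → f i = f' i) (h : ∀ i < n, (P i ↔ P' i)) :
    mx f n P = mx f' n P' := by
  unfold mx
  apply Finset.sup_congr
  · ext i; simp only [Finset.mem_filter, Finset.mem_range]
    constructor
    · rintro ⟨h1, h2⟩; exact ⟨h1, (h i h1).mp h2⟩
    · rintro ⟨h1, h2⟩; exact ⟨h1, (h i h1).mpr h2⟩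
  · intro i hi
    simp only [Finset.mem_filter, Finset.mem_range] at hi
    exact hf i hi.1 ((h i hi.1).mpr hi.2)

theorem mx_or (h : ∀ i < n, (P i ↔ P' i ∨ P'' i)) : mx f n P = max (mx f n P') (mx f n P'') := by
  unfold mx
  rw [← Finset.sup_union, ← Finset.filter_or]
  refine Finset.sup_congr (Finset.filter_congr fun i hi => h i (Finset.mem_range.mp hi)) fun _ _ => rfl

theorem le_mx {i : ℕ} (hi : i < n) (h : P i) : f i ≤ mx f n P :=
  Finset.le_sup (f := f) (by simp [hi, h])

theorem mx_le {v : ℕ} (h : ∀ i < n, P i → f i ≤ v) : mx f n P ≤ v :=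
  Finset.sup_le fun i hi => by
    simp only [Finset.mem_filter, Finset.mem_range] at hi
    exact h i hi.1 hi.2

theorem exists_mx (h : 0 < mx f n P) : ∃ i < n, P i ∧ f i = mx f n P := by
  have hne : ((Finset.range n).filter P).Nonempty := by
    rw [Finset.nonempty_iff_ne_empty]
    intro he
    simp [mx, he] at h
  obtain ⟨i, hi, h1⟩ := Finset.exists_mem_eq_sup _ hne f
  simp only [Finset.mem_filter, Finset.mem_range] at hi
  exact ⟨i, hi.1, hi.2, h1.symm⟩

theorem mx_eq_zero (h : ∀ i < n, ¬ P i) : mx f n P = 0 :=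
  Nat.le_zero.mp (mx_le fun i hi hp => absurd hp (h i hi))

end

/-- Update the tree of group `j` with the value `u` at the leaf `z`. -/
def insertLeaf : Cmd :=
  Var.node ≔ Var.z ;; Var.l ≔ 0 ;; .upto .l (Var.h + 1)
    (.ite (.lt (Expr.ld .tree Var.j Var.l Var.node) Var.u)
      (.store .tree Var.j Var.l Var.node Var.u) .skip ;;
    Var.node ≔ Var.node / 2)

/-- The ancestors of the leaf `ζ` are the nodes `ζ / 2 ^ l`; exactly these cells can change. -/
theorem insertLeaf_spec {s : St} {j h v ζ : ℕ} (hj : s.v .j = j) (hh : s.v .h = h) (hu : s.v .u = v)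
    (hz : s.v .z = ζ) (hjb : j < bd) (hhb : h + 2 < bd) (hzb : ζ < bd) (hbd : 10 < bd) :
    insertLeaf.wp bd len (fun s' =>
      (∀ l ≤ h, ∀ c, s'.a .tree j l c =
        if ζ / 2 ^ l = c then max (s.a .tree j l c) v else s.a .tree j l c) ∧
      (∀ j' l c, j' ≠ j → s'.a .tree j' l c = s.a .tree j' l c) ∧
      s'.clk ≤ s.clk + 150 * (h + 1) + 50) s := by
  have b0 : 0 < bd := by omega
  have b1 : 1 < bd := by omega
  have b2 : 2 < bd := by omega
  simp [insertLeaf, b0]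
  refine Cmd.wp_upto (fun k s' => s'.v .l = k ∧ s'.v .h = h ∧ s'.v .j = j ∧ s'.v .u = v ∧
    s'.v .node = ζ / 2 ^ k ∧
    (∀ l c, s'.a .tree j l c =
        if l < k ∧ ζ / 2 ^ l = c then max (s.a .tree j l c) v else s.a .tree j l c) ∧
    (∀ j' l c, j' ≠ j → s'.a .tree j' l c = s.a .tree j' l c) ∧
    s'.clk ≤ s.clk + 150 * k + 20) 0 (h + 1) (by omega) (by omega) ?_ ?_ ?_ ?_
  · rintro k s1 ⟨h1, h2, -⟩
    exact ⟨h1, by simp [h2], by simp [b1, h2]; omega⟩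
  · simp [hj, hh, hu, hz]
  · rintro k s1 - hk ⟨h1, h2, h3, h4, h5, h6, h7, h8⟩
    have hkb : k < bd := by omega
    have hnb : ζ / 2 ^ k < bd := lt_of_le_of_lt (Nat.div_le_self _ _) hzb
    have e : s1.a .tree j k (ζ / 2 ^ k) = s.a .tree j k (ζ / 2 ^ k) := by simp [h6]
    refine Cmd.wp_seq (R := fun s' => (∀ l c, s'.a .tree j l c =
        if l < k + 1 ∧ ζ / 2 ^ l = c then max (s.a .tree j l c) v else s.a .tree j l c) ∧
      (∀ j' l c, j' ≠ j → s'.a .tree j' l c = s.a .tree j' l c) ∧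
      s'.clk ≤ s1.clk + 80) ?_ ?_
    · have hcase : ∀ l c, ¬ (l = k ∧ c = ζ / 2 ^ k) → s1.a .tree j l c =
          if l < k + 1 ∧ ζ / 2 ^ l = c then max (s.a .tree j l c) v else s.a .tree j l c := by
        intro l c hne
        rw [h6]
        congr 1
        rw [eq_iff_iff]
        constructor
        · rintro ⟨h1, h2⟩; exact ⟨by omega, h2⟩
        · rintro ⟨h1, rfl⟩
          refine ⟨?_, rfl⟩
          by_contra hcon
          obtain rfl : l = k := by omega
          exact hne ⟨rfl, rfl⟩
      refine Cmd.wp_ite (by simp [h1, h3, h5, hjb, hkb, hnb]) (fun ht => ?_) (fun ht => ?_)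
      · simp [h1, h3, h4, h5, e] at ht
        simp only [Cmd.wp_store, Expr.ok_var, Expr.eval_var, St.tick_v, h1, h3, h4, h5, true_and]
        refine ⟨hjb, hkb, hnb, fun l c => ?_, fun j' l c hj' => ?_, ?_⟩
        · by_cases hc : l = k ∧ c = ζ / 2 ^ k
          · obtain ⟨rfl, rfl⟩ := hc
            simp; omega
          · rw [← hcase l c hc]
            simp [hc]
        · simp [hj', h7 j' l c hj']
        · simp
      · simp [h1, h3, h4, h5, e] at ht
        simp only [Cmd.wp_skip]
        refine ⟨fun l c => ?_, h7, by simp⟩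
        by_cases hc : l = k ∧ c = ζ / 2 ^ k
        · obtain ⟨rfl, rfl⟩ := hc
          simp [e]; omega
        · exact hcase l c hc
    · rintro s2 ⟨g1, g2, g3⟩ hs2
      simp [hs2.v .node rfl, hs2.v .l rfl, hs2.v .h rfl, hs2.v .j rfl, hs2.v .u rfl, h1, h2, h3,
        h4, h5, b2]
      refine ⟨?_, fun l c => by simpa using g1 l c, g2, by omega⟩
      rw [pow_succ, Nat.div_div_eq_div_mul]
  · rintro s1 ⟨h1, h2, h3, h4, h5, h6, h7, h8⟩
    refine ⟨fun l hl c => ?_, h7, by simp; omega⟩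
    simp only [St.tick_a, h6, show l < h + 1 by omega, true_and]

/-- Insert the new records of smaller groups into the tree of group `j`. -/
def absorb : Cmd :=
  Var.fin ≔ Var.cnt ;; Var.old ≔ Expr.ld .ptr Var.j 0 0 ;; Var.i ≔ Var.old ;; .upto .i Var.fin
    (.ite (.lt (Expr.ld .rg Var.i 0 0) Var.j)
      (Var.z ≔ Expr.ld .rz Var.i 0 0 ;; Var.u ≔ Expr.ld .ru Var.i 0 0 ;; insertLeaf) .skip) ;;
  .store .ptr Var.j 0 0 Var.fin

/-- Lazy update: the tree of `j` represents the first `old` records, and only those added since are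
inserted. The clock is charged per new record, which makes the amortization over a whole run
possible. -/
theorem absorb_spec {s : St} {j h n b old : ℕ} {f z g : ℕ → ℕ} (hj : s.v .j = j) (hh : s.v .h = h)
    (hn : s.v .cnt = n) (hold : s.a .ptr j 0 0 = old) (hle : old ≤ n)
    (hjb : j < bd) (hhb : h + 2 < bd) (hbb : b < bd) (hnb : n + 2 < bd) (hbd : 10 < bd)
    (hz : ∀ i < n, s.a .rz i 0 0 = z i) (hf : ∀ i < n, s.a .ru i 0 0 = f i)
    (hg : ∀ i < n, s.a .rg i 0 0 = g i) (hzb : ∀ i < n, z i ≤ b)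
    (hT : ∀ l ≤ h, ∀ c ≤ b, s.a .tree j l c = mx f old (fun i => g i < j ∧ z i / 2 ^ l = c)) :
    absorb.wp bd len (fun s' => s'.v .old = old ∧ s'.v .fin = n ∧
      (∀ l ≤ h, ∀ c ≤ b, s'.a .tree j l c = mx f n (fun i => g i < j ∧ z i / 2 ^ l = c)) ∧
      (∀ j' l c, j' ≠ j → s'.a .tree j' l c = s.a .tree j' l c) ∧
      (∀ j', s'.a .ptr j' 0 0 = if j' = j then n else s.a .ptr j' 0 0) ∧
      s'.clk ≤ s.clk + (n - old) * (350 * (h + 1)) + 200) s := by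
  have b0 : 0 < bd := by omega
  have b1 : 1 < bd := by omega
  simp [absorb, b0, hj, hn, hjb, hold]
  refine Cmd.wp_conseq (R := fun s' => s'.v .fin = n ∧ s'.v .old = old ∧
      (∀ l ≤ h, ∀ c ≤ b, s'.a .tree j l c = mx f n (fun i => g i < j ∧ z i / 2 ^ l = c)) ∧
      (∀ j' l c, j' ≠ j → s'.a .tree j' l c = s.a .tree j' l c) ∧
      s'.clk ≤ s.clk + (n - old) * (350 * (h + 1)) + 70)
    (Cmd.wp_upto (fun k s' => s'.v .i = k ∧ s'.v .fin = n ∧ s'.v .old = old ∧ s'.v .j = j ∧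
      s'.v .h = h ∧
      (∀ k' i l m, k' ≠ .tree → s'.a k' i l m = s.a k' i l m) ∧
      (∀ l ≤ h, ∀ c ≤ b, s'.a .tree j l c = mx f k (fun i => g i < j ∧ z i / 2 ^ l = c)) ∧
      (∀ j' l c, j' ≠ j → s'.a .tree j' l c = s.a .tree j' l c) ∧
      s'.clk ≤ s.clk + (k - old) * (350 * (h + 1)) + 50) old n (by omega) (by omega)
      ?_ ?_ ?_ ?_) ?_
  · rintro k s1 ⟨h1, h2, -⟩
    exact ⟨h1, by simp [h2], trivial⟩
  · simp [hj, hh]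
    exact hT
  · rintro k s1 hk1 hk ⟨h1, h2, h3, h4, h5, h6, h7, h8, h9⟩
    have hkb : k < bd := by omega
    have hclk : s1.clk + 350 * (h + 1) ≤ s.clk + (k + 1 - old) * (350 * (h + 1)) + 50 := by
      rw [show k + 1 - old = (k - old) + 1 by omega, add_mul (k - old), one_mul]; omega
    refine Cmd.wp_ite (by simp [h1, h4, hkb, b0]) (fun ht => ?_) (fun ht => ?_)
    · simp [h1, h4, h6, hg k hk] at ht
      simp [h1, hkb, b0]
      refine Cmd.wp_conseq (insertLeaf_spec (j := j) (h := h) (v := f k) (ζ := z k) (by simp [h4])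
        (by simp [h5]) (by simp [h6, hf k hk]) (by simp [h6, hz k hk]) hjb hhb
        (lt_of_le_of_lt (hzb k hk) hbb) hbd) ?_
      rintro s2 ⟨g1, g2, g3⟩ hs2
      have hv := hs2.v
      simp [hv .i rfl, hv .fin rfl, hv .old rfl, hv .j rfl, hv .h rfl, h1, h2, h3, h4, h5]
      refine ⟨fun k' i l m hk' => ?_, fun l hl c hc => ?_, fun j' l c hj' => ?_, ?_⟩
      · rw [hs2.a k' (by cases k' <;> first | rfl | exact absurd rfl hk')]
        simp [h6 k' i l m hk']
      · rw [g1 l hl c, mx_succ]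
        simp only [ht, true_and, St.tick_a, St.set_a, h7 l hl c hc]
      · rw [g2 j' l c hj']; simp [h8 j' l c hj']
      · simp at g3; omega
    · simp [h1, h4, h6, hg k hk] at ht
      simp [h1, h2, h3, h4, h5]
      refine ⟨h6, fun l hl c hc => ?_, h8, by omega⟩
      rw [mx_succ, if_neg (by omega), h7 l hl c hc]
  · rintro s1 ⟨h1, h2, h3, h4, h5, h6, h7, h8, h9⟩
    exact ⟨by simp [h2], by simp [h3], by simpa using h7, by simpa using h8, by simp; omega⟩
  · rintro s1 ⟨h1, h2, h3, h4, h5⟩ hs1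
    simp [hs1.v .j rfl, hj, hjb, b0, h1, h2]
    refine ⟨h3, h4, fun j' => ?_, by omega⟩
    rw [hs1.a .ptr rfl]
    simp

/-- Prefix maxima over the top level of the tree of group `j`. -/
def prefixMax : Cmd :=
  .store .pre 0 0 0 0 ;; Var.i ≔ 0 ;; .upto .i Var.sp
    (.ite (.lt (Expr.ld .pre Var.i 0 0) (Expr.ld .tree Var.j Var.h Var.i))
      (.store .pre (Var.i + 1) 0 0 (Expr.ld .tree Var.j Var.h Var.i))
      (.store .pre (Var.i + 1) 0 0 (Expr.ld .pre Var.i 0 0)))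

/-- The tree stops at level `h`, with about `b / 2 ^ h` nodes. Scanning them once per row keeps
every query at `O(h + 1)` instead of `O(log b)`. -/
theorem prefixMax_spec {s : St} {j h n b : ℕ} {f z g : ℕ → ℕ} (hj : s.v .j = j) (hh : s.v .h = h)
    (hsp : s.v .sp = b / 2 ^ h + 1) (hjb : j < bd) (hhb : h < bd) (hbb : b + 2 < bd)
    (hT : ∀ l ≤ h, ∀ c ≤ b, s.a .tree j l c = mx f n (fun i => g i < j ∧ z i / 2 ^ l = c)) :
    prefixMax.wp bd len (fun s' => (∀ c ≤ b / 2 ^ h + 1,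
      s'.a .pre c 0 0 = mx f n (fun i => g i < j ∧ z i / 2 ^ h < c)) ∧
      s'.clk ≤ s.clk + 150 * (b / 2 ^ h + 1) + 50) s := by
  have b0 : 0 < bd := by omega
  have b1 : 1 < bd := by omega
  have hq : b / 2 ^ h ≤ b := Nat.div_le_self _ _
  simp [prefixMax, b0]
  refine Cmd.wp_upto (fun k s' => s'.v .i = k ∧ s'.v .j = j ∧ s'.v .h = h ∧
    s'.v .sp = b / 2 ^ h + 1 ∧ s'.a .tree = s.a .tree ∧ (∀ c ≤ k,
      s'.a .pre c 0 0 = mx f n (fun i => g i < j ∧ z i / 2 ^ h < c)) ∧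
      s'.clk ≤ s.clk + 150 * k + 20) 0 (b / 2 ^ h + 1) (by omega) (by omega) ?_ ?_ ?_ ?_
  · rintro k s1 ⟨h1, h2, h3, h4, -⟩
    exact ⟨h1, by simp [h4], trivial⟩
  · simp [hj, hh, hsp]
    refine ⟨by funext i j l; simp, ?_⟩
    rw [mx_eq_zero]; simp
  · rintro k s1 - hk ⟨h1, h2, h3, h4, h5, h6, h7⟩
    have hkb : k < bd := by omega
    have hkb' : k + 1 < bd := by omega
    have e1 : s1.a .tree j h k = mx f n (fun i => g i < j ∧ z i / 2 ^ h = k) := by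
      rw [h5]; exact hT h le_rfl k (by omega)
    have e2 := h6 k le_rfl
    have e3 : mx f n (fun i => g i < j ∧ z i / 2 ^ h < k + 1) =
        max (mx f n (fun i => g i < j ∧ z i / 2 ^ h < k))
          (mx f n (fun i => g i < j ∧ z i / 2 ^ h = k)) := by
      apply mx_or; intro i _
      constructor
      · rintro ⟨h1, h2⟩
        rcases Nat.lt_succ_iff_lt_or_eq.mp h2 with h | h
        · exact Or.inl ⟨h1, h⟩
        · exact Or.inr ⟨h1, h⟩
      · rintro (⟨h1, h2⟩ | ⟨h1, h2⟩)
        · exact ⟨h1, by omega⟩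
        · exact ⟨h1, by omega⟩
    have hstep : ∀ c ≤ k + 1, (if c = k + 1 then mx f n (fun i => g i < j ∧ z i / 2 ^ h < k + 1)
        else s1.a .pre c 0 0) = mx f n (fun i => g i < j ∧ z i / 2 ^ h < c) := by
      intro c hc
      split_ifs with hck
      · rw [hck]
      · exact h6 c (by omega)
    refine Cmd.wp_ite (by simp [h1, h2, h3, hkb, b0, hjb, hhb]) (fun ht => ?_) (fun ht => ?_)
    · simp [h1, h2, h3, e1, e2] at ht
      simp [h1, h2, h3, h4, b0, b1, hkb, hkb', hjb, hhb]
      refine ⟨by funext i j l; simp [h5], fun c hc => ?_, by omega⟩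
      rw [e1, ← hstep c hc, e3, max_eq_right ht.le]
    · simp [h1, h2, h3, e1, e2] at ht
      simp [h1, h2, h3, h4, b0, b1, hkb, hkb', hjb, hhb]
      refine ⟨by funext i j l; simp [h5], fun c hc => ?_, by omega⟩
      rw [e2, ← hstep c hc, e3, max_eq_left ht]
  · rintro s1 ⟨h1, h2, h3, h4, h5, h6, h7⟩
    exact ⟨by simpa using h6, by simp; omega⟩

/-- The tree and the prefix maxima represent the records `i < n` with groups `g i`, places `z i` and
values `f i`. -/
structure Look (h b j n : ℕ) (f z g : ℕ → ℕ) (s : St) : Prop where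
  eq_j : s.v .j = j
  eq_h : s.v .h = h
  tree : ∀ l ≤ h, ∀ c ≤ b, s.a .tree j l c = mx f n (fun i => g i < j ∧ z i / 2 ^ l = c)
  pre : ∀ c ≤ b / 2 ^ h + 1, s.a .pre c 0 0 = mx f n (fun i => g i < j ∧ z i / 2 ^ h < c)

/-- The greatest value of a record of a smaller group at a place before `z`. -/
def query : Cmd :=
  Var.res ≔ 0 ;; Var.node ≔ Var.z ;; Var.l ≔ 0 ;; .upto .l Var.h
    (.ite (.lt (2 * (Var.node / 2)) Var.node)
      (.ite (.lt Var.res (Expr.ld .tree Var.j Var.l (Var.node - 1)))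
        (Var.res ≔ Expr.ld .tree Var.j Var.l (Var.node - 1)) .skip) .skip ;;
    Var.node ≔ Var.node / 2) ;;
  .ite (.lt Var.res (Expr.ld .pre Var.node 0 0)) (Var.res ≔ Expr.ld .pre Var.node 0 0) .skip

/-- Climb from the leaf `ζ` to level `h`. What remains to be added at level `k` is the maximum over
the nodes left of the current one, and at the top this is a prefix maximum. -/
theorem query_spec {s : St} {h b j n ζ : ℕ} {f z g : ℕ → ℕ} (hs : Look h b j n f z g s)
    (hz : s.v .z = ζ) (hzb : ζ ≤ b) (hjb : j < bd) (hhb : h + 2 < bd) (hbb : 2 * b + 2 < bd)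
    (hbd : 10 < bd) :
    query.wp bd len (fun s' => s'.v .res = mx f n (fun i => g i < j ∧ z i < ζ) ∧
      s'.clk ≤ s.clk + 200 * (h + 1)) s := by
  have b0 : 0 < bd := by omega
  have b1 : 1 < bd := by omega
  have b2 : 2 < bd := by omega
  have hzbd : ζ < bd := by omega
  simp [query, b0]
  refine Cmd.wp_conseq (R := fun s' => s'.v .node = ζ / 2 ^ h ∧
    mx f n (fun i => g i < j ∧ z i < ζ) =
      max (s'.v .res) (mx f n (fun i => g i < j ∧ z i / 2 ^ h < ζ / 2 ^ h)) ∧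
    s'.clk ≤ s.clk + 150 * h + 60)
    (Cmd.wp_upto (fun k s' => s'.v .l = k ∧ s'.v .h = h ∧ s'.v .j = j ∧ s'.a .tree = s.a .tree ∧
      s'.v .node = ζ / 2 ^ k ∧
      mx f n (fun i => g i < j ∧ z i < ζ) =
        max (s'.v .res) (mx f n (fun i => g i < j ∧ z i / 2 ^ k < ζ / 2 ^ k)) ∧
      s'.clk ≤ s.clk + 150 * k + 20) 0 h (by omega) (by omega) ?_ ?_ ?_ ?_) ?_
  · rintro k s1 ⟨h1, h2, h3, -⟩
    exact ⟨h1, by simp [h2], trivial⟩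
  · simp [hs.eq_j, hs.eq_h, hz]
  · rintro k s1 - hk ⟨h1, h2, h3, h4, h5, h6, h7⟩
    have hkb : k < bd := by omega
    have hq : ζ / 2 ^ k ≤ b := (Nat.div_le_self _ _).trans hzb
    set q := ζ / 2 ^ k with hq'
    have hdiv : ∀ m, m / 2 ^ (k + 1) = m / 2 ^ k / 2 := fun m => by
      rw [pow_succ, Nat.div_div_eq_div_mul]
    have hqb : q < bd := by omega
    have hqb2 : 2 * (q / 2) < bd := by omega
    have hqb3 : q - 1 < bd := by omega
    refine Cmd.wp_seq (R := fun s' => mx f n (fun i => g i < j ∧ z i < ζ) =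
        max (s'.v .res) (mx f n (fun i => g i < j ∧ z i / 2 ^ (k + 1) < ζ / 2 ^ (k + 1))) ∧
      s'.clk ≤ s1.clk + 120) ?_ ?_
    · refine Cmd.wp_ite (by simp [b2, h5, hqb2]) (fun ht => ?_) (fun ht => ?_)
      · simp [h5] at ht
        have e1 : s1.a .tree j k (q - 1) = mx f n (fun i => g i < j ∧ z i / 2 ^ k = q - 1) := by
          rw [h4]; exact hs.tree k hk.le _ (by omega)
        -- For odd `q` the nodes left of `q` are the left sibling `q - 1` and the descendants of the
        -- nodes left of `q / 2`; for even `q` the sibling is on the other side and nothing is lost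
        -- by climbing.
        have e2 : mx f n (fun i => g i < j ∧ z i / 2 ^ k < q) =
            max (mx f n (fun i => g i < j ∧ z i / 2 ^ k = q - 1))
              (mx f n (fun i => g i < j ∧ z i / 2 ^ (k + 1) < ζ / 2 ^ (k + 1))) := by
          apply mx_or; intro i _
          rw [hdiv, hdiv, ← hq']
          constructor
          · rintro ⟨h1, h2⟩
            by_cases h : z i / 2 ^ k = q - 1
            · exact Or.inl ⟨h1, h⟩
            · exact Or.inr ⟨h1, by omega⟩
          · rintro (⟨h1, h2⟩ | ⟨h1, h2⟩)
            · exact ⟨h1, by omega⟩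
            · exact ⟨h1, by omega⟩
        rw [e2, ← max_assoc] at h6
        refine Cmd.wp_ite (by simp [b1, h1, h3, h5, hkb, hjb, hqb3]) (fun ht' => ?_) (fun ht' => ?_)
        · simp [h1, h3, h5, e1] at ht'
          rw [max_eq_right ht'.le] at h6
          simp [b1, h1, h3, h5, hkb, hjb, hqb3, e1, h6]
        · simp [h1, h3, h5, e1] at ht'
          rw [max_eq_left ht'] at h6
          simp [h6]
      · simp [h5] at ht
        simp only [Cmd.wp_skip, St.tick_v]
        refine ⟨?_, by simp⟩
        rw [h6]
        congr 1
        apply mx_congr (fun _ _ _ => rfl)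
        intro i _
        rw [hdiv, hdiv, ← hq']
        constructor
        · rintro ⟨h1, h2⟩; exact ⟨h1, by omega⟩
        · rintro ⟨h1, h2⟩; exact ⟨h1, by omega⟩
    · rintro s2 ⟨g1, g2⟩ hs2
      have hv := hs2.v
      simp [hv .node rfl, hv .l rfl, hv .h rfl, hv .j rfl, hs2.a .tree rfl, h1, h2, h3, h4, h5, b2]
      exact ⟨(hdiv ζ).symm, g1, by omega⟩
  · rintro s1 ⟨h1, h2, h3, h4, h5, h6, h7⟩
    exact ⟨by simp [h5], by simpa using h6, by simp; omega⟩
  · rintro s1 ⟨h1, h2, h3⟩ hs1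
    have hq : ζ / 2 ^ h ≤ b / 2 ^ h := Nat.div_le_div_right hzb
    have hq2 : ζ / 2 ^ h < bd := by have := Nat.div_le_self b (2 ^ h); omega
    have e : s1.a .pre (ζ / 2 ^ h) 0 0 = mx f n (fun i => g i < j ∧ z i / 2 ^ h < ζ / 2 ^ h) := by
      rw [hs1.a .pre rfl]; exact hs.pre _ (by omega)
    refine Cmd.wp_ite (by simp [h1, hq2, b0]) (fun ht => ?_) (fun ht => ?_)
    · simp [h1, e] at ht
      simp [h1, hq2, b0, e, h2]
      omega
    · simp [h1, e] at ht
      simp [h2]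
      omega

end Imp


/-! ## Records of significant pairs -/

namespace LCIS

theorem IsSignificant.val_lt {A B : List ℤ} {x y x' y' : ℕ} (h : IsSignificant A B (x, y))
    (h' : Mt A B x' y') (hx : x' ≤ x) (hy : y' ≤ y) (hne : ¬ (x' = x ∧ y' = y))
    (hs : sym B y' = sym B y) : val A B x' y' < val A B x y := by
  obtain ⟨σ, h1, h2⟩ := h
  obtain ⟨h3, h4⟩ := isSigmaPair_iff.mp h1
  refine h2 (x', y') (isSigmaPair_iff.mpr ⟨h', hs.trans h4⟩) ⟨hx, hy⟩ ?_
  rintro he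
  exact hne ⟨congrArg Prod.fst he, congrArg Prod.snd he⟩

end LCIS

namespace Imp

open LCIS

variable {A B : List ℤ} {bd len : ℕ} {R : Par}

/-- After a sentinel, the records are those of the significant pairs in `D`, ordered by their rows.
The array `d` holds the greatest recorded value of each column. -/
structure Recs (A B : List ℤ) (R : Par) (D : ℕ → ℕ → Prop) (s : St) : Prop where
  cnt_pos : 1 ≤ s.v .cnt
  rz_zero : s.a .rz 0 0 0 = 0
  ru_zero : s.a .ru 0 0 0 = 1
  rg_zero : s.a .rg 0 0 0 = 0
  sound : ∀ i, 1 ≤ i → i < s.v .cnt → ∃ y, s.a .rz i 0 0 = y + 1 ∧ D (s.a .rx i 0 0) y ∧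
    IsSignificant A B (s.a .rx i 0 0, y) ∧ s.a .ru i 0 0 = val A B (s.a .rx i 0 0) y + 1 ∧
    s.a .rg i 0 0 = R.grp B (sym B y)
  complete : ∀ x y, D x y → IsSignificant A B (x, y) →
    ∃ i, 1 ≤ i ∧ i < s.v .cnt ∧ s.a .rx i 0 0 = x ∧ s.a .rz i 0 0 = y + 1
  inj : ∀ i i', 1 ≤ i → i < i' → i' < s.v .cnt →
    ¬ (s.a .rx i 0 0 = s.a .rx i' 0 0 ∧ s.a .rz i 0 0 = s.a .rz i' 0 0)
  sorted : ∀ i i', 1 ≤ i → i < i' → i' < s.v .cnt → s.a .rx i 0 0 ≤ s.a .rx i' 0 0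
  le_d : ∀ x y, D x y → IsSignificant A B (x, y) → val A B x y ≤ s.a .d y 0 0
  d_eq : ∀ y < B.length, s.a .d y 0 0 = 0 ∨
    ∃ x, D x y ∧ IsSignificant A B (x, y) ∧ val A B x y = s.a .d y 0 0

namespace Recs

variable {D D' : ℕ → ℕ → Prop} {s s' : St}

theorem congr (h : Recs A B R D s) (hD : ∀ x y, IsSignificant A B (x, y) → (D x y ↔ D' x y)) :
    Recs A B R D' s := by
  refine ⟨h.cnt_pos, h.rz_zero, h.ru_zero, h.rg_zero, fun i h1 h2 => ?_, fun x y h1 h2 => ?_, h.inj,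
    h.sorted, fun x y h1 h2 => h.le_d x y ((hD x y h2).mpr h1) h2, fun y hy => ?_⟩
  · obtain ⟨y, h3, h4, h5, h6⟩ := h.sound i h1 h2
    exact ⟨y, h3, (hD _ _ h5).mp h4, h5, h6⟩
  · exact h.complete x y ((hD x y h2).mpr h1) h2
  · rcases h.d_eq y hy with h1 | ⟨x, h1, h2, h3⟩
    · exact Or.inl h1
    · exact Or.inr ⟨x, (hD _ _ h2).mp h1, h2, h3⟩

theorem same (h : Recs A B R D s) (hc : s'.v .cnt = s.v .cnt) (hz : s'.a .rz = s.a .rz)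
    (hu : s'.a .ru = s.a .ru) (hg : s'.a .rg = s.a .rg) (hx : s'.a .rx = s.a .rx)
    (hd : s'.a .d = s.a .d) : Recs A B R D s' := by
  obtain ⟨h1, h2, h3, h4, h5, h6, h7, h8, h9, h10⟩ := h
  constructor <;> simpa only [hc, hz, hu, hg, hx, hd]

/-- The number of records is that of the significant pairs in `D`. -/
theorem cnt_eq (h : Recs A B R D s) [DecidablePred fun p : ℕ × ℕ => IsSignificant A B p ∧ D p.1 p.2] :
    s.v .cnt = ((Finset.range A.length ×ˢ Finset.range B.length).filter
      (fun p => IsSignificant A B p ∧ D p.1 p.2)).card + 1 := by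
  have : (Finset.Ico 1 (s.v .cnt)).card = ((Finset.range A.length ×ˢ Finset.range B.length).filter
      (fun p => IsSignificant A B p ∧ D p.1 p.2)).card := by
    apply Finset.card_bij (fun i _ => (s.a .rx i 0 0, s.a .rz i 0 0 - 1))
    · intro i hi
      rw [Finset.mem_Ico] at hi
      obtain ⟨y, h1, h2, h3, -⟩ := h.sound i hi.1 hi.2
      have := h3.mt
      simp [h1, h2, h3, this.1, this.2.1]
    · intro i hi i' hi' he
      rw [Finset.mem_Ico] at hi hi'
      obtain ⟨y, h1, -⟩ := h.sound i hi.1 hi.2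
      obtain ⟨y', h2, -⟩ := h.sound i' hi'.1 hi'.2
      simp only [Prod.mk.injEq, h1, h2] at he
      rcases lt_trichotomy i i' with hlt | rfl | hlt
      · exact absurd ⟨he.1, by omega⟩ (h.inj i i' hi.1 hlt hi'.2)
      · rfl
      · exact absurd ⟨he.1.symm, by omega⟩ (h.inj i' i hi'.1 hlt hi.2)
    · rintro ⟨x, y⟩ hp
      simp only [Finset.mem_filter] at hp
      obtain ⟨i, h1, h2, h3, h4⟩ := h.complete x y hp.2.2 hp.2.1
      exact ⟨i, by rw [Finset.mem_Ico]; exact ⟨h1, h2⟩, by simp [h3, h4]⟩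
  rw [← this, Nat.card_Ico]
  have := h.cnt_pos
  omega

theorem cnt_le (h : Recs A B R D s) : s.v .cnt ≤ A.length * B.length + 1 := by
  classical
  rw [h.cnt_eq]
  have := Finset.card_filter_le (Finset.range A.length ×ˢ Finset.range B.length)
    (fun p => IsSignificant A B p ∧ D p.1 p.2)
  rw [Finset.card_product, Finset.card_range, Finset.card_range] at this
  omega

theorem cnt_le_numSignificant (h : Recs A B R D s) : s.v .cnt ≤ numSignificant A B + 1 := by
  classical
  rw [h.cnt_eq]
  unfold numSignificant
  gcongr
  exact And.left

/-- A row has at most `|B|` pairs. A run that tests the limit once per row therefore exceeds it only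
slightly. -/
theorem cnt_succ_le {x : ℕ} (h : Recs A B R (fun X _ => X < x) s)
    (h' : Recs A B R (fun X _ => X < x + 1) s') : s'.v .cnt ≤ s.v .cnt + B.length := by
  classical
  rw [h.cnt_eq, h'.cnt_eq]
  have hsub : (Finset.range A.length ×ˢ Finset.range B.length).filter
      (fun p => IsSignificant A B p ∧ p.1 < x + 1) ⊆
      (Finset.range A.length ×ˢ Finset.range B.length).filter
      (fun p => IsSignificant A B p ∧ p.1 < x) ∪ ({x} : Finset ℕ) ×ˢ Finset.range B.length := by
    rintro ⟨X, Y⟩ hp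
    simp only [Finset.mem_filter, Finset.mem_union, Finset.mem_product, Finset.mem_singleton,
      Finset.mem_range] at hp ⊢
    rcases Nat.lt_succ_iff_lt_or_eq.mp hp.2.2 with h1 | h1
    · exact Or.inl ⟨hp.1, hp.2.1, h1⟩
    · exact Or.inr ⟨h1, hp.1.2⟩
  have h1 := Finset.card_le_card hsub
  have h2 := Finset.card_union_le ((Finset.range A.length ×ˢ Finset.range B.length).filter
      (fun p => IsSignificant A B p ∧ p.1 < x)) (({x} : Finset ℕ) ×ˢ Finset.range B.length)
  rw [Finset.card_product, Finset.card_singleton, Finset.card_range] at h2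
  omega

theorem rz_le (h : Recs A B R D s) {i : ℕ} (hi : i < s.v .cnt) : s.a .rz i 0 0 ≤ B.length := by
  rcases Nat.eq_zero_or_pos i with rfl | h0
  · rw [h.rz_zero]; omega
  · obtain ⟨y, h1, -, h2, -⟩ := h.sound i h0 hi
    have := h2.mt.2.1
    omega

/-- A record is worth at most the value of any later pair of a larger group. -/
theorem ru_le {x y i : ℕ} (h : Recs A B R (fun X _ => X < x) s) (hm : Mt A B x y)
    (hi : i < s.v .cnt) (hg : s.a .rg i 0 0 < R.grp B (sym B y)) (hz : s.a .rz i 0 0 < y + 1) :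
    s.a .ru i 0 0 ≤ val A B x y := by
  rcases Nat.eq_zero_or_pos i with rfl | h0
  · rw [h.ru_zero]; exact val_pos hm
  · obtain ⟨y', h1, h2, h3, h4, h5⟩ := h.sound i h0 hi
    rw [h4]
    exact LCIS.val_lt hm h3.mt h2 (by omega) (Par.lt_of_grp_lt (R := R) (B := B) (by omega))

theorem mx_le_val {x y : ℕ} (h : Recs A B R (fun X _ => X < x) s) (hm : Mt A B x y) :
    mx (fun i => s.a .ru i 0 0) (s.v .cnt)
      (fun i => s.a .rg i 0 0 < R.grp B (sym B y) ∧ s.a .rz i 0 0 < y + 1) ≤ val A B x y :=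
  mx_le fun _ hi hp => h.ru_le hm hi hp.1 hp.2

/-- An optimal significant predecessor lies either in a smaller group, where its record enters the
maximum, or in the same group, where `c` takes care of it. -/
theorem val_le_mx {x y c : ℕ} (h : Recs A B R (fun X _ => X < x) s) (hm : Mt A B x y)
    (hc : ∀ y' < y, R.grp B (sym B y') = R.grp B (sym B y) → sym B y' < sym B y →
      ∀ x' < x, IsSignificant A B (x', y') → val A B x' y' + 1 ≤ c) :
    val A B x y ≤ max (mx (fun i => s.a .ru i 0 0) (s.v .cnt)
      (fun i => s.a .rg i 0 0 < R.grp B (sym B y) ∧ s.a .rz i 0 0 < y + 1)) c := by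
  rcases val_eq hm with h1 | ⟨x', y', h1, h2, h3, h4, h5⟩
  -- The value `1` is supplied by the sentinel: its place and group are `0`, so every query sees it,
  -- and its worth is `1`.
  · rw [h1]
    apply le_max_of_le_left
    have := le_mx (f := fun i => s.a .ru i 0 0) (n := s.v .cnt)
      (P := fun i => s.a .rg i 0 0 < R.grp B (sym B y) ∧ s.a .rz i 0 0 < y + 1) h.cnt_pos
      (by simp only [h.rg_zero, h.rz_zero]; exact ⟨Par.grp_pos _, by omega⟩)
    simpa only [h.ru_zero] using this
  · rcases (Par.grp_mono (R := R) (B := B) h4.le).lt_or_eq with h6 | h6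
    · apply le_max_of_le_left
      obtain ⟨i, i1, i2, i3, i4⟩ := h.complete x' y' h2 h1
      obtain ⟨y'', j1, j2, j3, j4, j5⟩ := h.sound i i1 i2
      obtain rfl : y'' = y' := by omega
      have := le_mx (f := fun i => s.a .ru i 0 0) (n := s.v .cnt)
        (P := fun i => s.a .rg i 0 0 < R.grp B (sym B y) ∧ s.a .rz i 0 0 < y + 1) i2
        (by simp only [j5, j1]; exact ⟨h6, by omega⟩)
      rw [h5, ← i3, ← j4]; exact this
    · apply le_max_of_le_right
      rw [h5]
      exact hc y' h3 h6 h4 x' h2 h1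

end Recs

/-- No records are lost or changed. -/
structure Keep (s s' : St) : Prop where
  cnt_le : s.v .cnt ≤ s'.v .cnt
  eq : ∀ k, k = .rz ∨ k = .rg ∨ k = .ru ∨ k = .rx → ∀ i < s.v .cnt, ∀ j l, s'.a k i j l = s.a k i j l

theorem Keep.trans {s s' s'' : St} (h : Keep s s') (h' : Keep s' s'') : Keep s s'' :=
  ⟨h.cnt_le.trans h'.cnt_le, fun k hk i hi j l => by
    rw [h'.eq k hk i (hi.trans_le h.cnt_le), h.eq k hk i hi]⟩

theorem Keep.of_eq {s s' : St} (hc : s'.v .cnt = s.v .cnt)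
    (ha : ∀ k, k = .rz ∨ k = .rg ∨ k = .ru ∨ k = .rx → s'.a k = s.a k) : Keep s s' :=
  ⟨hc.ge, fun k hk _ _ _ _ => by rw [ha k hk]⟩

/-- Record the pair `(x, y)` of the group `j`, with the value `u`. -/
def append : Cmd :=
  .store .rz Var.cnt 0 0 (Var.y + 1) ;; .store .ru Var.cnt 0 0 (Var.u + 1) ;;
  .store .rg Var.cnt 0 0 Var.j ;; .store .rx Var.cnt 0 0 Var.x ;; .store .d Var.y 0 0 Var.u ;;
  Var.cnt ≔ Var.cnt + 1

theorem append_spec {s : St} {D : ℕ → ℕ → Prop} {x y : ℕ} (h : Recs A B R D s) (hx : s.v .x = x)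
    (hy : s.v .y = y) (hu : s.v .u = val A B x y) (hj : s.v .j = R.grp B (sym B y))
    (hsig : IsSignificant A B (x, y)) (hd : s.a .d y 0 0 < val A B x y)
    (hD : ∀ X Y, D X Y → X ≤ x) (hcb : s.v .cnt + 1 < bd) (hyb : y + 1 < bd)
    (hub : val A B x y + 1 < bd) :
    append.wp bd len (fun s' => Recs A B R (fun X Y => D X Y ∨ (X = x ∧ Y = y)) s' ∧
      Keep s s' ∧ s'.clk ≤ s.clk + 150) s := by
  have b0 : 0 < bd := by omega
  have b1 : 1 < bd := by omega
  have hcb' : s.v .cnt < bd := by omega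
  have hyb' : y < bd := by omega
  have hc := h.cnt_pos
  have hc0 : 0 ≠ s.v .cnt := by omega
  simp [append, hx, hy, hu, hj, b0, b1, hcb, hcb', hyb, hyb', hub]
  refine ⟨⟨?_, ?_, ?_, ?_, ?_, ?_, ?_, ?_, ?_, ?_⟩, ?_⟩
  · simp
  · simp [hc0, h.rz_zero]
  · simp [hc0, h.ru_zero]
  · simp [hc0, h.rg_zero]
  · intro i h1 h2
    simp at h2 ⊢
    by_cases hi : i = s.v .cnt
    · simp only [hi, if_true]
      exact ⟨y, by simp, by simp, by simpa using hsig, by simp, by simp⟩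
    · simp only [hi, if_false]
      obtain ⟨y', h3, h4, h5⟩ := h.sound i h1 (by omega)
      exact ⟨y', h3, Or.inl h4, h5⟩
  · rintro X Y (h1 | ⟨rfl, rfl⟩) h2
    · obtain ⟨i, h3, h4, h5, h6⟩ := h.complete X Y h1 h2
      refine ⟨i, h3, by simp; omega, ?_⟩
      simp [h4.ne, h5, h6]
    · refine ⟨s.v .cnt, hc, by simp, by simp⟩
  · intro i i' h1 h2 h3
    simp at h3 ⊢
    have hi : i ≠ s.v .cnt := by omega
    simp only [hi, if_false]
    split_ifs with hi'
    -- The new pair cannot have been recorded before: the entry of `d` for its column would be at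
    -- least its value, against `hd`.
    · intro h4 h5
      obtain ⟨Y, h6, h7, h8, h9, h10⟩ := h.sound i h1 (by omega)
      obtain rfl : Y = y := by omega
      have := h.le_d _ _ h7 h8
      rw [h4] at this
      omega
    · intro h4 h5
      exact h.inj i i' h1 h2 (by omega) ⟨h4, h5⟩
  · intro i i' h1 h2 h3
    simp at h3 ⊢
    have hi : i ≠ s.v .cnt := by omega
    simp only [hi, if_false]
    split_ifs with hi'
    · obtain ⟨Y, h6, h7, -⟩ := h.sound i h1 (by omega)
      exact hD _ _ h7
    · exact h.sorted i i' h1 h2 (by omega)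
  · rintro X Y (h1 | ⟨rfl, rfl⟩) h2
    · have := h.le_d X Y h1 h2
      simp
      split_ifs with hc
      · subst hc; omega
      · exact this
    · simp
  · intro Y hY
    simp
    split_ifs with hc
    · subst hc; exact Or.inr ⟨x, Or.inr ⟨rfl, rfl⟩, hsig, rfl⟩
    · rcases h.d_eq Y hY with h1 | ⟨X, h1, h2⟩
      · exact Or.inl h1
      · exact Or.inr ⟨X, Or.inl h1, h2⟩
  · refine ⟨by simp, ?_⟩
    rintro k (rfl | rfl | rfl | rfl) i hi j l <;> simp [hi.ne]

end Imp


/-! ## Finding the significant pairs of a row -/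

namespace Imp

open LCIS

variable {A B : List ℤ} {bd len : ℕ} {R : Par}

theorem Env.congr {s s' : St} (h : Env A B R s)
    (hv : ∀ x, x = .a ∨ x = .b ∨ x = .h ∨ x = .p ∨ x = .np ∨ x = .m → s'.v x = s.v x)
    (ha : ∀ k, k = .pv ∨ k = .nxt → s'.a k = s.a k) (hi : s'.inp = s.inp) : Env A B R s' :=
  ⟨h.base.congr (hv _ (by simp)) (hv _ (by simp)) hi, (hv _ (by simp)).trans h.eq_h,
    (hv _ (by simp)).trans h.eq_p, (hv _ (by simp)).trans h.eq_np, (hv _ (by simp)).trans h.eq_m,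
    fun i hi => by rw [ha _ (by simp)]; exact h.pv i hi, h.pv_lt,
    fun j hj z hz => by rw [ha _ (by simp)]; exact h.nxt j hj z hz⟩

theorem Look.congr {s s' : St} {h b j n : ℕ} {f z g : ℕ → ℕ} (hl : Look h b j n f z g s)
    (hj : s'.v .j = s.v .j) (hh : s'.v .h = s.v .h) (ht : s'.a .tree = s.a .tree)
    (hp : s'.a .pre = s.a .pre) : Look h b j n f z g s' :=
  ⟨hj.trans hl.eq_j, hh.trans hl.eq_h, by rw [ht]; exact hl.tree, by rw [hp]; exact hl.pre⟩

theorem IsNext.unique {j z y y' : ℕ} (h : IsNext R B j z y) (h' : IsNext R B j z y') : y = y' := by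
  rcases lt_trichotomy y y' with h1 | h1 | h1
  · exact absurd (h.grp_eq (h1.trans_le h'.le_length)) (h'.grp_ne y h.le h1)
  · exact h1
  · exact absurd (h'.grp_eq (h1.trans_le h.le_length)) (h.grp_ne y' h'.le h1)

/-- Record the pair `(x, y)` if its value, the maximum of `cur` and the answer to a query, makes it
significant. -/
def recordPair : Cmd :=
  Var.z ≔ Var.y + 1 ;; query ;; Var.u ≔ Var.res ;; .ite (.lt Var.u Var.cur) (Var.u ≔ Var.cur) .skip ;;
  .ite (.lt Var.last Var.u) (.ite (.lt (Expr.ld .d Var.y 0 0) Var.u) append .skip) .skip ;;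
  Var.last ≔ Var.u

/-- Process column `y` of the group of the current row. -/
def scanStep : Cmd :=
  Var.z ≔ Var.a + Var.y ;;
  .ite (.ilt Var.z Var.x)
    (.ite (.lt Var.cur (Expr.ld .d Var.y 0 0 + 1)) (Var.cur ≔ Expr.ld .d Var.y 0 0 + 1) .skip)
    (.ite (.ilt Var.x Var.z) .skip recordPair)

/-- The columns below `y` of the group `j` have been scanned for row `x`. -/
structure ScanInv (A B : List ℤ) (R : Par) (x j y : ℕ) (s : St) : Prop where
  recs : Recs A B R (fun X Y => X < x ∨ (X = x ∧ Y < y)) s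
  le_cur : ∀ y' < y, R.grp B (sym B y') = j → sym B y' < sym A x →
    ∀ x' < x, IsSignificant A B (x', y') → val A B x' y' + 1 ≤ s.v .cur
  cur_le : ∀ y', y ≤ y' → Mt A B x y' → s.v .cur ≤ val A B x y'
  le_last : ∀ y' < y, Mt A B x y' → val A B x y' ≤ s.v .last
  last_eq : s.v .last = 0 ∨ ∃ y' < y, Mt A B x y' ∧ s.v .last = val A B x y'

namespace ScanInv

variable {x j y : ℕ} {s s' : St}

/-- Columns of other groups contain neither pairs of row `x` nor predecessors inside the group, so
the scan may jump to the next column of the group. -/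
theorem skip {y' : ℕ} (h : ScanInv A B R x (R.grp B (sym A x)) y s) (hy : y ≤ y')
    (hne : ∀ Y, y ≤ Y → Y < y' → R.grp B (sym B Y) ≠ R.grp B (sym A x)) :
    ScanInv A B R x (R.grp B (sym A x)) y' s := by
  have hmt : ∀ Y, Mt A B x Y → Y < y' → Y < y := fun Y h1 h2 => by
    by_contra hcon
    exact hne Y (not_lt.mp hcon) h2 (by rw [h1.2.2])
  refine ⟨h.recs.congr fun X Y hs => ?_, fun Y h1 h2 h3 => ?_, fun Y h1 h2 => h.cur_le Y (by omega) h2,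
    fun Y h1 h2 => h.le_last Y (hmt Y h2 h1) h2, ?_⟩
  · constructor
    · rintro (h1 | ⟨h1, h2⟩)
      · exact Or.inl h1
      · exact Or.inr ⟨h1, by omega⟩
    · rintro (h1 | ⟨rfl, h2⟩)
      · exact Or.inl h1
      · exact Or.inr ⟨rfl, hmt Y hs.mt h2⟩
  · refine h.le_cur Y ?_ h2 h3
    by_contra hcon
    exact hne Y (not_lt.mp hcon) h1 h2
  · rcases h.last_eq with h1 | ⟨Y, h1, h2⟩
    · exact Or.inl h1
    · exact Or.inr ⟨Y, by omega, h2⟩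

theorem same (h : ScanInv A B R x j y s) (hv : ∀ v, v = .cur ∨ v = .last ∨ v = .cnt → s'.v v = s.v v)
    (ha : s'.a = s.a) : ScanInv A B R x j y s' := by
  have h1 := hv .cur (by simp)
  have h2 := hv .last (by simp)
  have h3 := hv .cnt (by simp)
  refine ⟨h.recs.same h3 ?_ ?_ ?_ ?_ ?_, ?_, ?_, ?_, ?_⟩
  iterate 5 rw [ha]
  · rw [h1]; exact h.le_cur
  · rw [h1]; exact h.cur_le
  · rw [h2]; exact h.le_last
  · rw [h2]; exact h.last_eq

theorem d_le (h : ScanInv A B R x j y s) (hy : y < B.length) :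
    s.a .d y 0 0 ≤ B.length := by
  rcases h.recs.d_eq y hy with h1 | ⟨X, h1, h2, h3⟩
  · omega
  · rw [← h3]; exact (LCIS.val_le h2.mt).2

/-- Columns with another symbol only affect the running maximum. -/
theorem other (h : ScanInv A B R x j y s) (hne : sym B y ≠ sym A x) (hy : y < B.length)
    (hcnt : s'.v .cnt = s.v .cnt) (hlast : s'.v .last = s.v .last) (ha : s'.a = s.a)
    (hcur : sym B y < sym A x → s'.v .cur = max (s.v .cur) (s.a .d y 0 0 + 1))
    (hcur' : ¬ sym B y < sym A x → s'.v .cur = s.v .cur) : ScanInv A B R x j (y + 1) s' := by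
  have hr : Recs A B R (fun X Y => X < x ∨ (X = x ∧ Y < y)) s' :=
    h.recs.same hcnt (by rw [ha]) (by rw [ha]) (by rw [ha]) (by rw [ha]) (by rw [ha])
  have hmy : ¬ Mt A B x y := fun hm => hne hm.2.2.symm
  have hmono : s.v .cur ≤ s'.v .cur := by
    by_cases hlt : sym B y < sym A x
    · rw [hcur hlt]; exact le_max_left _ _
    · rw [hcur' hlt]
  refine ⟨hr.congr fun X Y hs => ?_, fun Y h1 h2 h3 X h4 h5 => ?_, fun Y h1 h2 => ?_,
    fun Y h1 h2 => ?_, ?_⟩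
  · constructor
    · rintro (h1 | ⟨h1, h2⟩)
      · exact Or.inl h1
      · exact Or.inr ⟨h1, by omega⟩
    · rintro (h1 | ⟨rfl, h2⟩)
      · exact Or.inl h1
      · rcases Nat.lt_succ_iff_lt_or_eq.mp h2 with h3 | rfl
        · exact Or.inr ⟨rfl, h3⟩
        · exact absurd hs.mt hmy
  · rcases Nat.lt_succ_iff_lt_or_eq.mp h1 with h6 | rfl
    · exact (h.le_cur Y h6 h2 h3 X h4 h5).trans hmono
    · rw [hcur h3]
      apply le_max_of_le_right
      have := h.recs.le_d X Y (Or.inl h4) h5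
      omega
  · by_cases hlt : sym B y < sym A x
    · rw [hcur hlt]
      refine max_le (h.cur_le Y (by omega) h2) ?_
      rcases h.recs.d_eq y hy with h3 | ⟨X, h3, h4, h5⟩
      -- If nothing is recorded in the column, the running maximum becomes at least `1`, which no
      -- value falls short of.
      · rw [h3]; exact val_pos h2
      · rw [← h5]
        refine LCIS.val_lt h2 h4.mt ?_ (by omega) (by rw [← h2.2.2]; exact hlt)
        rcases h3 with h3 | h3
        · exact h3
        · omega
    · rw [hcur' hlt]; exact h.cur_le Y (by omega) h2
  · rw [hlast]
    rcases Nat.lt_succ_iff_lt_or_eq.mp h1 with h6 | rfl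
    · exact h.le_last Y h6 h2
    · exact absurd h2 hmy
  · rw [hlast]
    rcases h.last_eq with h1 | ⟨Y, h1, h2⟩
    · exact Or.inl h1
    · exact Or.inr ⟨Y, by omega, h2⟩

end ScanInv

/-- The two tests are the two halves of `isSignificant_iff`: `last` is the greatest value so far in
the row, values being monotone there, and `d` the greatest recorded value of the column. -/
theorem recordPair_spec {s : St} {h x j y n : ℕ} {f z g : ℕ → ℕ}
    (hlook : Look h B.length j n f z g s) (hx : s.v .x = x) (hy : s.v .y = y) (hm : Mt A B x y)
    (hj : j = R.grp B (sym B y)) (hs : ScanInv A B R x j y s)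
    (hQ1 : mx f n (fun i => g i < j ∧ z i < y + 1) ≤ val A B x y)
    (hQ2 : val A B x y ≤ max (mx f n (fun i => g i < j ∧ z i < y + 1)) (s.v .cur))
    (hjb : j < bd) (hhb : h + 2 < bd) (hbl : 4 * (A.length + B.length) + 20 < bd)
    (hcb : s.v .cnt + 1 < bd) :
    recordPair.wp bd len (fun s' => ScanInv A B R x j (y + 1) s' ∧ Keep s s' ∧
      s'.clk ≤ s.clk + 600 * (h + 1)) s := by
  have b0 : 0 < bd := by omega
  have b1 : 1 < bd := by omega
  have hyB : y < B.length := hm.2.1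
  have hyb : y < bd := by omega
  have hyb' : y + 1 < bd := by omega
  have hvp := val_pos hm
  have hvl := (LCIS.val_le hm).2
  generalize hq : mx f n (fun i => g i < j ∧ z i < y + 1) = q at hQ1 hQ2
  simp [recordPair, hy, b1, hyb']
  refine Cmd.wp_conseq (query_spec (ζ := y + 1) (hlook.congr (by simp) (by simp) (by simp) (by simp))
    (by simp) (by omega) hjb hhb (by omega) (by omega)) ?_
  rintro s1 ⟨h1, h2⟩ hs1
  rw [hq] at h1
  simp at h2
  have ha1 : s1.a = s.a := by funext k; rw [hs1.a k (by cases k <;> rfl)]; simp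
  rw [Cmd.wp_seq', Cmd.wp_assign]
  -- The maximum of the answer and `cur` is the value: `hQ1` and `cur_le` bound it from above, `hQ2`
  -- from below.
  refine ⟨trivial, Cmd.wp_seq (R := fun s' => s'.v .u = val A B x y ∧ s'.clk ≤ s1.clk + 50) ?_ ?_⟩
  · have hcur : s1.v .cur = s.v .cur := by rw [hs1.v .cur rfl]; simp
    have hcv := hs.cur_le y le_rfl hm
    refine Cmd.wp_ite (by simp) (fun ht => ?_) (fun ht => ?_)
    · simp [h1, hcur] at ht
      simp [hcur]
      omega
    · simp [h1, hcur] at ht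
      simp [h1]
      omega
  rintro s2 ⟨h3, h4⟩ hs2
  have hv2 : ∀ v, v = .cur ∨ v = .last ∨ v = .cnt ∨ v = .x ∨ v = .y ∨ v = .j → s2.v v = s.v v := by
    rintro v (rfl | rfl | rfl | rfl | rfl | rfl) <;> (rw [hs2.v _ rfl]; simp; rw [hs1.v _ rfl]; simp)
  have ha2 : s2.a = s.a := by funext k; rw [hs2.a k (by cases k <;> rfl)]; simp [ha1]
  have hr2 : ScanInv A B R x j y s2 :=
    hs.same (fun v hv => hv2 v (by tauto)) ha2
  refine Cmd.wp_seq (R := fun s' => Recs A B R (fun X Y => X < x ∨ (X = x ∧ Y < y + 1)) s' ∧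
    Keep s2 s' ∧ s'.clk ≤ s2.clk + 250) ?_ ?_
  -- `Recs` constrains only significant pairs, so its domain may be enlarged by a pair that is not
  -- significant.
  · have hstay : ¬ IsSignificant A B (x, y) → ∀ n,
        Recs A B R (fun X Y => X < x ∨ (X = x ∧ Y < y + 1)) (s2.tick n) := by
      intro hns n
      refine (hr2.recs.same (s' := s2.tick n) rfl rfl rfl rfl rfl rfl).congr fun X Y hsig => ?_
      constructor
      · rintro (h1 | ⟨h1, h2⟩)
        · exact Or.inl h1
        · exact Or.inr ⟨h1, by omega⟩
      · rintro (h1 | ⟨rfl, h2⟩)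
        · exact Or.inl h1
        · rcases Nat.lt_succ_iff_lt_or_eq.mp h2 with h3 | rfl
          · exact Or.inr ⟨rfl, h3⟩
          · exact absurd hsig hns
    have htick : ∀ n m, (s2.tick n).tick m = s2.tick (n + m) := fun n m => by
      simp [St.tick, add_assoc]
    refine Cmd.wp_ite (by simp) (fun ht => ?_) (fun ht => ?_)
    · simp [h3] at ht
      refine Cmd.wp_ite (by simp [b0, hv2, hy, hyb]) (fun ht' => ?_) (fun ht' => ?_)
      · simp [h3, hv2, hy] at ht'
        rw [htick]
        have hsig : IsSignificant A B (x, y) := by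
          rw [isSignificant_iff hm]
          refine ⟨fun y' h5 h6 => ?_, fun x' h5 h6 => ?_⟩
          · exact (hr2.le_last y' h5 ⟨hm.1, h5.trans hyB, hm.2.2.trans h6.symm⟩).trans_lt ht
          · exact (hr2.recs.le_d x' y (Or.inl h5) h6).trans_lt ht'
        refine Cmd.wp_conseq (append_spec (R := R) (D := fun X Y => X < x ∨ (X = x ∧ Y < y))
          (x := x) (y := y)
          (hr2.recs.same rfl rfl rfl rfl rfl rfl) (by simp [hv2, hx]) (by simp [hv2, hy])
          (by simpa using h3) (by simp [hv2, hlook.eq_j, hj]) hsig (by simpa using ht')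
          (by rintro X Y (h | h) <;> omega) (by simp [hv2, hcb]) hyb' (by omega)) ?_
        rintro s3 ⟨h5, h5', h6⟩ -
        refine ⟨h5.congr fun X Y _ => ?_, ⟨h5'.cnt_le, h5'.eq⟩, by simp at h6; omega⟩
        constructor
        · rintro ((h | h) | h) <;> omega
        · rintro (h | h) <;> omega
      · simp [h3, hv2, hy] at ht'
        rw [htick]
        refine ⟨hstay (fun hsig => ?_) _, Keep.of_eq rfl fun _ _ => rfl, by simp⟩
        rcases hr2.recs.d_eq y hyB with h5 | ⟨X, h5, h6, h7⟩
        · omega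
        · have hX : X < x := by omega
          have := ((isSignificant_iff hm).mp hsig).2 X hX h6
          omega
    · simp [h3] at ht
      refine ⟨hstay (fun hsig => ?_) _, Keep.of_eq rfl fun _ _ => rfl, by simp⟩
      rcases hr2.last_eq with h5 | ⟨y', h5, h6, h7⟩
      · omega
      · have := ((isSignificant_iff hm).mp hsig).1 y' h5 (h6.2.2.symm.trans hm.2.2)
        omega
  rintro s3 ⟨h5, h5', h6⟩ hs3
  have hu3 : s3.v .u = val A B x y := by rw [hs3.v .u rfl, h3]
  have hc3 : s3.v .cur = s2.v .cur := by rw [hs3.v .cur rfl]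
  simp [hu3]
  refine ⟨⟨h5.same (by simp) (by simp) (by simp) (by simp) (by simp) (by simp), ?_, ?_, ?_, ?_⟩,
    (Keep.of_eq (hv2 _ (by simp)) fun k _ => by rw [ha2]).trans ⟨h5'.cnt_le, h5'.eq⟩, by omega⟩
  · intro y' h7 h8 h9
    rcases Nat.lt_succ_iff_lt_or_eq.mp h7 with h10 | rfl
    · simpa [hc3] using hr2.le_cur y' h10 h8 h9
    · rw [hm.2.2] at h9; exact absurd h9 (lt_irrefl _)
  · intro y' h7 h8
    simpa [hc3] using hr2.cur_le y' (by omega) h8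
  · intro y' h7 h8
    simp
    exact val_mono hm h8 le_rfl (by omega) (h8.2.2.symm.trans hm.2.2)
  · exact Or.inr ⟨y, by omega, hm, by simp⟩

theorem scanStep_spec {s : St} {x j y n : ℕ} {f z g : ℕ → ℕ} (henv : Env A B R s)
    (hlook : Look R.h B.length j n f z g s) (hx : s.v .x = x) (hy : s.v .y = y)
    (hxA : x < A.length) (hyB : y < B.length)
    (hj : j = R.grp B (sym A x)) (hs : ScanInv A B R x j y s)
    (hQ1 : ∀ y, Mt A B x y → mx f n (fun i => g i < j ∧ z i < y + 1) ≤ val A B x y)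
    (hQ2 : ∀ y c, Mt A B x y → (∀ y' < y, R.grp B (sym B y') = j → sym B y' < sym A x →
      ∀ x' < x, IsSignificant A B (x', y') → val A B x' y' + 1 ≤ c) →
      val A B x y ≤ max (mx f n (fun i => g i < j ∧ z i < y + 1)) c)
    (hjb : j < bd) (hhb : R.h + 2 < bd) (hbl : 4 * (A.length + B.length) + 20 < bd)
    (hcb : s.v .cnt + 1 < bd) :
    scanStep.wp bd (A.length + B.length) (fun s' => ScanInv A B R x j (y + 1) s' ∧
      Keep s s' ∧ s'.clk ≤ s.clk + 700 * (R.h + 1)) s := by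
  have b0 : 0 < bd := by omega
  have b1 : 1 < bd := by omega
  have hyb : y < bd := by omega
  have hayb : A.length + y < bd := by omega
  have hdl := hs.d_le hyB
  have hdb : s.a .d y 0 0 + 1 < bd := by omega
  have hix := henv.base.inpA x hxA
  have hiy := henv.base.inpB y hyB
  simp [scanStep, hy, henv.base.a, hayb]
  refine Cmd.wp_ite (by simp [hx]; omega) (fun ht => ?_) (fun ht => ?_)
  · simp [hx, hix, hiy] at ht
    refine Cmd.wp_ite (by simp [hy, hyb, b0, b1, hdb]) (fun ht' => ?_) (fun ht' => ?_)
    · simp [hy] at ht'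
      simp [hy, hyb, b0, b1, hdb]
      refine ⟨hs.other ht.ne hyB (by simp) (by simp) (by simp) (fun _ => ?_)
        (fun h => absurd ht h), Keep.of_eq (by simp) (by simp), by omega⟩
      simp; omega
    · simp [hy] at ht'
      simp
      refine ⟨hs.other ht.ne hyB (by simp) (by simp) (by simp) (fun _ => ?_)
        (fun h => absurd ht h), Keep.of_eq (by simp) (by simp), by omega⟩
      simp; omega
  · simp [hx, hix, hiy] at ht
    refine Cmd.wp_ite (by simp [hx]; omega) (fun ht' => ?_) (fun ht' => ?_)
    · simp [hx, hix, hiy] at ht'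
      simp
      exact ⟨hs.other ht'.ne' hyB (by simp) (by simp) (by simp) (fun h => absurd h (not_lt.mpr ht))
        (fun _ => by simp), Keep.of_eq (by simp) (by simp), by omega⟩
    · simp [hx, hix, hiy] at ht'
      have hm : Mt A B x y := ⟨hxA, hyB, le_antisymm ht ht'⟩
      refine Cmd.wp_conseq (recordPair_spec (R := R) (A := A) (B := B) (h := R.h) (x := x) (j := j)
        (y := y)
        (hlook.congr (by simp) (by simp) (by simp) (by simp)) (by simp [hx]) (by simp [hy]) hm
        (by rw [hj, hm.2.2]) (hs.same (by rintro v (rfl | rfl | rfl) <;> simp) (by simp)) (hQ1 y hm)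
        (by simpa using hQ2 y _ hm hs.le_cur) hjb hhb hbl (by simpa using hcb)) ?_
      rintro s1 ⟨h1, h1', h2⟩ -
      simp only [St.tick_clk, St.set_clk, Expr.cost_add, Expr.cost_var, Cond.cost] at h2
      refine ⟨h1, ⟨h1'.cnt_le, h1'.eq⟩, ?_⟩
      linarith [Nat.zero_le R.h]

/-- Scan the columns of the group of the current row. -/
def scanGroup : Cmd :=
  Var.cur ≔ 0 ;; Var.last ≔ 0 ;; Var.y ≔ Expr.ld .nxt Var.j 0 0 ;;
  .whileDo (.lt Var.y Var.b) (scanStep ;; Var.y ≔ Expr.ld .nxt Var.j (Var.y + 1) 0)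

/-- For the clock: jumping to the next column of the group passes none, so the rounds of the scan
are counted by the columns of the group. -/
theorem IsNext.count_eq {j z y : ℕ} (h : IsNext R B j z y) :
    Nat.count (fun y => R.grp B (sym B y) = j) y = Nat.count (fun y => R.grp B (sym B y) = j) z := by
  have key : ∀ k, z + k ≤ y → Nat.count (fun y => R.grp B (sym B y) = j) (z + k) =
      Nat.count (fun y => R.grp B (sym B y) = j) z := by
    intro k
    induction k with
    | zero => intro _; rfl
    | succ k ih =>
      intro hk
      rw [← add_assoc, Nat.count_succ, if_neg (h.grp_ne _ (by omega) (by omega)), add_zero, ih (by omega)]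
  have := key (y - z) (by have := h.le; omega)
  rwa [show z + (y - z) = y by have := h.le; omega] at this

/-- By `hQ1` and `hQ2` a query never exceeds the value and misses only predecessors inside the
group, for which the running maximum makes up. -/
theorem scanGroup_spec {s : St} {x j n : ℕ} {f z g : ℕ → ℕ} (henv : Env A B R s)
    (hlook : Look R.h B.length j n f z g s) (hx : s.v .x = x)
    (hxA : x < A.length) (hj : j = R.grp B (sym A x)) (hs : Recs A B R (fun X _ => X < x) s)
    (hQ1 : ∀ y, Mt A B x y → mx f n (fun i => g i < j ∧ z i < y + 1) ≤ val A B x y)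
    (hQ2 : ∀ y c, Mt A B x y → (∀ y' < y, R.grp B (sym B y') = j → sym B y' < sym A x →
      ∀ x' < x, IsSignificant A B (x', y') → val A B x' y' + 1 ≤ c) →
      val A B x y ≤ max (mx f n (fun i => g i < j ∧ z i < y + 1)) c)
    (hhb : R.h + 2 < bd) (hnp : R.np ≤ B.length) (hbl : 4 * (A.length + B.length) + 20 < bd)
    (hcb : A.length * B.length + 2 < bd) :
    scanGroup.wp bd (A.length + B.length) (fun s' => Recs A B R (fun X _ => X < x + 1) s' ∧
      Keep s s' ∧ s'.clk ≤ s.clk + Nat.count (fun y => R.grp B (sym B y) = j) B.length * (800 * (R.h + 1)) + 100)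
      s := by
  have b0 : 0 < bd := by omega
  have b1 : 1 < bd := by omega
  have hjl : j ≤ 2 * R.np + 1 := hj ▸ Par.grp_le _
  have hjb : j < bd := by omega
  have hnx := henv.nxt j hjl
  simp only [scanGroup, Cmd.wp_seq', Cmd.wp_assign, Expr.ok_zero, Expr.ok_ld, Expr.ok_var,
    Expr.eval_zero, Expr.eval_ld, Expr.eval_var, St.tick_v, St.set_v, reduceCtorEq, if_false,
    hlook.eq_j, b0, hjb, true_and, and_true]
  refine Cmd.wp_while (fun s' => ∃ y, s'.v .y = y ∧ y ≤ B.length ∧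
    (y < B.length → R.grp B (sym B y) = j) ∧ Env A B R s' ∧
    Look R.h B.length j n f z g s' ∧ s'.v .x = x ∧ ScanInv A B R x j y s' ∧
    Keep s s' ∧ s'.clk ≤ s.clk + Nat.count (fun y => R.grp B (sym B y) = j) y * (800 * (R.h + 1)) + 50)
    (fun s' => B.length - s'.v .y) ?_ ?_ ?_ _ ?_
  · rintro s' -; simp
  · rintro s1 ⟨y, h1, h2, h3, h4, h5, h6, h7, h7', h8⟩ ht
    simp only [Cond.holds, Expr.eval_var, h1, h4.base.b] at ht
    have h3 := h3 ht
    have hyb : y + 1 < bd := by omega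
    refine Cmd.wp_seq (scanStep_spec (h4.congr (by simp) (by simp) (by simp))
      (h5.congr (by simp) (by simp) (by simp) (by simp)) (by simpa using h6) (by simpa using h1) hxA
      ht hj (h7.same (by simp) (by simp)) hQ1 hQ2 hjb hhb hbl (by
        have := h7.recs.cnt_le; simp; omega)) ?_
    rintro s2 ⟨g1, g1', g2⟩ hs2
    simp only [St.tick_clk] at g2
    have e4 : Env A B R s2 := h4.congr (by rintro v (rfl|rfl|rfl|rfl|rfl|rfl) <;> (rw [hs2.v _ rfl]; simp))
      (by rintro k (rfl|rfl) <;> (rw [hs2.a _ rfl]; simp)) (by rw [hs2.inp rfl]; simp)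
    have e5 : Look R.h B.length j n f z g s2 := h5.congr (by rw [hs2.v _ rfl]; simp)
      (by rw [hs2.v _ rfl]; simp) (by rw [hs2.a _ rfl]; simp) (by rw [hs2.a _ rfl]; simp)
    have ey : s2.v .y = y := by rw [hs2.v _ rfl]; simpa using h1
    have hn := e4.nxt j hjl (y + 1) (by omega)
    simp only [Cmd.wp_assign, Expr.ok_ld, Expr.ok_var, Expr.ok_zero, Expr.ok_add, Expr.ok_one,
      Expr.eval_ld, Expr.eval_var, Expr.eval_add, Expr.eval_one, Expr.eval_zero, e5.eq_j, ey,
      true_and, St.tick_v, St.set_v, if_true, b0, b1, hjb, hyb]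
    refine ⟨⟨_, rfl, hn.le_length, hn.grp_eq, e4.congr (by simp) (by simp) (by simp),
      e5.congr (by simp) (by simp) (by simp) (by simp), ?_, ?_,
      h7'.trans ⟨g1'.cnt_le, g1'.eq⟩, ?_⟩, ?_⟩
    · simp [hs2.v .x rfl, h6]
    · have : ScanInv A B R x j (s2.a .nxt j (y + 1) 0) s2 := by
        rw [hj] at g1 hn ⊢
        exact g1.skip hn.le hn.grp_ne
      exact this.same (by simp) (by simp)
    · rw [hn.count_eq, Nat.count_succ, if_pos h3, add_mul (Nat.count _ y)]
      simp only [St.tick_clk, St.set_clk, Expr.cost_add, Expr.cost_var, Expr.cost_ld,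
        Expr.cost_one, Expr.cost_zero, Cond.cost] at g2 ⊢
      omega
    · have := hn.le
      omega
  · rintro s1 ⟨y, h1, h2, h3, h4, h5, h6, h7, h7', h8⟩ ht
    simp only [Cond.holds, Expr.eval_var, h1, h4.base.b] at ht
    obtain rfl : y = B.length := by omega
    refine ⟨(h7.recs.same (s' := s1.tick _) rfl rfl rfl rfl rfl rfl).congr fun X Y hsig => ?_, ⟨h7'.cnt_le, h7'.eq⟩,
      by simp; omega⟩
    have := hsig.mt.2.1
    omega
  · have hn := hnx 0 (Nat.zero_le _)
    refine ⟨s.a .nxt j 0 0, by simp, hn.le_length, hn.grp_eq, henv.congr (by simp) (by simp) (by simp),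
      hlook.congr (by simp) (by simp) (by simp) (by simp), by simp [hx], ?_,
      Keep.of_eq (by simp) (by simp), by simp; omega⟩
    have : ScanInv A B R x j 0 (((s.set .cur 0).tick 2).set .last 0) := by
      refine ⟨(hs.same (by simp) (by simp) (by simp) (by simp) (by simp) (by simp)).congr
        (by intros; omega), by simp, by simp, by simp, by simp⟩
    rw [hj] at this hn ⊢
    exact (this.skip hn.le hn.grp_ne).same (by simp) (by simp)

end Imp


/-! ## Rows whose symbol is a pivot -/

namespace Imp

open LCIS

variable {A B : List ℤ} {bd len : ℕ} {R : Par}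

/-- Try the first column of the group `j` after the place of record `i`. -/
def tryRecord : Cmd :=
  Var.y ≔ Expr.ld .nxt Var.j (Expr.ld .rz Var.i 0 0) 0 ;;
  .ite (.lt Var.y Var.b)
    (Var.z ≔ Var.y + 1 ;; query ;; Var.u ≔ Var.res ;; Var.z ≔ Expr.ld .rz Var.i 0 0 ;; query ;;
      .ite (.lt Var.res Var.u) (.ite (.lt (Expr.ld .d Var.y 0 0) Var.u) append .skip) .skip)
    .skip

/-- The group has no column between the place `z k` and the candidate `y`, so `Q (z k)` bounds all
values to the left of `y` in this row. Thus `Q (z k) < Q (y + 1)` together with the comparison with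
`d` implies significance. A pair passing the first test but not the second is recorded already or
not significant. -/
theorem tryRecord_spec {s : St} {D : ℕ → ℕ → Prop} {x j k n : ℕ} {f z g Q : ℕ → ℕ}
    (henv : Env A B R s) (hlook : Look R.h B.length j n f z g s) (hx : s.v .x = x)
    (hxA : x < A.length) (hj : j = R.grp B (sym A x)) (hp : R.IsPivot B (sym A x))
    (hk : s.v .i = k) (hkb : k < bd) (hz : s.a .rz k 0 0 = z k) (hzk : z k ≤ B.length)
    (hrec : Recs A B R D s) (hD : ∀ X Y, D X Y → X ≤ x) (hD' : ∀ X Y, X < x → D X Y)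
    (hQ : ∀ ζ, mx f n (fun i => g i < j ∧ z i < ζ) = Q ζ) (hQm : Monotone Q)
    (hQv : ∀ y, Mt A B x y → Q (y + 1) = val A B x y)
    (hhb : R.h + 2 < bd) (hnp : R.np ≤ B.length) (hbl : 4 * (A.length + B.length) + 20 < bd)
    (hcb : A.length * B.length + 2 < bd) :
    tryRecord.wp bd len (fun s' =>
      Recs A B R (fun X Y => D X Y ∨ (X = x ∧ IsNext R B j (z k) Y ∧ Q (z k) < Q (Y + 1))) s' ∧
      Keep s s' ∧ s'.clk ≤ s.clk + 800 * (R.h + 1)) s := by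
  have b0 : 0 < bd := by omega
  have b1 : 1 < bd := by omega
  have hjl : j ≤ 2 * R.np + 1 := hj ▸ Par.grp_le _
  have hjb : j < bd := by omega
  have hzb : z k < bd := by omega
  have hn := henv.nxt j hjl (z k) hzk
  have hcnt := hrec.cnt_le
  generalize hy : s.a .nxt j (z k) 0 = y at hn
  have hsym : ∀ Y, R.grp B (sym B Y) = j → sym B Y = sym A x := fun Y h => by
    rw [hj] at h; exact hp.grp_eq_iff.mp h
  have hstay : (y < B.length → Q (z k) < Q (y + 1) → IsSignificant A B (x, y) → D x y) →
      Recs A B R (fun X Y => D X Y ∨ (X = x ∧ IsNext R B j (z k) Y ∧ Q (z k) < Q (Y + 1))) s := by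
    intro h
    refine hrec.congr fun X Y hs => ⟨Or.inl, ?_⟩
    rintro (h1 | ⟨rfl, h1, h2⟩)
    · exact h1
    · obtain rfl := h1.unique hn
      exact h hs.mt.2.1 h2 hs
  simp only [tryRecord, Cmd.wp_seq', Cmd.wp_assign, Expr.ok_ld, Expr.ok_var, Expr.ok_zero,
    Expr.eval_ld, Expr.eval_var, Expr.eval_zero, hlook.eq_j, hk, hz, hy, b0, hkb, hjb, hzb,
    true_and, and_true]
  refine Cmd.wp_ite (by simp) (fun ht => ?_) (fun ht => ?_)
  swap
  · simp only [Cond.holds, Expr.eval_var, St.tick_v, St.set_v, if_true, reduceCtorEq, if_false,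
      henv.base.b] at ht
    refine ⟨(hstay fun h => absurd h ht).same (by simp) rfl rfl rfl rfl rfl,
      Keep.of_eq (by simp) (fun _ _ => rfl), by simp; omega⟩
  simp only [Cond.holds, Expr.eval_var, St.tick_v, St.set_v, if_true, reduceCtorEq, if_false,
      henv.base.b] at ht
  have hyb : y + 1 < bd := by omega
  have hyb' : y < bd := by omega
  have hyg := hn.grp_eq ht
  have hys := hsym y hyg
  have hm : Mt A B x y := ⟨hxA, ht, hys.symm⟩
  have hqy := hQv y hm
  have hvp := val_pos hm
  have hvl := (LCIS.val_le hm).2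
  rw [Cmd.wp_seq', Cmd.wp_assign]
  refine ⟨by simp [b1, hyb], Cmd.wp_seq (query_spec (ζ := y + 1) (hlook.congr (by simp) (by simp)
    (by simp) (by simp)) (by simp) (by omega) hjb hhb (by omega) (by omega)) ?_⟩
  rintro s1 ⟨h1, h2⟩ hs1
  rw [hQ, hqy] at h1
  have hv1 : ∀ v, v = .i ∨ v = .cnt ∨ v = .x ∨ v = .j ∨ v = .h → s1.v v = s.v v := by
    rintro v (rfl | rfl | rfl | rfl | rfl) <;> (rw [hs1.v _ rfl]; simp)
  have hy1 : s1.v .y = y := by rw [hs1.v _ rfl]; simp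
  have ha1 : s1.a = s.a := by funext k; rw [hs1.a k (by cases k <;> rfl)]; simp
  simp only [Cmd.wp_seq', Cmd.wp_assign, Expr.ok_ld, Expr.ok_var, Expr.ok_zero,
    Expr.eval_ld, Expr.eval_var, Expr.eval_zero, hk, hz, b0, hkb, ha1, h1, St.tick_v, St.set_v,
    St.tick_a, St.set_a, hv1, reduceCtorEq, if_false, or_true, true_or, true_and, and_true]
  refine Cmd.wp_conseq (query_spec (ζ := z k) (hlook.congr (by simp [hv1]) (by simp [hv1])
    (by simp [ha1]) (by simp [ha1])) (by simp) hzk hjb hhb (by omega) (by omega)) ?_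
  rintro s2 ⟨h3, h4⟩ hs2
  rw [hQ] at h3
  have hv2 : ∀ v, v = .i ∨ v = .cnt ∨ v = .x ∨ v = .j ∨ v = .h → s2.v v = s.v v := by
    intro v hv
    rw [← hv1 v hv]
    rcases hv with rfl | rfl | rfl | rfl | rfl <;> (rw [hs2.v _ rfl]; simp)
  have hy2 : s2.v .y = y := by rw [hs2.v _ rfl]; simp [hy1]
  have hu2 : s2.v .u = val A B x y := by rw [hs2.v _ rfl]; simp
  have ha2 : s2.a = s.a := by funext k; rw [hs2.a k (by cases k <;> rfl)]; simp [ha1]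
  have hc2 : s2.clk ≤ s.clk + 400 * (R.h + 1) + 100 := by
    simp at h2 h4; omega
  have hr2 : Recs A B R D s2 := hrec.same (hv2 _ (by simp)) (by rw [ha2]) (by rw [ha2])
    (by rw [ha2]) (by rw [ha2]) (by rw [ha2])
  have hk2 : Keep s s2 := Keep.of_eq (hv2 _ (by simp)) (by simp [ha2])
  have hstay2 : ∀ m, (Q (z k) < Q (y + 1) → IsSignificant A B (x, y) → D x y) →
      Recs A B R (fun X Y => D X Y ∨ (X = x ∧ IsNext R B j (z k) Y ∧ Q (z k) < Q (Y + 1)))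
        (s2.tick m) := fun m h =>
    (hstay fun _ => h).same (hv2 _ (by simp)) (by simp [ha2]) (by simp [ha2]) (by simp [ha2])
      (by simp [ha2]) (by simp [ha2])
  have htick : ∀ n m, (s2.tick n).tick m = s2.tick (n + m) := fun n m => by
    simp [St.tick, add_assoc]
  refine Cmd.wp_ite (by simp) (fun ht => ?_) (fun ht => ?_)
  · simp only [Cond.holds, Expr.eval_var, h3, hu2] at ht
    refine Cmd.wp_ite (by simp [b0, hy2, hyb']) (fun ht' => ?_) (fun ht' => ?_)
    · simp only [Cond.holds, Expr.eval_var, Expr.eval_ld, Expr.eval_zero, St.tick_v, St.tick_a,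
        hy2, hu2] at ht'
      rw [htick]
      have hsig : IsSignificant A B (x, y) := by
        rw [isSignificant_iff hm]
        refine ⟨fun y' h5 h6 => ?_, fun x' h5 h6 => ?_⟩
        · have hm' : Mt A B x y' := ⟨hxA, h5.trans hm.2.1, hys.symm.trans h6.symm⟩
          have hzy : y' < z k := by
            by_contra hcon
            exact hn.grp_ne y' (not_lt.mp hcon) h5 (by rw [h6, hyg])
          rw [← hQv y' hm']
          exact (hQm hzy).trans_lt ht
        · exact (hr2.le_d x' y (hD' _ _ h5) h6).trans_lt ht'
      refine Cmd.wp_conseq (append_spec (R := R) (D := D) (x := x) (y := y)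
          (hr2.same rfl rfl rfl rfl rfl rfl) (by simp [hv2, hx]) (by simpa using hy2)
          (by simpa using hu2) (by simp [hv2, hlook.eq_j, hyg]) hsig (by simpa using ht')
          hD (by simp only [St.tick_v, hv2, or_true, true_or]; omega) hyb (by omega)) ?_
      rintro s3 ⟨h5, h6, h7⟩ -
      refine ⟨h5.congr fun X Y _ => or_congr Iff.rfl (and_congr Iff.rfl ?_),
        hk2.trans ⟨h6.cnt_le, h6.eq⟩, by simp at h7; omega⟩
      constructor
      · rintro rfl; exact ⟨hn, by rw [hqy]; exact ht⟩
      · rintro ⟨h8, -⟩; exact h8.unique hn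
    · simp only [Cond.holds, Expr.eval_var, Expr.eval_ld, Expr.eval_zero, St.tick_v, St.tick_a,
        hy2, hu2] at ht'
      rw [htick]
      refine ⟨hstay2 _ fun _ hsig => ?_, hk2.trans (Keep.of_eq rfl fun _ _ => rfl), by simp; omega⟩
      rcases hr2.d_eq y hm.2.1 with h5 | ⟨X, h5, h6, h7⟩
      · omega
      -- In the case `X = x` another record has led to the same column and the pair is already
      -- there.
      · rcases (hD X y h5).lt_or_eq with h8 | rfl
        · have := ((isSignificant_iff hm).mp hsig).2 X h8 h6
          omega
        · exact h5
  · simp only [Cond.holds, Expr.eval_var, h3, hu2] at ht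
    refine ⟨hstay2 _ fun h => ?_, hk2.trans (Keep.of_eq rfl fun _ _ => rfl), by simp; omega⟩
    rw [hqy] at h
    exact absurd h ht

/-- Try all records that have just been absorbed. -/
def scanRecords : Cmd :=
  Var.i ≔ Var.old ;; .upto .i Var.fin (.ite (.lt (Expr.ld .rg Var.i 0 0) Var.j) tryRecord .skip)

/-- The postcondition lists the pairs reached from the new records; that these include all
significant pairs of the row is the content of `Recs.exists_new`. -/
theorem scanRecords_spec {s : St} {x j old n : ℕ} {f z g Q : ℕ → ℕ}
    (henv : Env A B R s) (hlook : Look R.h B.length j n f z g s) (hx : s.v .x = x)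
    (hxA : x < A.length) (hj : j = R.grp B (sym A x)) (hp : R.IsPivot B (sym A x))
    (hold : s.v .old = old) (hfin : s.v .fin = n) (hle : old ≤ n) (hn : s.v .cnt = n)
    (hz : ∀ i < n, s.a .rz i 0 0 = z i) (hg : ∀ i < n, s.a .rg i 0 0 = g i)
    (hrec : Recs A B R (fun X _ => X < x) s)
    (hQ : ∀ ζ, mx f n (fun i => g i < j ∧ z i < ζ) = Q ζ) (hQm : Monotone Q)
    (hQv : ∀ y, Mt A B x y → Q (y + 1) = val A B x y)
    (hhb : R.h + 2 < bd) (hnp : R.np ≤ B.length) (hbl : 4 * (A.length + B.length) + 20 < bd)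
    (hcb : A.length * B.length + 2 < bd) :
    scanRecords.wp bd len (fun s' =>
      Recs A B R (fun X Y => X < x ∨ (X = x ∧ ∃ i, old ≤ i ∧ i < n ∧ g i < j ∧
        IsNext R B j (z i) Y ∧ Q (z i) < Q (Y + 1))) s' ∧
      Keep s s' ∧ s'.clk ≤ s.clk + (n - old) * (1000 * (R.h + 1)) + 50) s := by
  have b0 : 0 < bd := by omega
  have hcnt := hrec.cnt_le
  have hjl : j ≤ 2 * R.np + 1 := hj ▸ Par.grp_le _
  rw [scanRecords, Cmd.wp_seq', Cmd.wp_assign]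
  refine ⟨trivial, Cmd.wp_upto (fun k s' => s'.v .i = k ∧ s'.v .fin = n ∧ Env A B R s' ∧
    Look R.h B.length j n f z g s' ∧ s'.v .x = x ∧
    Recs A B R (fun X Y => X < x ∨ (X = x ∧ ∃ i, old ≤ i ∧ i < k ∧ g i < j ∧
        IsNext R B j (z i) Y ∧ Q (z i) < Q (Y + 1))) s' ∧
    Keep s s' ∧ s'.clk ≤ s.clk + (k - old) * (1000 * (R.h + 1)) + 10) old n hle (by omega)
    ?_ ?_ ?_ ?_⟩
  · rintro k s1 ⟨h1, h2, -⟩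
    exact ⟨h1, by simp [h2], trivial⟩
  · refine ⟨by simp [hold], by simp [hfin], henv.congr (by simp) (by simp) (by simp),
      hlook.congr (by simp) (by simp) (by simp) (by simp), by simp [hx], ?_,
      Keep.of_eq (by simp) (by simp), by simp⟩
    refine (hrec.same (by simp) (by simp) (by simp) (by simp) (by simp) (by simp)).congr
      fun X Y _ => ⟨Or.inl, ?_⟩
    rintro (h | ⟨-, i, h1, h2, -⟩)
    · exact h
    · omega
  · rintro k s1 hk1 hk ⟨h1, h2, h3, h4, h5, h6, h7, h8⟩
    have hkb : k < bd := by omega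
    have hclk : s1.clk + 1000 * (R.h + 1) ≤ s.clk + (k + 1 - old) * (1000 * (R.h + 1)) + 10 := by
      rw [show k + 1 - old = (k - old) + 1 by omega, add_mul (k - old), one_mul]; omega
    have hgk : s1.a .rg k 0 0 = g k := by
      rw [h7.eq .rg (by simp) k (by omega), hg k hk]
    have hzk : s1.a .rz k 0 0 = z k := by
      rw [h7.eq .rz (by simp) k (by omega), hz k hk]
    have hzl : z k ≤ B.length := by
      rw [← hz k hk]; exact hrec.rz_le (by omega)
    refine Cmd.wp_ite (by simp [h1, hkb, b0]) (fun ht => ?_) (fun ht => ?_)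
    · simp only [Cond.holds, Expr.eval_var, Expr.eval_ld, Expr.eval_zero, St.tick_v, St.tick_a,
        h1, h4.eq_j, hgk] at ht
      refine Cmd.wp_conseq (tryRecord_spec (A := A) (B := B) (R := R) (k := k) (x := x) (f := f)
        (n := n) (g := g) (z := z) (j := j) (Q := Q)
        (D := fun X Y => X < x ∨ (X = x ∧ ∃ i, old ≤ i ∧ i < k ∧ g i < j ∧
        IsNext R B j (z i) Y ∧ Q (z i) < Q (Y + 1)))
        (h3.congr (by simp) (by simp) (by simp)) (h4.congr (by simp) (by simp) (by simp) (by simp))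
        (by simpa using h5) hxA hj hp (by simpa using h1) hkb (by simpa using hzk) hzl
        (h6.same rfl rfl rfl rfl rfl rfl) (by rintro X Y (h | h) <;> omega)
        (fun X Y h => Or.inl h) hQ hQm hQv hhb hnp hbl hcb) ?_
      rintro s2 ⟨g1, g2, g3⟩ hs2
      refine ⟨by rw [hs2.v _ rfl]; simpa using h1, by simp, ?_, ?_, ?_, ?_, ?_, ?_, ?_⟩
      · simp [hs2.v .fin rfl, h2]
      · exact h3.congr (by rintro v (rfl|rfl|rfl|rfl|rfl|rfl) <;> (simp; rw [hs2.v _ rfl]; simp))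
          (by rintro k (rfl|rfl) <;> (simp; rw [hs2.a _ rfl]; simp)) (by simp [hs2.inp rfl])
      · exact h4.congr (by simp; rw [hs2.v _ rfl]; simp) (by simp; rw [hs2.v _ rfl]; simp) (by simp; rw [hs2.a _ rfl]; simp)
          (by simp; rw [hs2.a _ rfl]; simp)
      · simp [hs2.v .x rfl, h5]
      · refine (g1.same (by simp) (by simp) (by simp) (by simp) (by simp) (by simp)).congr
          fun X Y _ => ?_
        constructor
        · rintro ((h | ⟨h, i, i1, i2, i3⟩) | ⟨h, h'⟩)
          · exact Or.inl h
          · exact Or.inr ⟨h, i, i1, by omega, i3⟩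
          · exact Or.inr ⟨h, k, hk1, by omega, ht, h'⟩
        · rintro (h | ⟨h, i, i1, i2, i3, i4⟩)
          · exact Or.inl (Or.inl h)
          · rcases Nat.lt_succ_iff_lt_or_eq.mp i2 with h' | rfl
            · exact Or.inl (Or.inr ⟨h, i, i1, h', i3, i4⟩)
            · exact Or.inr ⟨h, i4⟩
      · exact h7.trans (Keep.trans (s' := s2) ⟨g2.cnt_le, g2.eq⟩
          (Keep.of_eq (by simp) (by simp)))
      · simp only [St.tick_clk, St.set_clk, Cond.cost, Expr.cost_ld, Expr.cost_var,
          Expr.cost_zero] at g3 ⊢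
        omega
    · simp only [Cond.holds, Expr.eval_var, Expr.eval_ld, Expr.eval_zero, St.tick_v, St.tick_a,
        h1, h4.eq_j, hgk] at ht
      refine ⟨by simpa using h1, by simp, by simp [h2], h3.congr (by simp) (by simp) (by simp),
        h4.congr (by simp) (by simp) (by simp) (by simp), by simp [h5], ?_,
        h7.trans (Keep.of_eq (by simp) (by simp)), ?_⟩
      · refine (h6.same (by simp) (by simp) (by simp) (by simp) (by simp) (by simp)).congr
          fun X Y _ => ?_
        constructor
        · rintro (h | ⟨h, i, i1, i2, i3⟩)
          · exact Or.inl h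
          · exact Or.inr ⟨h, i, i1, by omega, i3⟩
        · rintro (h | ⟨h, i, i1, i2, i3, i4⟩)
          · exact Or.inl h
          · rcases Nat.lt_succ_iff_lt_or_eq.mp i2 with h' | rfl
            · exact Or.inr ⟨h, i, i1, h', i3, i4⟩
            · exact absurd i3 ht
      · simp only [St.tick_clk, St.set_clk, Cond.cost, Expr.cost_ld, Expr.cost_var,
          Expr.cost_zero] at ⊢
        omega
  · rintro s1 ⟨h1, h2, h3, h4, h5, h6, h7, h8⟩
    exact ⟨h6.same rfl rfl rfl rfl rfl rfl, ⟨h7.cnt_le, h7.eq⟩, by simp; omega⟩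

end Imp


/-! ## Processing a row -/

namespace Imp

open LCIS

variable {A B : List ℤ} {bd : ℕ} {R : Par}

/-- A significant pair in a pivot row comes from a record that was not available in the previous row
of the same pivot. -/
theorem Recs.exists_new {s : St} {x j old y : ℕ} {Q : ℕ → ℕ}
    (h : Recs A B R (fun X _ => X < x) s) (hj : j = R.grp B (sym A x))
    (hp : R.IsPivot B (sym A x))
    (hrow : old = 0 ∨ ∃ X < x, X < A.length ∧ R.grp B (sym A X) = j ∧
      ∀ i, 1 ≤ i → i < old → s.a .rx i 0 0 < X)
    (hQ : ∀ ζ, mx (fun i => s.a .ru i 0 0) (s.v .cnt)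
      (fun i => s.a .rg i 0 0 < j ∧ s.a .rz i 0 0 < ζ) = Q ζ) (hQm : Monotone Q)
    (hQv : ∀ y, Mt A B x y → Q (y + 1) = val A B x y) (hsig : IsSignificant A B (x, y)) :
    ∃ i, old ≤ i ∧ i < s.v .cnt ∧ s.a .rg i 0 0 < j ∧ IsNext R B j (s.a .rz i 0 0) y ∧
      Q (s.a .rz i 0 0) < Q (y + 1) := by
  have hm := hsig.mt
  have hqy := hQv y hm
  have hvp := val_pos hm
  -- Among the records whose worth is the value of `(x, y)`, take one at the least place.
  have hex : ∃ ζ, ∃ i, i < s.v .cnt ∧ s.a .rg i 0 0 < j ∧ s.a .rz i 0 0 = ζ ∧ ζ ≤ y ∧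
      s.a .ru i 0 0 = Q (y + 1) := by
    obtain ⟨i, h1, h2, h3⟩ := exists_mx (lt_of_lt_of_le hvp (by rw [← hqy, ← hQ]))
    exact ⟨_, i, h1, h2.1, rfl, Nat.lt_succ_iff.mp h2.2, h3.trans (hQ _)⟩
  classical
  obtain ⟨i, h1, h2, h3, h4, h5⟩ := Nat.find_spec hex
  have hmin := fun ζ => Nat.find_min (m := ζ) hex
  rw [← h3] at hmin h4
  -- Otherwise a record of the same worth would exist at a smaller place.
  have hlt : Q (s.a .rz i 0 0) < Q (y + 1) := by
    by_contra hcon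
    have hle := hQm (show s.a .rz i 0 0 ≤ y + 1 by omega)
    have heq : Q (s.a .rz i 0 0) = Q (y + 1) := le_antisymm hle (not_lt.mp hcon)
    obtain ⟨i', h6, h7, h8⟩ := exists_mx (f := fun i => s.a .ru i 0 0) (n := s.v .cnt)
      (P := fun i' => s.a .rg i' 0 0 < j ∧ s.a .rz i' 0 0 < s.a .rz i 0 0)
      (by rw [hQ, heq, hqy]; exact hvp)
    exact hmin _ h7.2 ⟨i', h6, h7.1, rfl, by omega, by rw [← heq, ← hQ]; exact h8⟩
  refine ⟨i, ?_, h1, h2, ⟨h4, hm.2.1.le, fun _ => by rw [hj, hm.2.2], fun y' h6 h7 h8 => ?_⟩, hlt⟩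
  -- If the record is old, it precedes the earlier row `X` of the same pivot, or is the sentinel.
  -- Then `(X, y)` already has the value of `(x, y)`, which contradicts significance.
  · by_contra hcon
    rw [not_le] at hcon
    rcases hrow with h6 | ⟨X, h6, h7, h8, h9⟩
    · omega
    · have hXs : sym A X = sym A x := by rw [hj] at h8; exact hp.grp_eq_iff.mp h8
      have hmX : Mt A B X y := ⟨h7, hm.2.1, hXs.trans hm.2.2⟩
      have hlt := hsig.val_lt hmX h6.le le_rfl (by omega) rfl
      rw [← hqy, ← h5] at hlt
      rcases Nat.eq_zero_or_pos i with rfl | hi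
      · rw [h.ru_zero] at hlt
        have := val_pos hmX
        omega
      · obtain ⟨y', g1, g2, g3, g4, g5⟩ := h.sound i hi h1
        rw [g4] at hlt
        have := LCIS.val_lt hmX g3.mt (h9 i hi hcon) (by omega)
          (Par.lt_of_grp_lt (R := R) (B := B) (by rw [← g5, ← hmX.2.2, h8]; exact h2))
        omega
  -- A column of the group between the place and `y` would give a pair to the left with the same
  -- value.
  · have hs' : sym B y' = sym A x := by rw [hj] at h8; exact hp.grp_eq_iff.mp h8
    have hm' : Mt A B x y' := ⟨hm.1, h7.trans hm.2.1, hs'.symm⟩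
    have hlt' := hsig.val_lt hm' le_rfl h7.le (by omega) (hs'.trans hm.2.2)
    have := le_mx (f := fun i => s.a .ru i 0 0) (n := s.v .cnt)
      (P := fun i => s.a .rg i 0 0 < j ∧ s.a .rz i 0 0 < y' + 1) h1 ⟨h2, by omega⟩
    rw [hQ, hQv y' hm', h5, hqy] at this
    omega

/-- The rows below `x` have been processed. -/
structure RunInv (A B : List ℤ) (R : Par) (x : ℕ) (s : St) : Prop where
  env : Env A B R s
  good : R.Good B
  np_le : R.np ≤ B.length
  sp : s.v .sp = B.length / 2 ^ R.h + 1
  recs : Recs A B R (fun X _ => X < x) s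
  ptr_le : ∀ j ≤ 2 * R.np + 1, s.a .ptr j 0 0 ≤ s.v .cnt
  tree : ∀ j ≤ 2 * R.np + 1, ∀ l ≤ R.h, ∀ c ≤ B.length, s.a .tree j l c =
    mx (fun i => s.a .ru i 0 0) (s.a .ptr j 0 0)
      (fun i => s.a .rg i 0 0 < j ∧ s.a .rz i 0 0 / 2 ^ l = c)
  ptr_row : ∀ j ≤ 2 * R.np + 1, s.a .ptr j 0 0 = 0 ∨ ∃ X < x, X < A.length ∧
    R.grp B (sym A X) = j ∧ ∀ i, 1 ≤ i → i < s.a .ptr j 0 0 → s.a .rx i 0 0 < X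

theorem RunInv.congr {s s' : St} {x : ℕ} (h : RunInv A B R x s) (hv : ∀ v, v ≠ .x → s'.v v = s.v v)
    (ha : s'.a = s.a) (hi : s'.inp = s.inp) : RunInv A B R x s' := by
  obtain ⟨h1, h2, h3, h4, h5, h6, h7, h8⟩ := h
  refine ⟨h1.congr ?_ (by simp [ha]) hi, h2, h3, (hv _ (by simp)).trans h4,
    h5.same (hv _ (by simp)) (by rw [ha]) (by rw [ha]) (by rw [ha]) (by rw [ha]) (by rw [ha]),
    ?_, ?_, ?_⟩
  · rintro v (rfl | rfl | rfl | rfl | rfl | rfl) <;> exact hv _ (by simp)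
  · rw [ha, hv .cnt (by simp)]; exact h6
  · rw [ha]; exact h7
  · rw [ha]; exact h8

theorem Fresh.runInv {s : St} (h : Fresh A B R s) : RunInv A B R 0 s := by
  refine ⟨h.env, h.good, h.np_le, h.sp, ⟨h.cnt.ge, h.rz, h.ru, h.rg, ?_, by simp, ?_, ?_, by simp,
    fun y hy => Or.inl (h.d y hy)⟩, fun j hj => ?_, fun j hj l hl c hc => ?_,
    fun j hj => Or.inl (h.ptr j hj)⟩
  · intro i h1 h2; have := h.cnt; omega
  · intro i i' h1 h2 h3; have := h.cnt; omega
  · intro i i' h1 h2 h3; have := h.cnt; omega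
  · rw [h.ptr j hj]; omega
  · rw [h.ptr j hj, mx_zero, h.tree j hj l hl c hc]

/-- The total number of records absorbed by all groups. -/
def absorbed (R : Par) (s : St) : ℕ := ∑ j ∈ Finset.range (2 * R.np + 2), s.a .ptr j 0 0

/-- Amortization of one row: `Δ` is the number of newly absorbed records and `S` the potential
before the row. Absorbing and trying a record costs `(350 + 1000) H`, which the rise `1500 H` of the
potential pays for. -/
theorem row_cost {c c3 c4 np P T H Δ S : ℕ} (hnp : np ≤ P) (hH : 1 ≤ H)
    (h3 : c3 ≤ c + 200 * np + Δ * (350 * H) + 150 * (T + 1) + 350)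
    (h4 : c4 ≤ c3 + Δ * (1000 * H) + (T + 1) * (800 * H) + 120) :
    c4 + 1500 * H * S ≤ c + 2000 * H * (P + T + 1) + 1500 * H * (S + Δ) := by
  have e1 : 1500 * H * (S + Δ) = 1500 * H * S + 1500 * (H * Δ) := by ring
  have e2 : Δ * (350 * H) + Δ * (1000 * H) = 1350 * (H * Δ) := by ring
  have e3 : (T + 1) * (800 * H) = 800 * (H * (T + 1)) := by ring
  have e4 : 2000 * H * (P + T + 1) = 2000 * (H * P) + 2000 * (H * (T + 1)) := by ring
  have e5 : P ≤ H * P := Nat.le_mul_of_pos_left _ hH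
  have e6 : T + 1 ≤ H * (T + 1) := Nat.le_mul_of_pos_left _ hH
  omega

/-- Find the significant pairs of row `x`. -/
def processRow : Cmd :=
  Var.z ≔ Var.x ;; countPivots ;; Var.j ≔ Var.lo + Var.le + 1 ;; absorb ;; prefixMax ;;
    .ite (.lt Var.lo Var.le) scanRecords scanGroup

theorem processRow_spec {s : St} {x : ℕ} (h : RunInv A B R x s) (hx : s.v .x = x)
    (hxA : x < A.length) (hhb : R.h + 2 < bd) (hbl : 4 * (A.length + B.length) + 20 < bd)
    (hcb : A.length * B.length + 3 < bd) :
    processRow.wp bd (A.length + B.length) (fun s' => RunInv A B R (x + 1) s' ∧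
      s'.clk + 1500 * (R.h + 1) * absorbed R s ≤
        s.clk + 2000 * (R.h + 1) * (2 ^ R.h + B.length / 2 ^ R.h + 1) +
          1500 * (R.h + 1) * absorbed R s') s := by
  have b0 : 0 < bd := by omega
  have b1 : 1 < bd := by omega
  obtain ⟨henv, hgood, hnp, hsp, hrec, hpl, htree, hpr⟩ := h
  have hcnt := hrec.cnt_le
  set σ := sym A x with hσ
  have l1 := Par.ltc_le_lec (R := R) (B := B) σ R.np
  have l2 := Par.lec_le (R := R) (B := B) σ R.np
  obtain ⟨j, hj⟩ : ∃ j, j = R.grp B σ := ⟨_, rfl⟩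
  have hjl : j ≤ 2 * R.np + 1 := hj ▸ Par.grp_le _
  have hjb : j < bd := by omega
  rw [processRow, Cmd.wp_seq', Cmd.wp_assign]
  refine ⟨trivial, Cmd.wp_seq (countPivots_spec (R := R) (B := B) (A := A)
      (henv.base.congr (by simp) (by simp) (by simp)) (by simp [henv.eq_np])
      (fun i hi => ⟨by simp [henv.pv i hi], henv.pv_lt i hi⟩) hbl
      (by omega) (by simp [hx]; omega)) ?_⟩
  rintro s1 ⟨p1, p2, p3⟩ hs1
  simp [hx, henv.base.inpA x hxA] at p1 p2 p3
  rw [← hσ] at p1 p2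
  have ha1 : s1.a = s.a := by funext k; rw [hs1.a k (by cases k <;> rfl)]; simp
  rw [Cmd.wp_seq', Cmd.wp_assign]
  refine ⟨by simp [p1, p2, b1]; omega, ?_⟩
  simp only [Expr.eval_add, Expr.eval_var, Expr.eval_one, p1, p2]
  rw [show R.ltc B σ R.np + R.lec B σ R.np + 1 = j from hj.symm]
  have hv1 : ∀ v, v ≠ .z → v ≠ .lo → v ≠ .le → v ≠ .i → s1.v v = s.v v := by
    intro v n1 n2 n3 n4
    rw [hs1.v v (by cases v <;> first | rfl | contradiction)]
    simp [n1]
  set n := s.v .cnt with hn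
  refine Cmd.wp_seq (absorb_spec (j := j) (h := R.h) (n := n) (b := B.length)
    (old := s.a .ptr j 0 0) (f := fun i => s.a .ru i 0 0) (z := fun i => s.a .rz i 0 0)
    (g := fun i => s.a .rg i 0 0) (by simp) (by simp [hv1, henv.eq_h]) (by simp [hv1, hn])
    (by simp [ha1]) (hpl j hjl) hjb hhb (by omega) (by omega) (by omega) (by simp [ha1])
    (by simp [ha1]) (by simp [ha1]) (fun i hi => hrec.rz_le hi)
    (by simpa [ha1] using htree j hjl)) ?_
  rintro s2 ⟨q1, q2, q3, q4, q5, q6⟩ hs2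
  simp at q6
  have hv2 : ∀ v, v ≠ .z → v ≠ .lo → v ≠ .le → v ≠ .i → v ≠ .j → v ≠ .fin → v ≠ .old → v ≠ .u →
      v ≠ .node → v ≠ .l → s2.v v = s.v v := by
    intro v n1 n2 n3 n4 n5 n6 n7 n8 n9 n10
    rw [hs2.v v (by cases v <;> first | rfl | contradiction)]
    simp [n5, hv1 v n1 n2 n3 n4]
  have hj2 : s2.v .j = j := by rw [hs2.v .j rfl]; simp
  have ha2 : ∀ k, k ≠ .tree → k ≠ .ptr → s2.a k = s.a k := by
    intro k n1 n2
    rw [hs2.a k (by cases k <;> first | rfl | contradiction)]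
    simp [ha1]
  refine Cmd.wp_seq (prefixMax_spec (j := j) (h := R.h) (n := n) (b := B.length)
    (f := fun i => s.a .ru i 0 0) (z := fun i => s.a .rz i 0 0)
    (g := fun i => s.a .rg i 0 0) hj2 (by rw [hv2] <;> simp [henv.eq_h])
    (by rw [hv2] <;> simp [hsp]) hjb (by omega) (by omega) q3) ?_
  rintro s3 ⟨r1, r2⟩ hs3
  have hv3 : ∀ v, v ≠ .z → v ≠ .lo → v ≠ .le → v ≠ .i → v ≠ .j → v ≠ .fin → v ≠ .old → v ≠ .u →
      v ≠ .node → v ≠ .l → s3.v v = s.v v := by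
    intro v n1 n2 n3 n4 n5 n6 n7 n8 n9 n10
    rw [hs3.v v (by cases v <;> first | rfl | contradiction), hv2 v n1 n2 n3 n4 n5 n6 n7 n8 n9 n10]
  have ha3 : ∀ k, k ≠ .tree → k ≠ .ptr → k ≠ .pre → s3.a k = s.a k := by
    intro k n1 n2 n3
    rw [hs3.a k (by cases k <;> first | rfl | contradiction), ha2 k n1 n2]
  have hinp3 : s3.inp = s.inp := by
    rw [hs3.inp rfl, hs2.inp rfl, St.tick_inp, St.set_inp, hs1.inp rfl]; simp
  have htree3 : s3.a .tree = s2.a .tree := hs3.a .tree rfl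
  have hptr3 : s3.a .ptr = s2.a .ptr := hs3.a .ptr rfl
  have henv3 : Env A B R s3 := henv.congr
    (by rintro v (rfl | rfl | rfl | rfl | rfl | rfl) <;> (rw [hv3] <;> simp))
    (by rintro v (rfl | rfl) <;> (rw [ha3] <;> simp)) hinp3
  have hrec3 : Recs A B R (fun X _ => X < x) s3 := by
    apply hrec.same
    · rw [hv3] <;> simp
    all_goals (rw [ha3] <;> simp)
  have hkeep3 : Keep s s3 := Keep.of_eq (by rw [hv3] <;> simp)
    (by rintro k (rfl | rfl | rfl | rfl) <;> (rw [ha3] <;> simp))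
  have hlook3 : Look R.h B.length j n (fun i => s.a .ru i 0 0) (fun i => s.a .rz i 0 0)
      (fun i => s.a .rg i 0 0) s3 :=
    ⟨by rw [hs3.v .j rfl, hj2], henv3.eq_h, by rw [htree3]; exact q3, r1⟩
  have hlo3 : s3.v .lo = R.ltc B σ R.np := by
    rw [hs3.v .lo rfl, hs2.v .lo rfl]; simp [p1]
  have hle3 : s3.v .le = R.lec B σ R.np := by
    rw [hs3.v .le rfl, hs2.v .le rfl]; simp [p2]
  -- All queries of this row refer to the records present at its start, hence to one fixed function
  -- `Q`; pairs of the same row are never predecessors of each other.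
  obtain ⟨Q, hQ⟩ : ∃ Q : ℕ → ℕ, ∀ ζ, mx (fun i => s.a .ru i 0 0) n
      (fun i => s.a .rg i 0 0 < j ∧ s.a .rz i 0 0 < ζ) = Q ζ := ⟨_, fun ζ => rfl⟩
  have hQm : Monotone Q := by
    intro a b hab
    rw [← hQ, ← hQ]
    exact mx_le fun i hi hp => le_mx (f := fun i => s.a .ru i 0 0) hi
      (P := fun i => s.a .rg i 0 0 < j ∧ s.a .rz i 0 0 < b) ⟨hp.1, hp.2.trans_le hab⟩
  have hjm : ∀ {y}, Mt A B x y → R.grp B (sym B y) = j := fun hm => by rw [hj, hσ, hm.2.2]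
  have hQ1 : ∀ y, Mt A B x y → Q (y + 1) ≤ val A B x y := fun y hm => by
    have := hrec.mx_le_val hm
    rwa [hjm hm, hQ] at this
  have hQ2 : ∀ y c, Mt A B x y → (∀ y' < y, R.grp B (sym B y') = j → sym B y' < sym A x →
      ∀ x' < x, IsSignificant A B (x', y') → val A B x' y' + 1 ≤ c) →
      val A B x y ≤ max (Q (y + 1)) c := fun y c hm hc => by
    have := hrec.val_le_mx (c := c) hm (by rw [hjm hm, ← hm.2.2]; exact hc)
    rwa [hjm hm, hQ] at this
  have hold : s.a .ptr j 0 0 ≤ n := hpl j hjl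
  -- Only the pointer of the group `j` has moved.
  have hSn : absorbed R s + (n - s.a .ptr j 0 0) =
      ∑ j' ∈ Finset.range (2 * R.np + 2), s3.a .ptr j' 0 0 := by
    unfold absorbed
    have hmem : j ∈ Finset.range (2 * R.np + 2) := Finset.mem_range.mpr (by omega)
    rw [← Finset.add_sum_erase _ _ hmem, ← Finset.add_sum_erase _ (fun j' => s3.a .ptr j' 0 0) hmem]
    have e1 : ∑ j' ∈ (Finset.range (2 * R.np + 2)).erase j, s3.a .ptr j' 0 0 =
        ∑ j' ∈ (Finset.range (2 * R.np + 2)).erase j, s.a .ptr j' 0 0 := by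
      apply Finset.sum_congr rfl
      intro j' hj'
      rw [hptr3, q5, if_neg (Finset.ne_of_mem_erase hj')]
      simp [ha1]
    rw [e1, hptr3, q5, if_pos rfl]
    omega
  -- Common to both kinds of rows: the rest of the invariant needs only that old records, trees and
  -- pointers are kept.
  have hfinal : ∀ s4 : St, Recs A B R (fun X _ => X < x + 1) s4 → Keep s3 s4 →
      (∀ v, v = .a ∨ v = .b ∨ v = .h ∨ v = .p ∨ v = .np ∨ v = .m ∨ v = .sp → s4.v v = s3.v v) →
      (∀ k, k = .pv ∨ k = .nxt ∨ k = .tree ∨ k = .ptr → s4.a k = s3.a k) → s4.inp = s3.inp →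
      RunInv A B R (x + 1) s4 ∧ absorbed R s + (n - s.a .ptr j 0 0) = absorbed R s4 := by
    intro s4 hr hk hv ha hi
    have hk4 := hkeep3.trans hk
    have hptr4 : ∀ j', s4.a .ptr j' 0 0 = if j' = j then n else s.a .ptr j' 0 0 := fun j' => by
      rw [ha .ptr (by simp), hptr3, q5]; simp [ha1]
    have hptrle : ∀ j' ≤ 2 * R.np + 1, s4.a .ptr j' 0 0 ≤ n := fun j' hj' => by
      rw [hptr4]; split_ifs; exacts [le_rfl, hpl j' hj']
    refine ⟨⟨henv3.congr (fun v h => hv v (by tauto)) (fun k h => ha k (by tauto)) hi, hgood, hnp,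
      ?_, hr, fun j' hj' => (hptrle j' hj').trans hk4.cnt_le, fun j' hj' l hl c hc => ?_,
      fun j' hj' => ?_⟩, ?_⟩
    · rw [hv _ (by simp), hv3] <;> simp [hsp]
    · have e : s4.a .tree j' l c = mx (fun i => s.a .ru i 0 0) (s4.a .ptr j' 0 0)
          (fun i => s.a .rg i 0 0 < j' ∧ s.a .rz i 0 0 / 2 ^ l = c) := by
        rw [ha .tree (by simp), htree3, hptr4]
        split_ifs with hjj
        · subst hjj; exact q3 l hl c hc
        · rw [q4 j' l c hjj]
          simpa [ha1] using htree j' hj' l hl c hc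
      rw [e]
      refine mx_congr (fun i hi _ => ?_) (fun i hi => ?_)
      · rw [hk4.eq .ru (by simp) i (hi.trans_le (hptrle j' hj'))]
      · rw [hk4.eq .rg (by simp) i (hi.trans_le (hptrle j' hj')),
          hk4.eq .rz (by simp) i (hi.trans_le (hptrle j' hj'))]
    · have hrx : ∀ i, i < s4.a .ptr j' 0 0 → s4.a .rx i 0 0 = s.a .rx i 0 0 := fun i hi =>
        hk4.eq .rx (by simp) i (hi.trans_le (hptrle j' hj')) 0 0
      -- For the group `j` the witness is the present row `x`, as everything absorbed comes from
      -- rows before it.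
      by_cases hjj : j' = j
      · right
        refine ⟨x, by omega, hxA, by rw [hjj, hj], fun i h1 h2 => ?_⟩
        rw [hrx i h2]
        obtain ⟨y, -, h3, -⟩ := hrec.sound i h1 (h2.trans_le (hptrle j' hj'))
        exact h3
      · rw [hptr4, if_neg hjj] at hrx ⊢
        rcases hpr j' hj' with h1 | ⟨X, h1, h2, h3, h4⟩
        · exact Or.inl h1
        · exact Or.inr ⟨X, by omega, h2, h3, fun i h5 h6 => by rw [hrx i h6]; exact h4 i h5 h6⟩
    · rw [hSn]
      unfold absorbed
      rw [ha .ptr (by simp)]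
  have hnp2 := hgood.np_le
  have hpow : 1 ≤ 2 ^ R.h := Nat.one_le_two_pow
  have hclk3 : s3.clk ≤ s.clk + 200 * R.np + (n - s.a .ptr j 0 0) * (350 * (R.h + 1)) +
      150 * (B.length / 2 ^ R.h + 1) + 350 := by
    omega
  refine Cmd.wp_ite (by simp) (fun ht => ?_) (fun ht => ?_)
  · simp only [Cond.holds, Expr.eval_var, hlo3, hle3] at ht
    have hQv : ∀ y, Mt A B x y → Q (y + 1) = val A B x y := fun y hm => by
      refine le_antisymm (hQ1 y hm) ?_
      -- The group of a pivot contains no smaller symbol, so nothing is left to the running maximum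
      -- and `c = 0` is allowed.
      have := hQ2 y 0 hm (fun y' _ h2 h3 => by
        rw [hj] at h2
        have : sym B y' = σ := Par.IsPivot.grp_eq_iff (R := R) ht |>.mp h2
        omega)
      simpa using this
    refine Cmd.wp_conseq (Cmd.wp_same _ _ (scanRecords_spec (A := A) (B := B) (R := R) (x := x)
      (j := j) (old := s.a .ptr j 0 0) (n := n) (Q := Q)
      (f := fun i => s.a .ru i 0 0) (z := fun i => s.a .rz i 0 0) (g := fun i => s.a .rg i 0 0)
      (henv3.congr (by simp) (by simp) (by simp)) (hlook3.congr (by simp) (by simp) (by simp)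
      (by simp)) (by simp only [St.tick_v]; rw [hv3] <;> simp [hx]) hxA hj ht
      (by simp only [St.tick_v]; rw [hs3.v _ rfl, q1])
      (by simp only [St.tick_v]; rw [hs3.v _ rfl, q2]) hold
      (by simp only [St.tick_v]; rw [hv3] <;> simp [hn])
      (fun i hi => by simp only [St.tick_a]; rw [ha3] <;> simp)
      (fun i hi => by simp only [St.tick_a]; rw [ha3] <;> simp)
      (hrec3.same (by simp) (by simp) (by simp) (by simp) (by simp) (by simp)) hQ hQm hQv hhb hnp
      hbl (by omega))) ?_
    rintro s4 ⟨⟨t1, t2, t3⟩, hs4⟩ -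
    obtain ⟨u1, u2⟩ := hfinal s4
      (t1.congr fun X Y hsig => ⟨by rintro (h | h) <;> omega, fun h => by
        rcases Nat.lt_succ_iff_lt_or_eq.mp h with h | rfl
        · exact Or.inl h
        · exact Or.inr ⟨rfl, hrec.exists_new hj ht (hpr j hjl) hQ hQm hQv hsig⟩⟩)
      ⟨t2.cnt_le, t2.eq⟩
      (by rintro v (rfl|rfl|rfl|rfl|rfl|rfl|rfl) <;> (rw [hs4.v _ rfl]; simp))
      (by rintro v (rfl|rfl|rfl|rfl) <;> (rw [hs4.a _ rfl]; simp)) (by rw [hs4.inp rfl]; simp)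
    refine ⟨u1, ?_⟩
    simp only [St.tick_clk, Cond.cost, Expr.cost_var] at t3
    rw [← u2]
    exact row_cost hnp2 (by omega) hclk3 (by omega)
  · simp only [Cond.holds, Expr.eval_var, hlo3, hle3] at ht
    have hsparse := hgood.sparse σ ht
    refine Cmd.wp_conseq (Cmd.wp_same _ _ (scanGroup_spec (A := A) (B := B) (R := R) (x := x)
      (j := j) (n := n)
      (f := fun i => s.a .ru i 0 0) (z := fun i => s.a .rz i 0 0) (g := fun i => s.a .rg i 0 0)
      (henv3.congr (by simp) (by simp) (by simp)) (hlook3.congr (by simp) (by simp) (by simp)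
      (by simp)) (by simp only [St.tick_v]; rw [hv3] <;> simp [hx]) hxA hj
      (hrec3.same (by simp) (by simp) (by simp) (by simp) (by simp) (by simp))
      (by simpa only [hQ] using hQ1) (by simpa only [hQ] using hQ2) hhb hnp
      hbl (by omega))) ?_
    rintro s4 ⟨⟨t1, t2, t3⟩, hs4⟩ -
    obtain ⟨u1, u2⟩ := hfinal s4 t1 ⟨t2.cnt_le, t2.eq⟩
      (by rintro v (rfl|rfl|rfl|rfl|rfl|rfl|rfl) <;> (rw [hs4.v _ rfl]; simp))
      (by rintro v (rfl|rfl|rfl|rfl) <;> (rw [hs4.a _ rfl]; simp)) (by rw [hs4.inp rfl]; simp)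
    refine ⟨u1, ?_⟩
    simp only [St.tick_clk, Cond.cost, Expr.cost_var] at t3
    rw [← u2]
    rw [← hj] at hsparse
    have := Nat.mul_le_mul_right (800 * (R.h + 1)) hsparse
    exact row_cost hnp2 (by omega) hclk3 (by omega)

end Imp


/-! ## Runs with decreasing numbers of groups -/

namespace Imp

open LCIS

variable {A B : List ℤ} {bd : ℕ} {R : Par}

/-- Process all rows, unless there are too many records. -/
def runRows : Cmd :=
  Var.x ≔ 0 ;; .upto .x Var.a (.ite (.lt Var.cap Var.cnt) .skip processRow)

/-- Once the limit is exceeded the remaining rows are skipped, so at most `cap + |B| + 1` records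
ever exist. Each of the `2 np + 2` pointers is bounded by that number, and so the total potential is
bounded. -/
theorem runRows_spec {s : St} {cap : ℕ} (h : RunInv A B R 0 s) (hcap : s.v .cap = cap)
    (hc1 : s.v .cnt ≤ 1)
    (hhb : R.h + 2 < bd) (hbl : 4 * (A.length + B.length) + 20 < bd)
    (hcb : A.length * B.length + 3 < bd) :
    runRows.wp bd (A.length + B.length) (fun s' => ∃ x, x ≤ A.length ∧ RunInv A B R x s' ∧
      (s'.v .cnt ≤ cap → x = A.length) ∧
      s'.clk ≤ s.clk + A.length * (2000 * (R.h + 1) * (2 ^ R.h + B.length / 2 ^ R.h + 1) + 50) +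
        1500 * (R.h + 1) * ((2 * R.np + 2) * (cap + B.length + 1)) + 50) s := by
  have b0 : 0 < bd := by omega
  rw [runRows, Cmd.wp_seq', Cmd.wp_assign]
  refine ⟨b0, Cmd.wp_upto (fun k s' => s'.v .x = k ∧ s'.v .cap = cap ∧ ∃ x, x ≤ k ∧
    RunInv A B R x s' ∧ (s'.v .cnt ≤ cap → x = k) ∧ s'.v .cnt ≤ cap + B.length + 1 ∧
      s'.clk ≤ s.clk + k * (2000 * (R.h + 1) * (2 ^ R.h + B.length / 2 ^ R.h + 1) + 50) +
        1500 * (R.h + 1) * absorbed R s' + 20) 0 A.length (by omega) (by omega) ?_ ?_ ?_ ?_⟩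
  · rintro k s1 ⟨h1, -, x, -, h2, -⟩
    exact ⟨h1, by simp [h2.env.base.a], trivial⟩
  · refine ⟨by simp, by simp [hcap], 0, le_rfl, h.congr (fun v hv => by simp [hv]) (by simp) (by simp),
      fun _ => rfl, by simp; omega, ?_⟩
    simp
    omega
  · rintro k s1 - hk ⟨h1, h2, x, h3, h4, h5, h6, h7⟩
    have hmul : ∀ c, (k + 1) * (c + 50) = k * (c + 50) + c + 50 := fun c => by ring
    refine Cmd.wp_ite (by simp) (fun ht => ?_) (fun ht => ?_)
    · simp only [Cond.holds, Expr.eval_var, St.tick_v, h2] at ht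
      refine ⟨by simp [h1], by simp, by simp [h2], x, by omega,
        h4.congr (fun v hv => by simp [hv]) (by simp) (by simp), fun h => ?_, by simpa using h6, ?_⟩
      · simp at h; omega
      · rw [hmul]
        have e : absorbed R (((((s1.tick ((Expr.var Var.a).cost + 6)).tick
          ((Cond.lt (Expr.var Var.cap) (Expr.var Var.cnt)).cost + 2)).set Var.x (k + 1)).tick 6)) =
          absorbed R s1 := rfl
        rw [e]
        simp only [St.tick_clk, St.set_clk, Cond.cost, Expr.cost_var]
        omega
    · simp only [Cond.holds, Expr.eval_var, St.tick_v, h2, not_lt] at ht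
      obtain rfl := h5 ht
      refine Cmd.wp_conseq (processRow_spec (x := x)
        (h4.congr (fun v hv => by simp) (by simp) (by simp)) (by simpa using h1) hk hhb hbl hcb) ?_
      rintro s2 ⟨g1, g2⟩ hs2
      have hc := h4.recs.cnt_succ_le g1.recs
      have hcap2 : s2.v .cap = cap := by rw [hs2.v _ rfl]; simpa using h2
      refine ⟨by rw [hs2.v _ rfl]; simpa using h1, by simp, by simpa using hcap2, x + 1, le_rfl,
        g1.congr (fun v hv => by simp [hv]) (by simp) (by simp), fun _ => rfl, by simp; omega, ?_⟩
      rw [hmul]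
      have e : absorbed R (((s1.tick ((Expr.var Var.a).cost + 6)).tick
          ((Cond.lt (Expr.var Var.cap) (Expr.var Var.cnt)).cost + 2))) = absorbed R s1 := rfl
      have e' : absorbed R ((s2.set .x (x + 1)).tick 6) = absorbed R s2 := rfl
      rw [e] at g2
      rw [e']
      simp only [St.tick_clk, St.set_clk, Cond.cost, Expr.cost_var] at g2 ⊢
      omega
  · rintro s1 ⟨h1, h2, x, h3, h4, h5, h6, h7⟩
    refine ⟨x, h3, h4.congr (by simp) rfl rfl, h5, ?_⟩
    have hS : absorbed R s1 ≤ (2 * R.np + 2) * (cap + B.length + 1) := by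
      unfold absorbed
      refine (Finset.sum_le_card_nsmul _ _ (cap + B.length + 1) fun j hj => ?_).trans (by simp)
      exact (h4.ptr_le j (by rw [Finset.mem_range] at hj; omega)).trans h6
    have := Nat.mul_le_mul_left (1500 * (R.h + 1)) hS
    simp only [St.tick_clk, Expr.cost_var]
    omega

/-- The three main terms are the setup `P N`, the rows `N (P + N / P)` and the absorptions `P ((N /
P) ^ 2 + N)`, each times `h + 1`. After multiplication by `P` all are `O((h + 1) N ^ 2)` because `P
^ 2 ≤ N`. -/
theorem run_cost {N a b np h P c : ℕ} (hP : P * P ≤ N) (hP1 : 1 ≤ P) (hab : a + b + 2 ≤ N)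
    (hnp : np ≤ P)
    (hc : c ≤ 2500 * (P * N * (h + 1)) + (a * (2000 * (h + 1) * (P + b / P + 1) + 50) +
        1500 * (h + 1) * ((2 * np + 2) * (N / P * (N / P) + b + 1)) + 50)) :
    c * P ≤ 29000 * ((h + 1) * (N * N)) := by
  have hq : b / P * P ≤ b := Nat.div_mul_le_self b P
  have hq2 : N / P * P ≤ N := Nat.div_mul_le_self N P
  generalize b / P = q at *
  generalize N / P = r at *
  have hPN : P ≤ N := le_trans (Nat.le_mul_of_pos_left _ hP1) hP
  have e1 : P * N * (h + 1) * P ≤ (h + 1) * (N * N) := by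
    calc P * N * (h + 1) * P = (h + 1) * (P * P * N) := by ring
      _ ≤ _ := by gcongr
  have e2 : a * (2000 * (h + 1) * (P + q + 1) + 50) * P ≤ 6050 * ((h + 1) * (N * N)) := by
    have f1 : (P + q + 1) * P ≤ 3 * N := by
      calc (P + q + 1) * P = P * P + q * P + P := by ring
        _ ≤ _ := by omega
    calc a * (2000 * (h + 1) * (P + q + 1) + 50) * P
        = 2000 * ((h + 1) * (a * ((P + q + 1) * P))) + 50 * (1 * (a * P)) := by ring
      _ ≤ 2000 * ((h + 1) * (N * (3 * N))) + 50 * ((h + 1) * (N * N)) := by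
        gcongr
        · omega
        · omega
        · omega
      _ = _ := by ring
  have e3 : 1500 * (h + 1) * ((2 * np + 2) * (r * r + b + 1)) * P ≤
      12000 * ((h + 1) * (N * N)) := by
    have f1 : (r * r + b + 1) * (P * P) ≤ 2 * (N * N) := by
      calc (r * r + b + 1) * (P * P) = (r * P) * (r * P) + (b + 1) * (P * P) := by ring
        _ ≤ N * N + N * N := by
          gcongr
          omega
        _ = _ := by ring
    calc 1500 * (h + 1) * ((2 * np + 2) * (r * r + b + 1)) * P
        ≤ 1500 * (h + 1) * ((4 * P) * (r * r + b + 1)) * P := by gcongr; omega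
      _ = 6000 * ((h + 1) * ((r * r + b + 1) * (P * P))) := by ring
      _ ≤ 6000 * ((h + 1) * (2 * (N * N))) := by gcongr
      _ = _ := by ring
  have e4 : P ≤ (h + 1) * (N * N) :=
    hPN.trans ((Nat.le_mul_of_pos_left _ (by omega)).trans (Nat.le_mul_of_pos_left _ (by omega)))
  calc c * P ≤ (2500 * (P * N * (h + 1)) + (a * (2000 * (h + 1) * (P + q + 1) + 50) +
        1500 * (h + 1) * ((2 * np + 2) * (r * r + b + 1)) + 50)) * P := by gcongr
    _ = 2500 * (P * N * (h + 1) * P) + a * (2000 * (h + 1) * (P + q + 1) + 50) * P +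
        1500 * (h + 1) * ((2 * np + 2) * (r * r + b + 1)) * P + 50 * P := by ring
    _ ≤ _ := by omega

/-- One run. -/
def runOnce : Cmd := setup ;; runRows

theorem runOnce_spec {s : St} {L h : ℕ} (hs : Base A B s) (hL : Sorted B L s)
    (hp : s.v .p = 2 ^ h) (hh : s.v .h = h) (hm : s.v .m = A.length + B.length + 2)
    (hpm : 2 ^ h * 2 ^ h ≤ A.length + B.length + 2)
    (hbd : 64 * ((A.length + B.length + 2) * (A.length + B.length + 2)) ≤ bd) :
    runOnce.wp bd (A.length + B.length) (fun s' => ∃ R : Par, R.h = h ∧ ∃ x, x ≤ A.length ∧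
      RunInv A B R x s' ∧ (s'.v .cnt ≤ s'.v .cap → x = A.length) ∧
      s'.v .cap = ((A.length + B.length + 2) / 2 ^ h) * ((A.length + B.length + 2) / 2 ^ h) ∧
      s'.clk * 2 ^ h ≤ s.clk * 2 ^ h +
        29000 * ((h + 1) * ((A.length + B.length + 2) * (A.length + B.length + 2)))) s := by
  have hP1 := Nat.one_le_two_pow (n := h)
  have hpm' : 2 ^ h ≤ A.length + B.length + 2 :=
    le_trans (Nat.le_mul_of_pos_left _ hP1) hpm
  have hbl : 4 * (A.length + B.length) + 20 < bd := by nlinarith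
  have hcb : A.length * B.length + 3 < bd := by nlinarith
  have hlt := Nat.lt_two_pow_self (n := h)
  refine Cmd.wp_seq (setup_spec hs hL hp hh hm hpm' hbd) ?_
  rintro s1 ⟨R, rfl, h1, h2⟩ hs1
  refine Cmd.wp_conseq (Cmd.wp_same _ _ (runRows_spec h1.runInv h1.cap h1.cnt.le
    (by have := hlt.trans_le hpm'; omega) hbl hcb)) ?_
  rintro s2 ⟨⟨x, g1, g2, g3, g4⟩, hs2⟩ -
  have hcap : s2.v .cap = _ := (hs2.v .cap rfl).trans h1.cap
  refine ⟨R, rfl, x, g1, g2, by rw [hcap]; exact g3, hcap, ?_⟩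
  have := run_cost (N := A.length + B.length + 2) (a := A.length) (b := B.length) (np := R.np)
    (h := R.h) (P := 2 ^ R.h) (c := s2.clk - s.clk) hpm hP1 le_rfl h1.good.np_le (by omega)
  rw [Nat.sub_mul] at this
  omega

/-- The greatest power of two whose fourth power is at most `m`. -/
def initPower : Cmd :=
  Var.p ≔ 1 ;; Var.h ≔ 0 ;;
  .whileDo (.lt (16 * (Var.p * Var.p * (Var.p * Var.p))) (Var.m + 1))
    (Var.p ≔ 2 * Var.p ;; Var.h ≔ Var.h + 1)

/-- The upper bound on `16 ^ h` keeps `4 ^ h ≤ N` for the cost of the runs; the lower one bounds `N`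
by a power of `2 ^ h`, which is needed when no run is cut off. -/
theorem initPower_spec {s : St} {N len : ℕ} (hm : s.v .m = N) (hN : 1 ≤ N)
    (hbd : 64 * (N * N) ≤ bd) :
    initPower.wp bd len (fun s' => ∃ h, s'.v .h = h ∧ s'.v .p = 2 ^ h ∧ 16 ^ h ≤ N ∧
      N < 16 * 16 ^ h ∧ s'.clk ≤ s.clk + 100 * (h + 1)) s := by
  have hNN : N ≤ N * N := Nat.le_mul_of_pos_left _ hN
  have b1 : 1 < bd := by omega
  have b2 : 2 < bd := by omega
  have b16 : 16 < bd := by omega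
  have b0 : 0 < bd := by omega
  have hpow : ∀ h : ℕ, 2 ^ h * 2 ^ h * (2 ^ h * 2 ^ h) = 16 ^ h := fun h => by
    rw [← mul_pow, ← mul_pow]; norm_num
  simp only [initPower, Cmd.wp_seq', Cmd.wp_assign, Expr.ok_one, Expr.ok_zero, Expr.eval_one,
    Expr.eval_zero]
  refine ⟨b1, b0, Cmd.wp_while (fun s' => ∃ h, s'.v .h = h ∧ s'.v .p = 2 ^ h ∧ s'.v .m = N ∧
    16 ^ h ≤ N ∧ s'.clk ≤ s.clk + 100 * h + 20) (fun s' => N + 1 - s'.v .p) ?_ ?_ ?_ _ ?_⟩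
  · rintro s1 ⟨h, h1, h2, h3, h4, h5⟩
    have e := hpow h
    have e1 : 2 ^ h * 2 ^ h ≤ 16 ^ h := by
      rw [← e]; exact Nat.le_mul_of_pos_left _ (by positivity)
    simp [h2, h3, b16, b1, e]
    omega
  · rintro s1 ⟨h, h1, h2, h3, h4, h5⟩ ht
    have e := hpow h
    simp [h2, h3, e] at ht
    have e1 : 2 ^ h ≤ 16 ^ h := Nat.pow_le_pow_left (by omega) h
    have e2 := Nat.one_le_two_pow (n := h)
    have hh : h < 2 ^ h := Nat.lt_two_pow_self
    simp [h1, h2, h3, b1, b2]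
    refine ⟨by omega, by omega, ⟨by ring, by rw [pow_succ]; omega, by omega⟩, by omega⟩
  · rintro s1 ⟨h, h1, h2, h3, h4, h5⟩ ht
    have e := hpow h
    simp [h2, h3, e] at ht
    refine ⟨h, h1, h2, h4, by omega, ?_⟩
    simp only [St.tick_clk, Cond.cost, Expr.cost_mul, Expr.cost_add, Expr.cost_var, Expr.cost_one,
      Expr.cost_ofNat]
    omega
  · exact ⟨0, by simp [hm, hN]⟩

/-- Run with fewer and fewer groups until the records fit. -/
def runAll : Cmd :=
  Var.done ≔ 0 ;; .whileDo (.lt Var.done 1)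
    (runOnce ;; .ite (.lt Var.cap Var.cnt) (Var.p ≔ Var.p / 2 ;; Var.h ≔ Var.h - 1) (Var.done ≔ 1))

/-- In units of `30000 N ^ 2 / 2 ^ h`, the time before the run with parameter `h` is at most `h +
3`; the run adds at most `h + 1`. Passing to `h' = h - 1` halves the sum `2 h + 4 = 2 (h' + 3)`, so
the bound reproduces itself. A run that was cut off shows that the significant pairs number at least
its limit. -/
theorem runAll_spec {s : St} {L h₀ : ℕ} (hs : Base A B s) (hL : Sorted B L s)
    (hp : s.v .p = 2 ^ h₀) (hh : s.v .h = h₀) (hm : s.v .m = A.length + B.length + 2)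
    (hpm : 2 ^ h₀ * 2 ^ h₀ ≤ A.length + B.length + 2)
    (hbd : 64 * ((A.length + B.length + 2) * (A.length + B.length + 2)) ≤ bd) :
    runAll.wp bd (A.length + B.length) (fun s' => Base A B s' ∧ ∃ R : Par,
      Recs A B R (fun X _ => X < A.length) s' ∧ ∃ h, h ≤ h₀ ∧
      (h = h₀ ∨ (A.length + B.length + 2) / 2 ^ (h + 1) * ((A.length + B.length + 2) / 2 ^ (h + 1)) ≤
        numSignificant A B) ∧
      s'.v .cnt ≤ (A.length + B.length + 2) / 2 ^ h * ((A.length + B.length + 2) / 2 ^ h) ∧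
      s'.clk * 2 ^ h ≤ s.clk * 2 ^ h +
        30000 * ((2 * h + 5) * ((A.length + B.length + 2) * (A.length + B.length + 2)))) s := by
  generalize hN : A.length + B.length + 2 = N at *
  have hNN : N ≤ N * N := Nat.le_mul_of_pos_left _ (by omega)
  have b0 : 0 < bd := by omega
  have b1 : 1 < bd := by omega
  have b2 : 2 < bd := by omega
  have hsmall : ∀ h ≤ h₀, 2 ^ h * 2 ^ h ≤ N := fun h hle =>
    le_trans (Nat.mul_le_mul (Nat.pow_le_pow_right (by omega) hle)
      (Nat.pow_le_pow_right (by omega) hle)) hpm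
  have hsmall' : ∀ h ≤ h₀, 2 ^ h ≤ N := fun h hle =>
    le_trans (Nat.le_mul_of_pos_left _ (by positivity)) (hsmall h hle)
  rw [runAll, Cmd.wp_seq', Cmd.wp_assign]
  refine ⟨b0, Cmd.wp_while (fun s' => Base A B s' ∧ ∃ h, h ≤ h₀ ∧ s'.v .h = h ∧
    s'.v .m = N ∧ (h = h₀ ∨ N / 2 ^ (h + 1) * (N / 2 ^ (h + 1)) ≤ numSignificant A B) ∧
    ((s'.v .done = 0 ∧ Sorted B L s' ∧ s'.v .p = 2 ^ h ∧
      s'.clk * 2 ^ h ≤ s.clk * 2 ^ h + 5 * 2 ^ h + 30000 * ((h + 3) * (N * N))) ∨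
    (s'.v .done = 1 ∧ ∃ R : Par, Recs A B R (fun X _ => X < A.length) s' ∧
      s'.v .cnt ≤ N / 2 ^ h * (N / 2 ^ h) ∧
      s'.clk * 2 ^ h + 100 * 2 ^ h ≤ s.clk * 2 ^ h + 30000 * ((2 * h + 5) * (N * N)))))
    (fun s' => s'.v .h + 1 - s'.v .done) ?_ ?_ ?_ _ ?_⟩
  · rintro s1 -; simp [b1]
  · rintro s1 ⟨h1, h, h2, h3, h4, h5, h6⟩ ht
    simp only [Cond.holds, Expr.eval_var, Expr.eval_one] at ht
    obtain ⟨h7, h8, h9, h10⟩ := h6.resolve_right (by omega)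
    have hP1 := Nat.one_le_two_pow (n := h)
    refine Cmd.wp_seq (runOnce_spec (h := h) (L := L) (h1.congr (by simp) (by simp) (by simp))
      (h8.congr (by simp) (by simp)) (by simpa using h9) (by simpa using h3) (by simp [h4, hN])
      (by rw [hN]; exact hsmall h h2) (by rw [hN]; exact hbd)) ?_
    rintro s2 ⟨R, g1, x, g2, g3, g4, g5, g6⟩ hs2
    have hclk : s2.clk * 2 ^ h + 200 * 2 ^ h ≤ s.clk * 2 ^ h + 30000 * ((2 * h + 4) * (N * N)) := by
      have e1 : 29000 * ((h + 1) * (N * N)) + 1000 * (N * N) * (h + 1) = 30000 * ((h + 1) * (N * N)) := by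
        ring
      have e2 : 30000 * ((h + 1) * (N * N)) + 30000 * ((h + 3) * (N * N)) =
        30000 * ((2 * h + 4) * (N * N)) := by ring
      have e3 : 1000 * (N * N) ≤ 1000 * (N * N) * (h + 1) := Nat.le_mul_of_pos_right _ (by omega)
      have e4 := hsmall' h h2
      rw [hN] at g6
      generalize (h + 1) * (N * N) = q1 at *
      generalize (h + 3) * (N * N) = q3 at *
      generalize (2 * h + 4) * (N * N) = q4 at *
      simp only [St.tick_clk, Cond.cost, Expr.cost_var, Expr.cost_one, add_mul] at g6
      omega
    have hb2 : Base A B s2 := g3.env.base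
    have hL2 : Sorted B L s2 := h8.congr (by rw [hs2.v _ rfl]; simp) (by rw [hs2.a _ rfl]; simp)
    rw [hN] at g5
    refine Cmd.wp_ite (by simp) (fun ht' => ?_) (fun ht' => ?_)
    · simp only [Cond.holds, Expr.eval_var, g5] at ht'
      have hcs := g3.recs.cnt_le_numSignificant
      have hcl := g3.recs.cnt_le
      -- For `h = 0` the limit is `N ^ 2`, which exceeds the number of all pairs; so the loop ends
      -- at the latest there.
      have hh0 : 0 < h := by
        by_contra hcon
        obtain rfl : h = 0 := by omega
        simp only [pow_zero, Nat.div_one] at ht'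
        nlinarith
      obtain ⟨h', rfl⟩ : ∃ h', h = h' + 1 := ⟨h - 1, by omega⟩
      simp [g3.env.eq_h, g3.env.eq_p, g1, b1, b2]
      refine ⟨⟨hb2.congr (by simp) (by simp) (by simp), by omega, ?_, Or.inr (by omega),
        Or.inl ⟨?_, hL2.congr (by simp) (by simp), by rw [pow_succ]; omega, ?_⟩⟩, ?_⟩
      · simp [g3.env.eq_m, hN]
      · simp [hs2.v .done rfl, h7]
      · rw [pow_succ] at hclk
        have e2 : 30000 * ((2 * (h' + 1) + 4) * (N * N)) =
          2 * (30000 * ((h' + 3) * (N * N))) := by ring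
        rw [e2] at hclk
        ring_nf at hclk ⊢
        omega
      · simp [hs2.v .done rfl, h7, h3]
    · simp only [Cond.holds, Expr.eval_var, g5, not_lt] at ht'
      obtain rfl := g4 (by rw [g5]; exact ht')
      simp [b1, g3.env.eq_h, g1]
      refine ⟨⟨hb2.congr (by simp) (by simp) (by simp), h2, ?_, h5, ⟨R, g3.recs.same (by simp)
        (by simp) (by simp) (by simp) (by simp) (by simp)⟩, ht', ?_⟩, by omega⟩
      · simp [g3.env.eq_m, hN]
      · have e : 30000 * ((2 * h + 4) * (N * N)) ≤ 30000 * ((2 * h + 5) * (N * N)) := by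
          gcongr; omega
        rw [add_mul, add_mul]
        omega
  · rintro s1 ⟨h1, h, h2, h3, h4, h5, h6⟩ ht
    simp only [Cond.holds, Expr.eval_var, Expr.eval_one] at ht
    obtain ⟨h7, R, h8, h9, h10⟩ := h6.resolve_left (by rintro ⟨h, -⟩; omega)
    refine ⟨h1.congr (by simp) (by simp) (by simp), R, h8.same rfl rfl rfl rfl rfl rfl, h, h2, h5,
      h9, ?_⟩
    generalize (2 * h + 5) * (N * N) = q5 at *
    simp only [St.tick_clk, Cond.cost, Expr.cost_var, Expr.cost_one, add_mul]
    omega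
  · refine ⟨hs.congr (by simp) (by simp) (by simp), h₀, le_rfl, by simp [hh], by simp [hm], Or.inl rfl,
      Or.inl ⟨by simp, hL.congr (by simp) (by simp), by simp [hp], ?_⟩⟩
    simp only [St.tick_clk, St.set_clk, Expr.cost_zero, add_mul]
    omega

end Imp


/-! ## Output of a longest common increasing subsequence -/

namespace Imp

open LCIS

variable {A B : List ℤ} {bd len : ℕ} {R : Par}

/-- Let `j` be a record of greatest worth. -/
def bestRecord : Cmd :=
  Var.j ≔ 0 ;; Var.i ≔ 0 ;; .upto .i Var.cnt
    (.ite (.lt (.ld .ru Var.j 0 0) (.ld .ru Var.i 0 0)) (Var.j ≔ Var.i) .skip)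

theorem bestRecord_spec {s : St} (hc : 1 ≤ s.v .cnt) (hb : s.v .cnt < bd) :
    bestRecord.wp bd len (fun s' => s'.v .j < s.v .cnt ∧
      (∀ i < s.v .cnt, s.a .ru i 0 0 ≤ s.a .ru (s'.v .j) 0 0) ∧
      s'.clk ≤ s.clk + 60 * s.v .cnt + 20) s := by
  have b0 : 0 < bd := by omega
  generalize hn : s.v .cnt = n at *
  simp only [bestRecord, Cmd.wp_seq', Cmd.wp_assign, Expr.ok_zero, Expr.eval_zero]
  refine ⟨b0, b0, Cmd.wp_upto (fun k s' => s'.v .i = k ∧ s'.v .cnt = n ∧ s'.a .ru = s.a .ru ∧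
    s'.v .j < n ∧ (∀ i < k, s.a .ru i 0 0 ≤ s.a .ru (s'.v .j) 0 0) ∧
      s'.clk ≤ s.clk + 60 * k + 4) 0 n (by omega) hb ?_ ?_ ?_ ?_⟩
  · rintro k s1 ⟨h1, h2, -⟩
    exact ⟨h1, h2, trivial⟩
  · refine ⟨by simp, by simpa using hn, rfl, by simp; omega, by simp, by simp⟩
  · rintro k s1 - hk ⟨h1, h2, h3, h4, h5, h6⟩
    refine Cmd.wp_ite (by simp [Cond.ok, h1, b0]; omega) (fun ht => ?_) (fun ht => ?_)
    · simp [Cond.holds, h1, h3] at ht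
      simp only [Cmd.wp_assign, Expr.ok_var, Expr.eval_var, true_and]
      refine ⟨by simp [h1], by simp, by simp [h2], by simp [h3], by simp [h1]; omega, ?_, ?_⟩
      · intro i hi
        simp only [St.tick_v, St.set_v, h1]
        rcases Nat.lt_succ_iff_lt_or_eq.mp hi with hi | rfl
        · exact (h5 i hi).trans ht.le
        · simp
      · simp [Cond.cost]; omega
    · simp [Cond.holds, h1, h3] at ht
      refine ⟨by simp [h1], by simp, by simp [h2], by simp [h3], by simpa using h4, ?_, ?_⟩
      · intro i hi
        rcases Nat.lt_succ_iff_lt_or_eq.mp hi with hi | rfl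
        · simpa using h5 i hi
        · simpa using ht
      · simp [Cond.cost]; omega
  · rintro s1 ⟨h1, h2, h3, h4, h5, h6⟩
    exact ⟨h4, h5, by simp; omega⟩

/-- The pair of a record. -/
def St.pair (s : St) (c : ℕ) : ℕ × ℕ := (s.a .rx c 0 0, s.a .rz c 0 0 - 1)

/-- The record `i` may precede the record `c` in an optimal sequence. -/
def Precedes (A : List ℤ) (s : St) (i c : ℕ) : Prop :=
  s.a .ru i 0 0 + 1 = s.a .ru c 0 0 ∧ s.a .rx i 0 0 < s.a .rx c 0 0 ∧
    s.a .rz i 0 0 < s.a .rz c 0 0 ∧ sym A (s.a .rx i 0 0) < sym A (s.a .rx c 0 0)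

namespace Recs

variable {s : St}

theorem pair_mt {D : ℕ → ℕ → Prop} (h : Recs A B R D s) {c : ℕ} (hc : 1 ≤ c) (hc' : c < s.v .cnt) :
    Mt A B (s.pair c).1 (s.pair c).2 ∧ s.a .rz c 0 0 = (s.pair c).2 + 1 ∧
      s.a .ru c 0 0 = val A B (s.pair c).1 (s.pair c).2 + 1 := by
  obtain ⟨y, h1, -, h2, h3, -⟩ := h.sound c hc hc'
  have e : (s.pair c).2 = y := by simp [St.pair, h1]
  rw [e]
  exact ⟨h2.mt, h1, h3⟩

theorem prec {D : ℕ → ℕ → Prop} (h : Recs A B R D s) {i c : ℕ} (hi : 1 ≤ i) (hi' : i < s.v .cnt)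
    (hc : 1 ≤ c) (hc' : c < s.v .cnt) (hp : Precedes A s i c) :
    Prec A B (s.pair i) (s.pair c) := by
  obtain ⟨h1, h2, -⟩ := h.pair_mt hi hi'
  obtain ⟨h3, h4, -⟩ := h.pair_mt hc hc'
  obtain ⟨-, h5, h6, h7⟩ := hp
  refine prec_iff.mpr ⟨h1, h3, h5, by omega, ?_⟩
  rw [← h1.2.2, ← h3.2.2]
  exact h7

/-- Records are ordered by rows and a predecessor lies in an earlier row, so its index is smaller.
This lets one sweep with decreasing index find the whole sequence. Worth `2` means value `1`. -/
theorem exists_precedes (h : Recs A B R (fun X _ => X < A.length) s) {c : ℕ} (hc : 1 ≤ c)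
    (hc' : c < s.v .cnt) : s.a .ru c 0 0 = 2 ∨ ∃ i, 1 ≤ i ∧ i < c ∧ Precedes A s i c := by
  obtain ⟨h1, h2, h3⟩ := h.pair_mt hc hc'
  rcases val_eq h1 with h4 | ⟨x, y, h4, h5, h6, h7, h8⟩
  · left; omega
  · right
    obtain ⟨i, g1, g2, g3, g4⟩ := h.complete x y h4.mt.1 h4
    have e : s.pair i = (x, y) := by simp [St.pair, g3, g4]
    obtain ⟨k1, k2, k3⟩ := h.pair_mt g1 g2
    rw [e] at k3
    have hx : s.a .rx i 0 0 < s.a .rx c 0 0 := by rw [g3]; exact h5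
    refine ⟨i, g1, ?_, by simp at k3; omega, hx, by omega, ?_⟩
    · by_contra hcon
      rcases (not_lt.mp hcon).lt_or_eq with h' | rfl
      · have := h.sorted c i hc h' g2
        omega
      · omega
    · have e2 : sym A (s.a .rx c 0 0) = sym B (s.pair c).2 := h1.2.2
      rw [e2, g3, h4.mt.2.2]
      exact h7

end Recs

/-- Write the pair of the record `cur` to its place in the output arrays. -/
def notePair : Cmd :=
  .store .ox (.ld .ru Var.cur 0 0 - 2) 0 0 (.ld .rx Var.cur 0 0) ;;
  .store .oy (.ld .ru Var.cur 0 0 - 2) 0 0 (.ld .rz Var.cur 0 0 - 1)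

/-- The output arrays hold a common increasing subsequence from the record `c` on, up to the
length `n`. -/
def Traced (A B : List ℤ) (s : St) (n c : ℕ) : Prop :=
  ∃ T, IsCIS A B (s.pair c :: T) ∧ T.length + s.a .ru c 0 0 = n + 1 ∧
    ∀ k < T.length + 1, (s.pair c :: T)[k]? =
      some (s.a .ox (s.a .ru c 0 0 - 2 + k) 0 0, s.a .oy (s.a .ru c 0 0 - 2 + k) 0 0)

theorem Traced.congr {s s' : St} {n c : ℕ} (h : Traced A B s n c) (ha : s'.a = s.a) :
    Traced A B s' n c := by
  unfold Traced St.pair at *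
  rwa [ha]

theorem isCIS_cons {p q : ℕ × ℕ} {T : List (ℕ × ℕ)} (h : IsCIS A B (q :: T)) (hp : Prec A B p q) :
    IsCIS A B (p :: q :: T) := by
  refine ⟨fun r hr => ?_, List.IsChain.cons_cons hp h.2⟩
  rcases List.mem_cons.mp hr with rfl | hr
  · exact isMatching_iff.mpr (prec_iff.mp hp).1
  · exact h.1 r hr

/-- A pair of value `v` is the `v`-th of the sequence and goes to place `v - 1`, which is its worth
minus two. The alternatives are the last pair of the sequence and a pair put before a traced part.
-/
theorem notePair_spec {s : St} {n c : ℕ} (hcur : s.v .cur = c) (hcb : c < bd) (h2 : 2 < bd)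
    (hub : s.a .ru c 0 0 < bd) (hu : 2 ≤ s.a .ru c 0 0)
    (h : (s.a .ru c 0 0 = n + 1 ∧ IsMatching A B (s.pair c)) ∨
      ∃ c', s.a .ru c 0 0 + 1 = s.a .ru c' 0 0 ∧ Prec A B (s.pair c) (s.pair c') ∧
        Traced A B s n c') :
    notePair.wp bd len (fun s' => Traced A B s' n c ∧ s'.clk ≤ s.clk + 120) s := by
  have b0 : 0 < bd := by omega
  have b1 : 1 < bd := by omega
  have hub' : s.a .ru c 0 0 - 2 < bd := by omega
  simp [notePair, hcur, b0, b1, h2, hcb, hub']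
  have e : ∀ s' : St, s'.a .rx = s.a .rx → s'.a .rz = s.a .rz → s'.pair c = s.pair c := by
    intro s' h1 h2; simp [St.pair, h1, h2]
  rcases h with ⟨h3, h4⟩ | ⟨c', h3, h4, T, h5, h6, h7⟩
  · refine ⟨[], ?_, ?_, ?_⟩
    · rw [e]
      · exact ⟨by simpa using h4, by simp⟩
      · funext i j l; simp
      · funext i j l; simp
    · simpa using h3
    · intro k hk
      obtain rfl : k = 0 := by simpa using hk
      simp [St.pair]
  · refine ⟨s.pair c' :: T, ?_, ?_, ?_⟩
    · rw [e]
      · exact isCIS_cons h5 h4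
      · funext i j l; simp
      · funext i j l; simp
    · simp; omega
    · intro k hk
      rw [e]
      · rcases k with _ | k
        · simp [St.pair]
        · have := h7 k (by simpa using hk)
          have e2 : s.a .ru c' 0 0 - 2 + k = s.a .ru c 0 0 - 2 + (k + 1) := by omega
          rw [List.getElem?_cons_succ, this, e2]
          simp
      · funext i j l; simp
      · funext i j l; simp

end Imp


/-! ## Tracing back and output -/

namespace Imp

open LCIS

variable {A B : List ℤ} {bd : ℕ} {R : Par}

/-- Take the record `i` as the predecessor of the record `cur` if possible. -/
def stepBack : Cmd :=
  .ite (.lt (Expr.ld .ru Var.i 0 0 + 1) (.ld .ru Var.cur 0 0)) .skip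
  (.ite (.lt (.ld .ru Var.i 0 0) (.ld .ru Var.cur 0 0))
  (.ite (.lt (.ld .rx Var.i 0 0) (.ld .rx Var.cur 0 0))
  (.ite (.lt (.ld .rz Var.i 0 0) (.ld .rz Var.cur 0 0))
  (.ite (.ilt (.ld .rx Var.i 0 0) (.ld .rx Var.cur 0 0))
    (Var.cur ≔ Var.i ;; notePair) .skip) .skip) .skip) .skip)

/-- There are `n` records, for all the significant pairs. -/
structure Done (A B : List ℤ) (R : Par) (n : ℕ) (s : St) : Prop where
  base : Base A B s
  recs : Recs A B R (fun X _ => X < A.length) s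
  cnt_eq : s.v .cnt = n

theorem Done.congr {s s' : St} {n : ℕ} (h : Done A B R n s)
    (hv : ∀ v, v ≠ .cur → v ≠ .i → v ≠ .j → v ≠ .k → s'.v v = s.v v)
    (ha : ∀ k, k ≠ .ox → k ≠ .oy → s'.a k = s.a k)
    (hi : s'.inp = s.inp) : Done A B R n s' := by
  exact ⟨h.base.congr (hv _ (by simp) (by simp) (by simp) (by simp))
    (hv _ (by simp) (by simp) (by simp) (by simp)) hi,
    h.recs.same (hv _ (by simp) (by simp) (by simp) (by simp)) (ha _ (by simp) (by simp))
    (ha _ (by simp) (by simp)) (ha _ (by simp) (by simp)) (ha _ (by simp) (by simp))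
    (ha _ (by simp) (by simp)), (hv _ (by simp) (by simp) (by simp) (by simp)).trans h.cnt_eq⟩

theorem Done.ru_lt {s : St} {n : ℕ} (h : Done A B R n s) (hbd : A.length + B.length + 3 < bd)
    {c : ℕ} (hc : 1 ≤ c) (hc' : c < n) :
    2 ≤ s.a .ru c 0 0 ∧ s.a .ru c 0 0 < bd ∧ s.a .rx c 0 0 < A.length ∧ s.a .rz c 0 0 < bd := by
  obtain ⟨h1, h2, h3⟩ := h.recs.pair_mt hc (by rw [h.cnt_eq]; exact hc')
  have := val_pos h1
  have := val_le h1
  have := h1.2.1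
  exact ⟨by omega, by omega, h1.1, by omega⟩

/-- By `hex` a needed predecessor of `c` has index at most `i`. If the tests reject `i`, its index
is below `i`; if they accept, `exists_precedes` provides the next predecessor below `i`. -/
theorem stepBack_spec {s : St} {n c i N : ℕ} (h : Done A B R N s)
    (hbd : A.length + B.length + 3 < bd) (hN : N < bd)
    (hi : s.v .i = i) (h1 : 1 ≤ i) (hcur : s.v .cur = c) (hic : i < c) (hc : c < N)
    (ht : Traced A B s n c)
    (hex : s.a .ru c 0 0 = 2 ∨ ∃ i', 1 ≤ i' ∧ i' < i + 1 ∧ Precedes A s i' c) :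
    stepBack.wp bd (A.length + B.length) (fun s' => ∃ c, s'.v .cur = c ∧ i ≤ c ∧ c < N ∧
      Done A B R N s' ∧ Traced A B s' n c ∧ s'.v .i = i ∧
      (s'.a .ru c 0 0 = 2 ∨ ∃ i', 1 ≤ i' ∧ i' < i ∧ Precedes A s' i' c) ∧
      s'.clk ≤ s.clk + 400) s := by
  have b0 : 0 < bd := by omega
  have b1 : 1 < bd := by omega
  have hib : i < bd := by omega
  have hcb : c < bd := by omega
  obtain ⟨i1, i2, i3, i4⟩ := h.ru_lt hbd h1 (by omega : i < N)
  obtain ⟨c1, c2, c3, c4⟩ := h.ru_lt hbd (by omega) hc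
  have hlen1 : s.a .rx i 0 0 < A.length + B.length := by omega
  have hlen2 : s.a .rx c 0 0 < A.length + B.length := by omega
  have hub : s.a .ru i 0 0 + 1 < bd := by
    obtain ⟨g1, g2, g3⟩ := h.recs.pair_mt h1 (by rw [h.cnt_eq]; omega)
    have := val_le g1
    omega
  have hno : ∀ m, m ≤ 400 → ¬ Precedes A s i c → ∃ c, (s.tick m).v .cur = c ∧ i ≤ c ∧ c < N ∧
      Done A B R N (s.tick m) ∧ Traced A B (s.tick m) n c ∧ (s.tick m).v .i = i ∧
      ((s.tick m).a .ru c 0 0 = 2 ∨ ∃ i', 1 ≤ i' ∧ i' < i ∧ Precedes A (s.tick m) i' c) ∧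
      (s.tick m).clk ≤ s.clk + 400 := by
    intro m hm hp
    refine ⟨c, hcur, hic.le, hc, h.congr (by simp) (by simp) rfl, ht.congr rfl, hi, ?_, by simpa⟩
    rcases hex with hex | ⟨i', g1, g2, g3⟩
    · exact Or.inl hex
    · refine Or.inr ⟨i', g1, ?_, g3⟩
      rcases Nat.lt_succ_iff_lt_or_eq.mp g2 with g2 | rfl
      · exact g2
      · exact absurd g3 hp
  have tt : ∀ (s : St) m m', (s.tick m).tick m' = s.tick (m + m') := by
    intro s m m'; simp [St.tick, add_assoc]
  unfold stepBack
  refine Cmd.wp_ite (by simp [Cond.ok, hi, hcur, b0, b1, hib, hcb, hub]) (fun t1 => ?_) (fun t1 => ?_)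
  · simp [Cond.holds, hi, hcur] at t1
    exact hno _ (by simp [Cond.cost]) fun hp => by have := hp.1; omega
  simp [Cond.holds, hi, hcur] at t1
  refine Cmd.wp_ite (by simp [Cond.ok, hi, hcur, b0, b1, hib, hcb, hub]) (fun t2 => ?_) (fun t2 => ?_)
  swap
  · simp [Cond.holds, hi, hcur] at t2
    rw [tt]
    exact hno _ (by simp [Cond.cost]) fun hp => by have := hp.1; omega
  simp [Cond.holds, hi, hcur] at t2
  rw [tt]
  refine Cmd.wp_ite (by simp [Cond.ok, hi, hcur, b0, b1, hib, hcb, hub]) (fun t3 => ?_) (fun t3 => ?_)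
  swap
  · simp [Cond.holds, hi, hcur] at t3
    rw [tt]
    exact hno _ (by simp [Cond.cost]) fun hp => by have := hp.2.1; omega
  simp [Cond.holds, hi, hcur] at t3
  rw [tt]
  refine Cmd.wp_ite (by simp [Cond.ok, hi, hcur, b0, b1, hib, hcb, hub]) (fun t4 => ?_) (fun t4 => ?_)
  swap
  · simp [Cond.holds, hi, hcur] at t4
    rw [tt]
    exact hno _ (by simp [Cond.cost]) fun hp => by have := hp.2.2.1; omega
  simp [Cond.holds, hi, hcur] at t4
  rw [tt]
  refine Cmd.wp_ite (by simp [Cond.ok, hi, hcur, b0, b1, hib, hcb, hub, hlen1, hlen2])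
    (fun t5 => ?_) (fun t5 => ?_)
  swap
  · simp [Cond.holds, hi, hcur, h.base.inpA _ i3, h.base.inpA _ c3] at t5
    rw [tt]
    exact hno _ (by simp [Cond.cost]) fun hp => by have := hp.2.2.2; omega
  simp [Cond.holds, hi, hcur, h.base.inpA _ i3, h.base.inpA _ c3] at t5
  rw [tt, Cmd.wp_seq', Cmd.wp_assign]
  have hp : Precedes A s i c := ⟨by omega, t3, t4, t5⟩
  refine ⟨trivial, Cmd.wp_conseq (notePair_spec (A := A) (B := B) (n := n) (c := i) (by simp [hi])
    hib (by omega) i2 i1 (Or.inr ⟨c, hp.1, h.recs.prec h1 (by rw [h.cnt_eq]; omega) (by omega)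
      (by rw [h.cnt_eq]; omega) hp, ht.congr rfl⟩)) ?_⟩
  rintro s' ⟨g1, g2⟩ hs
  have hd : Done A B R N s' := h.congr
    (fun v hv1 _ _ _ => by rw [hs.v _ rfl]; simp [hv1])
    (fun k hk1 hk2 => by
      rw [hs.a _ (by simp [notePair, Cmd.wa, beq_eq_false_iff_ne, hk1.symm, hk2.symm])]; rfl)
    (hs.inp rfl)
  refine ⟨i, by rw [hs.v _ rfl]; simp [hi], le_rfl, by omega, hd, g1,
    by rw [hs.v _ rfl]; simp [hi], ?_, ?_⟩
  · exact hd.recs.exists_precedes h1 (by rw [hd.cnt_eq]; omega)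
  · simp [Cond.cost] at g2
    omega

/-- Follow the predecessors of the record `j`. -/
def traceBack : Cmd :=
  Var.cur ≔ Var.j ;; notePair ;; Var.i ≔ Var.j ;;
  .whileDo (.lt 1 Var.i) (Var.i ≔ Var.i - 1 ;; stepBack)

theorem traceBack_spec {s : St} {j N : ℕ} (h : Done A B R N s)
    (hbd : A.length + B.length + 3 < bd) (hN : N < bd) (hj : s.v .j = j) (hj1 : 1 ≤ j) (hjN : j < N) :
    traceBack.wp bd (A.length + B.length) (fun s' => Done A B R N s' ∧ s'.v .j = j ∧
      (∃ T, IsCIS A B T ∧ T.length + 1 = s'.a .ru j 0 0 ∧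
        ∀ k < T.length, T[k]? = some (s'.a .ox k 0 0, s'.a .oy k 0 0)) ∧
      s'.clk ≤ s.clk + 500 * N) s := by
  have b0 : 0 < bd := by omega
  have b1 : 1 < bd := by omega
  obtain ⟨i1, i2, i3, i4⟩ := h.ru_lt hbd hj1 hjN
  have hm := (h.recs.pair_mt hj1 (by rw [h.cnt_eq]; exact hjN)).1
  simp only [traceBack, Cmd.wp_seq', Cmd.wp_assign, Expr.ok_var, Expr.eval_var, true_and]
  refine Cmd.wp_conseq (notePair_spec (A := A) (B := B) (n := s.a .ru j 0 0 - 1) (c := j)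
    (by simp [hj]) (by omega) (by omega) i2 i1
    (Or.inl ⟨by simp; omega, isMatching_iff.mpr hm⟩)) ?_
  rintro s1 ⟨g1, g2⟩ hs
  have hd : Done A B R N s1 := h.congr
    (fun v hv1 _ _ _ => by rw [hs.v _ rfl]; simp [hv1])
    (fun k hk1 hk2 => by
      rw [hs.a _ (by simp [notePair, Cmd.wa, beq_eq_false_iff_ne, hk1.symm, hk2.symm])]; rfl)
    (hs.inp rfl)
  have hj' : s1.v .j = j := by rw [hs.v _ rfl]; simp [hj]
  have hru : s1.a .ru = s.a .ru := hs.a _ rfl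
  rw [Cmd.wp_seq', Cmd.wp_assign]
  refine ⟨trivial, Cmd.wp_while (fun s' => ∃ i c, s'.v .i = i ∧ 1 ≤ i ∧ i ≤ j ∧ s'.v .cur = c ∧ i ≤ c ∧ c < N ∧
    s'.v .j = j ∧ s'.a .ru = s.a .ru ∧ Done A B R N s' ∧ Traced A B s' (s.a .ru j 0 0 - 1) c ∧
    (s'.a .ru c 0 0 = 2 ∨ ∃ i', 1 ≤ i' ∧ i' < i ∧ Precedes A s' i' c) ∧
    s'.clk + 450 * i ≤ s.clk + 450 * j + 200) (fun s' => s'.v .i) ?_ ?_ ?_ _ ?_⟩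
  · rintro s2 -
    simp [Cond.ok, b1]
  · rintro s2 ⟨i, c, k1, k2, k3, k4, k5, k6, k7, k8, k9, k10, k11, k12⟩ ht
    simp [Cond.holds, k1] at ht
    simp only [Cmd.wp_seq', Cmd.wp_assign, Expr.ok_sub, Expr.ok_var, Expr.ok_one, Expr.eval_sub,
      Expr.eval_var, Expr.eval_one, true_and]
    refine ⟨b1, Cmd.wp_conseq (stepBack_spec (n := s.a .ru j 0 0 - 1) (c := c) (i := i - 1)
      (k9.congr (by simp +contextual) (by simp) rfl) hbd hN (by simp [k1]) (by omega) (by simp [k4])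
      (by omega) k6 (k10.congr rfl) ?_) ?_⟩
    · rw [Nat.sub_add_cancel k2]
      exact k11
    · rintro s3 ⟨c', m1, m2, m3, m4, m5, m6, m7, m8⟩ hs3
      refine ⟨⟨i - 1, c', m6, by omega, by omega, m1, m2, m3, by rw [hs3.v _ rfl]; simp [k7],
        by rw [hs3.a _ rfl]; simpa using k8, m4, m5, m7, ?_⟩, by simp [m6, k1]; omega⟩
      simp [Cond.cost] at m8
      omega
  · rintro s2 ⟨i, c, k1, k2, k3, k4, k5, k6, k7, k8, k9, k10, k11, k12⟩ ht
    simp [Cond.holds, k1] at ht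
    -- At `i = 1` no index is left for a predecessor, so the traced sequence begins at place `0`.
    have hc2 : s2.a .ru c 0 0 = 2 := k11.resolve_right (by rintro ⟨i', h1, h2, -⟩; omega)
    refine ⟨k9.congr (by simp) (by simp) rfl, by simpa using k7, ?_, ?_⟩
    · obtain ⟨T, n1, n2, n3⟩ := k10
      refine ⟨_, n1, ?_, ?_⟩
      · simp [k8]; omega
      · intro k hk
        have := n3 k (by simpa using hk)
        rw [this, hc2]
        simp
    · simp [Cond.cost]; omega
  · refine ⟨j, j, by simp [hj'], hj1, le_rfl, ?_, le_rfl, hjN, by simpa using hj', hru,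
      hd.congr (by simp +contextual) (by simp) rfl, g1.congr rfl, ?_, ?_⟩
    · simp; rw [hs.v _ rfl]; simp [hj]
    · exact hd.recs.exists_precedes hj1 (by rw [hd.cnt_eq]; exact hjN)
    · simp at g2 ⊢
      omega

end Imp


/-! ## The complete program -/

namespace Imp

open LCIS

variable {A B : List ℤ} {bd : ℕ} {R : Par}

/-- Copy the output arrays to the input region and its length to `a`. -/
def copyOut : Cmd :=
  Var.k ≔ 0 ;; .upto .k (Expr.ld .ru Var.j 0 0 - 1)
    (.out (2 * Var.k) (.ld .ox Var.k 0 0) ;; .out (2 * Var.k + 1) (.ld .oy Var.k 0 0)) ;;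
  Var.a ≔ Expr.ld .ru Var.j 0 0 - 1

/-- The output overwrites the input, which is no longer needed and, by `hl`, long enough; the output
address is therefore `0`. -/
theorem copyOut_spec {s : St} {j len : ℕ} {T : List (ℕ × ℕ)} (hj : s.v .j = j) (hjb : j < bd)
    (hT : T.length + 1 = s.a .ru j 0 0) (hb : 2 * T.length + 3 < bd) (hl : 2 * T.length ≤ len)
    (h : ∀ k < T.length, T[k]? = some (s.a .ox k 0 0, s.a .oy k 0 0)) :
    copyOut.wp bd len (fun s' => s'.v .a = T.length ∧
      (∀ k (hk : k < T.length), s'.inp (2 * k) = T[k].1 ∧ s'.inp (2 * k + 1) = T[k].2) ∧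
      s'.clk ≤ s.clk + 100 * T.length + 100) s := by
  have b0 : 0 < bd := by omega
  have b1 : 1 < bd := by omega
  have b2 : 2 < bd := by omega
  rw [copyOut, Cmd.wp_seq', Cmd.wp_assign]
  refine ⟨b0, Cmd.wp_seq (R := fun s' => s'.v .j = j ∧ s'.a = s.a ∧
    (∀ k < T.length, s'.inp (2 * k) = s.a .ox k 0 0 ∧ s'.inp (2 * k + 1) = s.a .oy k 0 0) ∧
    s'.clk ≤ s.clk + 100 * T.length + 50) (Cmd.wp_upto (fun n s' => s'.v .k = n ∧ s'.v .j = j ∧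
    s'.a = s.a ∧ (∀ k < n, s'.inp (2 * k) = s.a .ox k 0 0 ∧ s'.inp (2 * k + 1) = s.a .oy k 0 0) ∧
    s'.clk ≤ s.clk + 100 * n + 2) 0 T.length (by omega) (by omega) ?_ ?_ ?_ ?_) ?_⟩
  · rintro k s1 ⟨h1, h2, h3, -⟩
    exact ⟨h1, by simp [h2, h3, ← hT], by simp [h2, hjb, b0, b1]⟩
  · exact ⟨by simp, by simp [hj], rfl, by simp, by simp⟩
  · rintro k s1 - hk ⟨h1, h2, h3, h4, h5⟩
    have hkb : 2 * k < bd := by omega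
    have hkb' : 2 * k + 1 < bd := by omega
    have hkb2 : k < bd := by omega
    have hkl : 2 * k < len := by omega
    have hkl' : 2 * k + 1 < len := by omega
    simp [h1, b0, b1, b2, hkb, hkb', hkb2, hkl, hkl', h2, h3]
    refine ⟨fun i hi => ?_, by omega⟩
    rcases Nat.lt_succ_iff_lt_or_eq.mp (Nat.lt_succ_of_le hi) with hi | rfl
    · have e1 : 2 * i ≠ 2 * k + 1 := by omega
      have e2 : 2 * i + 1 ≠ 2 * k := by omega
      have e3 : i ≠ k := by omega
      simp [e1, e2, e3, h4 i hi]
    · simp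
  · rintro s1 ⟨h1, h2, h3, h4, h5⟩
    exact ⟨by simpa using h2, by simpa using h3, by simpa using h4, by simp; omega⟩
  · rintro s1 ⟨h1, h2, h3, h4⟩ -
    simp [h1, h2, ← hT, hjb, b0, b1]
    refine ⟨fun k hk => ?_, by omega⟩
    have e := h k hk
    rw [List.getElem?_eq_getElem hk, Option.some.injEq] at e
    rw [e]
    exact h3 k hk

/-- Write a longest common increasing subsequence. -/
def writeOutput : Cmd := bestRecord ;; .ite (.lt 0 Var.j) traceBack .skip ;; copyOut

/-- The state holds a longest common increasing subsequence as output. -/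
def Output (A B : List ℤ) (s : St) : Prop :=
  ∃ L, IsLongestCIS A B L ∧ s.v .a = L.length ∧ 2 * L.length ≤ A.length + B.length ∧
    ∀ k (hk : k < L.length), s.inp (2 * k) = L[k].1 ∧ s.inp (2 * k + 1) = L[k].2

theorem writeOutput_spec {s : St} {N : ℕ} (h : Done A B R N s)
    (hbd : A.length + B.length + 3 < bd) (hN : N < bd) :
    writeOutput.wp bd (A.length + B.length) (fun s' => Output A B s' ∧
      s'.clk ≤ s.clk + 600 * N + 100 * (A.length + B.length) + 200) s := by
  have b0 : 0 < bd := by omega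
  have hN1 : 1 ≤ N := h.cnt_eq ▸ h.recs.cnt_pos
  unfold writeOutput
  refine Cmd.wp_seq (bestRecord_spec (by rw [h.cnt_eq]; exact hN1) (by rw [h.cnt_eq]; exact hN)) ?_
  rintro s1 ⟨h1, h2, h3⟩ hs1
  rw [h.cnt_eq] at h1 h2 h3
  have hd1 : Done A B R N s1 := h.congr (fun v _ hv1 hv2 _ => hs1.v _
    (by simp [bestRecord, Cmd.upto, Cmd.wv, beq_eq_false_iff_ne, hv1.symm, hv2.symm]))
    (fun k _ _ => hs1.a _ rfl) (hs1.inp rfl)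
  have hru : s1.a .ru = s.a .ru := hs1.a _ rfl
  generalize hj : s1.v .j = j at *
  refine Cmd.wp_seq (R := fun s' => s'.v .j = j ∧ s'.a .ru = s.a .ru ∧ (∃ T, IsCIS A B T ∧
    T.length + 1 = s'.a .ru j 0 0 ∧ ∀ k < T.length, T[k]? = some (s'.a .ox k 0 0, s'.a .oy k 0 0)) ∧
      s'.clk ≤ s1.clk + 500 * N + 20) ?_ ?_
  · refine Cmd.wp_ite (by simp [Cond.ok, b0]) (fun ht => ?_) (fun ht => ?_)
    · simp [Cond.holds, hj] at ht
      refine Cmd.wp_conseq (traceBack_spec (j := j)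
        (hd1.congr (by simp) (by simp) rfl : Done A B R N (s1.tick _)) hbd hN (by simpa using hj)
        ht h1) ?_
      rintro s2 ⟨g1, g2, g3, g4⟩ hs2
      exact ⟨g2, by rw [hs2.a _ rfl]; exact hru, g3, by simp [Cond.cost] at g4; omega⟩
    · simp [Cond.holds, hj] at ht
      -- The sentinel is best only if there is no significant pair, and the answer is the empty
      -- sequence.
      subst ht
      refine ⟨by simpa using hj, hru, ⟨[], ⟨by simp, by simp⟩, ?_, by simp⟩,
        by simp [Cond.cost]; omega⟩
      simp [hd1.recs.ru_zero]
  · rintro s2 ⟨g1, g2, ⟨T, g3, g4, g5⟩, g6⟩ -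
    have hl := g3.length_le
    refine Cmd.wp_conseq (copyOut_spec (j := j) (T := T) g1 (by omega) g4 (by omega) (by omega) g5) ?_
    rintro s3 ⟨m1, m2, m3⟩ -
    refine ⟨⟨T, isLongestCIS_of g3 fun x y hsig => ?_, m1, by omega, m2⟩, by omega⟩
    obtain ⟨i, k1, k2, k3, k4⟩ := h.recs.complete x y hsig.mt.1 hsig
    obtain ⟨k5, k6, k7⟩ := h.recs.pair_mt k1 k2
    have e : s.pair i = (x, y) := by simp [St.pair, k3, k4]
    rw [e] at k7
    have := h2 i (by rw [← h.cnt_eq]; exact k2)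
    rw [g2] at g4
    simp at k7
    omega

/-- The program. -/
def lcisProgram : Cmd :=
  Var.m ≔ Var.a + Var.b + 2 ;; sortCols ;; initPower ;; runAll ;; writeOutput

/-- `c₁`, `c₂`, `c₃`, `c` are the clock after sorting, after the choice of the first `P`, after the
runs and at the end. The runs dominate all the rest. -/
theorem total_cost {N L h h₀ c₁ c₂ c₃ cnt c : ℕ} (hL : (L + 1) * (L + 1) ≤ 8 * N) (hN : 2 ≤ N)
    (hh : h ≤ h₀) (h16 : 16 ^ h₀ ≤ N) (h1 : c₁ ≤ 20 + 2000 * N * (L + 1))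
    (h2 : c₂ ≤ c₁ + 100 * (h₀ + 1))
    (h3 : c₃ * 2 ^ h ≤ c₂ * 2 ^ h + 30000 * ((2 * h + 5) * (N * N)))
    (hcnt : cnt ≤ N / 2 ^ h * (N / 2 ^ h)) (h4 : c ≤ c₃ + 600 * cnt + 100 * N + 200) :
    (c + 12) * 2 ^ h ≤ 200000 * ((h + 1) * (N * N)) := by
  have hP16 : 2 ^ h * 2 ^ h * (2 ^ h * 2 ^ h) ≤ N := by
    rw [← mul_pow, ← mul_pow]
    exact (Nat.pow_le_pow_right (by norm_num) hh).trans h16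
  have hP1 := Nat.one_le_two_pow (n := h)
  have hh0 : h₀ ≤ N :=
    (Nat.lt_pow_self (by norm_num : 1 < 16)).le.trans h16
  generalize 2 ^ h = P at *
  have hPP : P * P ≤ N := le_trans (Nat.le_mul_of_pos_left _ (by positivity)) hP16
  have hPN : P ≤ N := le_trans (Nat.le_mul_of_pos_left _ hP1) hPP
  have hr : N / P * P ≤ N := Nat.div_mul_le_self N P
  generalize N / P = r at *
  -- The logarithm in the cost of sorting times `P`: compare squares, using `P ^ 2 ≤ N`.
  have hLP : (L + 1) * P ≤ 3 * N := by
    have : (L + 1) * P * ((L + 1) * P) ≤ 3 * N * (3 * N) := by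
      calc (L + 1) * P * ((L + 1) * P) = ((L + 1) * (L + 1)) * (P * P) := by ring
        _ ≤ 8 * N * N := Nat.mul_le_mul hL hPP
        _ ≤ _ := by nlinarith
    exact Nat.mul_self_le_mul_self_iff.mp this
  have e1 : c₁ * P ≤ 6020 * (N * N) := by
    calc c₁ * P ≤ (20 + 2000 * N * (L + 1)) * P := by gcongr
      _ = 20 * (1 * P) + 2000 * (N * ((L + 1) * P)) := by ring
      _ ≤ 20 * (N * N) + 2000 * (N * (3 * N)) := by gcongr; omega
      _ = _ := by ring
  have e2 : c₂ * P ≤ 6220 * (N * N) := by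
    calc c₂ * P ≤ (c₁ + 100 * (h₀ + 1)) * P := by gcongr
      _ = c₁ * P + 100 * ((h₀ + 1) * P) := by ring
      _ ≤ 6020 * (N * N) + 100 * ((N + N) * N) := by gcongr; omega
      _ = _ := by ring
  have e3 : cnt * P ≤ N * N := by
    calc cnt * P ≤ r * r * P := by gcongr
      _ ≤ r * r * P * P := Nat.le_mul_of_pos_right _ hP1
      _ = (r * P) * (r * P) := by ring
      _ ≤ _ := by gcongr
  have e5 : (2 * h + 5) * (N * N) ≤ 5 * ((h + 1) * (N * N)) := by nlinarith
  have e6 : N * N ≤ (h + 1) * (N * N) := Nat.le_mul_of_pos_left _ (by omega)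
  have e7 : N * P ≤ N * N := Nat.mul_le_mul_left _ hPN
  have e8 : P ≤ N * N := hPN.trans (Nat.le_mul_of_pos_left _ (by omega))
  calc (c + 12) * P ≤ (c₃ + 600 * cnt + 100 * N + 200 + 12) * P := by gcongr
    _ = c₃ * P + 600 * (cnt * P) + 100 * (N * P) + 212 * P := by ring
    _ ≤ _ := by omega

theorem lcisProgram_spec {s : St} (hs : Base A B s) (hclk : s.clk = 0)
    (hbd : (A.length + B.length + 2) ^ 8 ≤ bd) :
    lcisProgram.wp bd (A.length + B.length) (fun s' => Output A B s' ∧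
      ∃ h h₀, h ≤ h₀ ∧ 16 ^ h ≤ A.length + B.length + 2 ∧ A.length + B.length + 2 < 16 * 16 ^ h₀ ∧
      (h = h₀ ∨ (A.length + B.length + 2) / 2 ^ (h + 1) * ((A.length + B.length + 2) / 2 ^ (h + 1)) ≤
        numSignificant A B) ∧
      (s'.clk + 12) * 2 ^ h ≤ 200000 * ((h + 1) *
        ((A.length + B.length + 2) * (A.length + B.length + 2)))) s := by
  have hN2 : 2 ≤ A.length + B.length + 2 := by omega
  have hb : 64 * ((A.length + B.length + 2) * (A.length + B.length + 2)) ≤ bd := by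
    refine le_trans ?_ hbd
    calc 64 * ((A.length + B.length + 2) * (A.length + B.length + 2))
        = 2 ^ 6 * (A.length + B.length + 2) ^ 2 := by ring
      _ ≤ (A.length + B.length + 2) ^ 6 * (A.length + B.length + 2) ^ 2 := by gcongr
      _ = _ := by ring
  have hNN : A.length + B.length + 2 ≤ (A.length + B.length + 2) * (A.length + B.length + 2) :=
    Nat.le_mul_of_pos_left _ (by omega)
  have hl : 4 * (A.length + B.length) + 20 < bd := by omega
  have hAB : A.length * B.length + 1 < bd := by nlinarith
  have b2 : 2 < bd := by omega
  unfold lcisProgram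
  rw [Cmd.wp_seq', Cmd.wp_assign]
  refine ⟨by simp [hs.a, hs.b]; omega, ?_⟩
  refine Cmd.wp_seq (sortCols_spec (hs.congr (by simp) (by simp) (by simp)) hl) ?_
  rintro s1 ⟨L, h1, h2, h3, h4, h5, h6⟩ hs1
  have hb1 : Base A B s1 := (hs.congr (by simp) (by simp) (by simp) : Base A B
    ((s.set Var.m _).tick _)).same hs1 rfl rfl rfl
  have hm1 : s1.v .m = A.length + B.length + 2 := by
    rw [hs1.v _ rfl]; simp [hs.a, hs.b]
  have hS1 : Sorted B L s1 := ⟨h1, h2, h4, h5⟩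
  refine Cmd.wp_seq (initPower_spec hm1 (by omega) hb) ?_
  rintro s2 ⟨h₀, g1, g2, g3, g4, g5⟩ hs2
  have hpm : 2 ^ h₀ * 2 ^ h₀ ≤ A.length + B.length + 2 := by
    refine le_trans ?_ g3
    rw [← mul_pow]
    exact Nat.pow_le_pow_left (by norm_num) _
  refine Cmd.wp_seq (runAll_spec (hb1.same hs2 rfl rfl rfl)
    (hS1.congr (hs2.v _ rfl) (hs2.a _ rfl)) g2 g1 ((hs2.v _ rfl).trans hm1) hpm hb) ?_
  rintro s3 ⟨k1, R, k2, h, k3, k4, k5, k6⟩ -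
  refine Cmd.wp_conseq (writeOutput_spec (R := R) (N := s3.v .cnt) ⟨k1, k2, rfl⟩ (by omega)
    (by have := k2.cnt_le; omega)) ?_
  rintro s4 ⟨m1, m2⟩ -
  refine ⟨m1, h, h₀, k3, (Nat.pow_le_pow_right (by norm_num) k3).trans g3, g4, k4,
    total_cost (c₁ := s1.clk) (c₂ := s2.clk) (c₃ := s3.clk) (cnt := s3.v .cnt) h3 hN2 k3 g3 ?_ g5 k6
      k5 (by omega)⟩
  have e : 2000 * (B.length + 1) * (L + 1) ≤ 2000 * (A.length + B.length + 2) * (L + 1) := by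
    exact Nat.mul_le_mul_right _ (by omega)
  simp only [St.tick_clk, St.set_clk, hclk, Expr.cost_add, Expr.cost_var, Expr.cost_ofNat] at h6
  linarith

end Imp


/-! ## The running time -/

namespace Imp

open LCIS

/-- Here `u` is `log log n`, `M` is `|A| + |B| + 2` and `P = 2 ^ h`. If `t ≤ P`, then `(h + 1) √t ≤
4 P` and the cost `(h + 1) M ^ 2 / P` is `O(n ^ 2 / √t)`. If `t > P`, then `h log 2 < log t ≤ c u`,
and `hcase` controls `M ^ 2 / P`. -/
theorem time_bound {n t u c D M k : ℝ} {h : ℕ} (hn : 1 ≤ n) (ht : 0 < t) (hu : 1 ≤ u)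
    (hc : 0 ≤ c) (hD : 0 ≤ D) (hk : 0 ≤ k) (hM : 0 ≤ M) (hMn : M ≤ 3 * n)
    (hlog : Real.log t ≤ c * u) (hlog' : 9 * Real.log t ≤ 2 * Real.log n)
    (hcost : k * 2 ^ h ≤ 200000 * ((h + 1) * (M * M)))
    (hcase : M ≤ 16 * 16 ^ h ∨ M ≤ 2 * 2 ^ h * (D * n / √t + 1)) :
    k ≤ 60000000 * (2 * c + 1) * (D + 1) * (n ^ 2 * u ^ 2 / √t) := by
  have hr : 0 < √t := Real.sqrt_pos.mpr ht
  have hrr : √t * √t = t := Real.mul_self_sqrt ht.le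
  have ht9 : t ^ 9 ≤ n ^ 2 := by
    rw [← Real.log_le_log_iff (by positivity) (by positivity), Real.log_pow, Real.log_pow]
    exact_mod_cast hlog'
  rw [← mul_div_assoc, le_div_iff₀ hr]
  generalize hP : (2 : ℝ) ^ h = P at *
  generalize √t = r at *
  have hP1 : 1 ≤ P := hP ▸ one_le_pow₀ (by norm_num)
  have hP0 : 0 < P := by linarith
  have huu : u ≤ u ^ 2 := by nlinarith
  have hMM : M * M ≤ 9 * n ^ 2 := by nlinarith
  have hn2 : 0 < n ^ 2 := by positivity
  have hcD : 1 ≤ (2 * c + 1) * (D + 1) := by nlinarith [mul_nonneg hc hD]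
  rcases le_or_gt t P with htP | htP
  · have h1 : (h + 1 : ℝ) * r ≤ 4 * P := by
      have hs : ((h : ℝ) + 1) * (h + 1) ≤ 16 * P := by
        have : ((h : ℝ) + 1) * (h + 1) ≤ 4 * 2 ^ h := by exact_mod_cast succ_sq_le h
        linarith
      refine abs_le_of_sq_le_sq' ?_ (by positivity) |>.2
      calc ((h + 1 : ℝ) * r) ^ 2 = (h + 1) * (h + 1) * (r * r) := by ring
        _ ≤ 16 * P * P := by rw [hrr]; gcongr
        _ = _ := by ring
    have h2 : k * r ≤ 800000 * (M * M) := by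
      refine le_of_mul_le_mul_right ?_ hP0
      calc k * r * P = k * P * r := by ring
        _ ≤ 200000 * ((h + 1) * (M * M)) * r := by gcongr
        _ = 200000 * (M * M) * ((h + 1) * r) := by ring
        _ ≤ 200000 * (M * M) * (4 * P) := by gcongr
        _ = _ := by ring
    have h3 : n ^ 2 ≤ (2 * c + 1) * (D + 1) * (n ^ 2 * u ^ 2) := by
      calc n ^ 2 = 1 * (n ^ 2 * 1) := by ring
        _ ≤ _ := by gcongr; nlinarith
    calc k * r ≤ 800000 * (9 * n ^ 2) := by linarith
      _ ≤ 60000000 * ((2 * c + 1) * (D + 1) * (n ^ 2 * u ^ 2)) := by linarith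
      _ = _ := by ring
  · have ht1 : 1 ≤ t := hP1.trans htP.le
    have h1 : (h + 1 : ℝ) ≤ (2 * c + 1) * u ^ 2 := by
      have h2 : (h : ℝ) * Real.log 2 ≤ c * u := by
        rw [← Real.log_pow, hP]
        exact (Real.log_le_log hP0 htP.le).trans hlog
      have h3 : (h : ℝ) * (1 / 2) ≤ h * Real.log 2 := by
        gcongr
        linarith [Real.log_two_gt_d9]
      have h4 : c * u ≤ c * u ^ 2 := by gcongr
      nlinarith
    have hr1 : 1 ≤ r := by nlinarith
    have hrt : r ≤ t := by nlinarith
    have h5 : k * r ≤ 60000000 * ((h + 1) * ((D + 1) * n ^ 2)) := by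
      rcases hcase with h2 | h2
      · have e16 : (16 : ℝ) ^ h = P ^ 4 := by
          rw [← hP, ← pow_mul, mul_comm, pow_mul]; norm_num
        rw [e16] at h2
        -- No run was cut off, so `M ≤ 16 P ^ 4 ≤ 16 t ^ 4`, and `t ^ 9 ≤ n ^ 2` absorbs everything.
        -- The product `200000 * 256` is the largest constant and fits under `60000000`.
        have h3 : M * M ≤ 256 * t ^ 8 := by
          calc M * M ≤ (16 * P ^ 4) * (16 * P ^ 4) := by gcongr
            _ = 256 * P ^ 8 := by ring
            _ ≤ _ := by gcongr
        calc k * r ≤ k * P * t := by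
              have : k ≤ k * P := by nlinarith
              gcongr
          _ ≤ 200000 * ((h + 1) * (M * M)) * t := by gcongr
          _ ≤ 200000 * ((h + 1) * (256 * t ^ 8)) * t := by gcongr
          _ = 51200000 * ((h + 1) * (1 * t ^ 9)) := by ring
          _ ≤ 60000000 * ((h + 1) * ((D + 1) * n ^ 2)) := by
              gcongr <;> linarith
      -- Some run was cut off: one factor `M` is bounded by `3 n`, the other by `hcase`, whose
      -- factor `P` cancels.
      · have hrn : r ≤ n := by
          have : r ^ 2 ≤ n ^ 2 := by
            calc r ^ 2 = t := by rw [← hrr]; ring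
              _ ≤ t ^ 9 := le_self_pow₀ ht1 (by norm_num)
              _ ≤ _ := ht9
          exact abs_le_of_sq_le_sq' this (by linarith) |>.2
        refine le_of_mul_le_mul_right ?_ hP0
        calc k * r * P = k * P * r := by ring
          _ ≤ 200000 * ((h + 1) * (M * M)) * r := by gcongr
          _ ≤ 200000 * ((h + 1) * (3 * n * (2 * P * (D * n / r + 1)))) * r := by gcongr
          _ = 1200000 * ((h + 1) * (n * (D * n / r * r + r))) * P := by ring
          _ = 1200000 * ((h + 1) * (n * (D * n + r))) * P := by
              rw [div_mul_cancel₀ _ (by linarith)]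
          _ ≤ 1200000 * ((h + 1) * (n * (D * n + n))) * P := by gcongr
          _ = 1200000 * ((h + 1) * ((D + 1) * n ^ 2)) * P := by ring
          _ ≤ 60000000 * ((h + 1) * ((D + 1) * n ^ 2)) * P := by gcongr; norm_num
    calc k * r ≤ 60000000 * ((h + 1) * ((D + 1) * n ^ 2)) := h5
      _ ≤ 60000000 * ((2 * c + 1) * u ^ 2 * ((D + 1) * n ^ 2)) := by gcongr
      _ = _ := by ring

/-- Take the square root of `h1` and undo the integer division. The maximum with `0` allows a
negative `C`. -/
theorem le_of_div_sq_le {M h S : ℕ} {n t C : ℝ} (hn : 0 ≤ n) (ht : 0 < t)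
    (h1 : M / 2 ^ (h + 1) * (M / 2 ^ (h + 1)) ≤ S) (h2 : (S : ℝ) ≤ C * (n ^ 2 / t)) :
    (M : ℝ) ≤ 2 * 2 ^ h * (√(max C 0) * n / √t + 1) := by
  have h3 : M < 2 ^ (h + 1) * (M / 2 ^ (h + 1) + 1) := Nat.lt_mul_div_succ M (by positivity)
  generalize M / 2 ^ (h + 1) = q at *
  have h4 : (q : ℝ) ≤ √(max C 0) * n / √t := by
    have e : √(max C 0) * n / √t = √(max C 0 * (n ^ 2 / t)) := by
      rw [Real.sqrt_mul (le_max_right _ _), Real.sqrt_div (by positivity), Real.sqrt_sq hn,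
        mul_div_assoc]
    rw [e]
    refine Real.le_sqrt_of_sq_le ?_
    calc (q : ℝ) ^ 2 = q * q := by ring
      _ ≤ S := by exact_mod_cast h1
      _ ≤ C * (n ^ 2 / t) := h2
      _ ≤ _ := by gcongr; exact le_max_left _ _
  calc (M : ℝ) ≤ 2 ^ (h + 1) * (q + 1) := by exact_mod_cast h3.le
    _ = 2 * 2 ^ h * (q + 1) := by ring
    _ ≤ _ := by gcongr

/-- Since `log log n` is `o(log n)`, eventually `(9 c + 1) log log n ≤ log n`, which gives the last
bound, that is `t ^ 9 ≤ n ^ 2`. -/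
theorem eventually_bounds (t : ℕ → ℝ) (ht_pos : ∀ᶠ n in atTop, 0 < t n)
    (ht : (fun n : ℕ => Real.log (t n)) =O[atTop] fun n : ℕ => Real.log (Real.log n)) :
    ∃ c, 0 ≤ c ∧ ∀ᶠ n : ℕ in atTop, 2 ≤ n ∧ 0 < t n ∧ 1 ≤ Real.log (Real.log n) ∧
      Real.log (t n) ≤ c * Real.log (Real.log n) ∧ 9 * Real.log (t n) ≤ 2 * Real.log n := by
  obtain ⟨c, hc, hO⟩ := ht.exists_nonneg
  refine ⟨c, hc, ?_⟩
  have hl : Tendsto (fun n : ℕ => Real.log n) atTop atTop :=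
    Real.tendsto_log_atTop.comp tendsto_natCast_atTop_atTop
  have hll := Real.tendsto_log_atTop.comp hl
  have ho := (Real.isLittleO_log_id_atTop.comp_tendsto hl).def (c := 1 / (9 * c + 1)) (by positivity)
  filter_upwards [hO.bound, hll.eventually_ge_atTop 1, hl.eventually_ge_atTop 0, ho, ht_pos,
    eventually_ge_atTop 2] with n h1 h2 h3 h4 h5 h6
  simp only [Function.comp_apply, Real.norm_eq_abs, id] at h1 h2 h4
  rw [abs_of_nonneg (by linarith : 0 ≤ Real.log (Real.log n))] at h1 h4
  rw [abs_of_nonneg h3] at h4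
  have h7 := (le_abs_self _).trans h1
  refine ⟨h6, h5, h2, h7, ?_⟩
  rw [div_mul_eq_mul_div, one_mul, le_div_iff₀ (by positivity)] at h4
  nlinarith

theorem Base.of_input {A B : List ℤ} {s : St} (ha : s.v .a = A.length) (hb : s.v .b = B.length)
    (h : ∀ i (hi : i < (A ++ B).length), s.inp i = (A ++ B)[i]) : Base A B s := by
  refine ⟨ha, hb, fun x hx => ?_, fun y hy => ?_⟩
  · rw [h x (by simp; omega), List.getElem_append_left hx]
    simp [sym, hx]
  · rw [h _ (by simp; omega), List.getElem_append_right (by omega)]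
    simp [sym, hy]

end Imp

theorem theorem2 (t : ℕ → ℝ) (ht_pos : ∀ᶠ n in atTop, 0 < t n)
    (ht : (fun n : ℕ => Real.log (t n)) =Θ[atTop] fun n : ℕ => Real.log (Real.log n)) :
    ∃ (P : WordRAM.Program) (κ : ℕ), ∀ C : ℝ, ∃ (K : ℝ) (N : ℕ),
      ∀ (A B : List ℤ) (w : ℕ) (s : WordRAM.State),
        (A.length + B.length + 2) ^ κ ≤ 2 ^ w → WordRAM.IsInput w A B s →
        ∃ (k : ℕ) (s' : WordRAM.State) (L : List (ℕ × ℕ)),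
          WordRAM.HaltsIn w P s k s' ∧ WordRAM.IsOutput L s' ∧ LCIS.IsLongestCIS A B L ∧
          ∀ n : ℕ, N ≤ n → A.length ≤ n → B.length ≤ n →
            (LCIS.numSignificant A B : ℝ) ≤ C * ((n : ℝ) ^ 2 / t n) →
            (k : ℝ) ≤ K * ((n : ℝ) ^ 2 * Real.log (Real.log n) ^ 2 / √(t n)) := by
  obtain ⟨c, hc, hev⟩ := Imp.eventually_bounds t ht_pos ht.1
  obtain ⟨N, hN⟩ := eventually_atTop.mp hev
  -- One program serves all `t` and `C`; only the constants of the analysis depend on them. The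
  -- exponent `30` comes from `Cmd.program_correct`.
  refine ⟨Imp.lcisProgram.program, 30, fun C =>
    ⟨60000000 * (2 * c + 1) * (√(max C 0) + 1), N, fun A B w s hw hs => ?_⟩⟩
  obtain ⟨k, m', s', h1, h2, ⟨⟨L, h3, h4, h5, h6⟩, h, h₀, g1, -, g2, g3, g4⟩, h7, h8, h9⟩ :=
    Imp.lcisProgram.program_correct hw hs fun s ha hb hclk hin =>
      Imp.lcisProgram_spec (Imp.Base.of_input ha hb hin) hclk le_rfl
  refine ⟨k, m', L, h1, ⟨by rw [h7, h4], 0, by simpa using h8, fun i hi => ?_⟩, h3,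
    fun n hn hA hB hS => ?_⟩
  · rw [zero_add, h9 _ (by omega), h9 _ (by omega)]
    exact h6 i hi
  · obtain ⟨n1, n2, n3, n4, n5⟩ := hN n hn
    have hcost : k * 2 ^ h ≤ 200000 * ((h + 1) *
        ((A.length + B.length + 2) * (A.length + B.length + 2))) :=
      (Nat.mul_le_mul_right _ h2).trans g4
    refine Imp.time_bound (M := (A.length + B.length + 2 : ℕ)) (h := h) (by exact_mod_cast (by omega : 1 ≤ n)) n2 n3
      hc (Real.sqrt_nonneg _) (Nat.cast_nonneg _) (Nat.cast_nonneg _)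
      (by exact_mod_cast (by omega : A.length + B.length + 2 ≤ 3 * n)) n4 n5
      (by exact_mod_cast hcost) ?_
    -- Either the first choice of `P` succeeded, or the run before the last was cut off.
    rcases g3 with rfl | g3
    · left
      exact_mod_cast g2.le
    · right
      exact Imp.le_of_div_sq_le (Nat.cast_nonneg _) n2 g3 hS
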